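/- Let $G$ be a connected undirected graph with $n\ge 2$ vertices, $m$ edges and positive edge weights, with distance $d_G$; let $h\ge 1$ be an integer and $t=(4/3)^h$. The randomized path-reporting distance oracle $\Lambda_h$ is the following data structure. **Landmarks.** For $1\le i\le h$ let $p_i=\rho_i/n$ with $\rho_i=n^{1-(3/4)^{h-i+1}}$. Every vertex $u$ has $\lceil \deg(u)/(m/n)\rceil$ virtual copies; for every level $i$ every copy is selected independently with probability $p_i$, and $L_i$ is the set of vertices with a copy selected at level $i$. Let $\ell_i(v)$ be the vertex of $L_i$ closest to $v$ (ties broken consistently), $r_i(v)=d_G(v,\ell_i(v))$ ($=\infty$ if $L_i=\emptyset$), and, for $0<c\le 1$, $\mathcal B_i^{c}(v)=\{u: d_G(v,u)<c\,r_i(v)\}$. Let $\mathcal P_h=L_h\times L_h$, and for $i<h$ let $\mathcal P_i$ be the set of pairs $(u,v)$ in $L_i\times L_i$ with $v\in\mathcal B^{1/3}_{i+1}(u)$ or $u\in\mathcal B^{1/3}_{i+1}(v)$. **Stored data.** Besides $G$, the oracle stores for every $i\le h$: the parent pointers of the forest of shortest path trees rooted at the vertices of $L_i$, where $v$ belongs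 to the tree of $\ell_i(v)$; a hash table for $\mathcal P_i$; and a distance-preserving path-reporting oracle for $\mathcal P_i$. For shortest paths $\Pi(x,y)$ chosen with consistent tie-breaking, the latter stores the first and the last edge of each $\Pi(x,y)$, $(x,y)\in\mathcal P_i$; for each vertex that is internal to one of these paths one such path (its home path) and the two edges of that path at the vertex; and, for each branching event, i.e. each two distinct stored paths and a common vertex at which their sets $\{\text{predecessor},\text{successor}\}$ differ, the edges of both paths at this vertex. With it $\Pi(x,y)$ is traced edge by edge: at each inner vertex one looks up whether $\Pi(x,y)$ and the home path of the vertex branch there, and otherwise follows the home path. **Query** $(u,v)$. Explore $G$ from $v$ (by breadth-first search if $G$ is unweighted, by Dijkstra's algorithm if it is weighted) until $u$ or a vertex of $L_1$ is reached, and, if $u$ was not reached, likewise from $u$ until $v$ or a vertex of $L_1$ is reached. If the other endpoint was reached, report the shortest path found. Otherwise put $u^{(1)}=\ell_1(u)$, $v^{(1)}=\ell_1(v)$ and, for $j=1,2,\dots$, if $j=h$ or $(u^{(j)},v^{(j)})\in\mathcal P_j$, report the concatenation of the tree paths from $u$ through $u^{(1)},\dots$ to $u^{(j)}$, the path $\Pi(u^{(j)},v^{(j)})$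 and the tree paths from $v^{(j)}$ back to $v$; else continue with $u^{(j+1)}=\ell_{j+1}(u^{(j)})$, $v^{(j+1)}=\ell_{j+1}(v^{(j)})$. Space is counted in machine words and time in unit-cost operations (including look-ups in hash tables of linear size with keys of $O(1)$ words). A bound on the query time is understood up to an additive $O(|\Pi|)$, where $|\Pi|$ is the number of edges of the reported path $\Pi$. **Statement.** With absolute constants in all $O(\cdot)$: 1. $\Lambda_h$ uses expected space $O(n\cdot h)$ in addition to the space required to store $G$. 2. Its stretch is at most $t^{\log_{4/3}7}$: with certainty, every query $(u,v)$ is answered by a walk in $G$ from $u$ to $v$ of length between $d_G(u,v)$ and $t^{\log_{4/3}7}\cdot d_G(u,v)$. 3. If $G$ is unweighted (all weights are $1$), then for every query $(u,v)$ the expected query time is $O\big(n^{1/t}\cdot (m/n)+\log t\big)$. 4. If $G$ is weighted, then for every query $(u,v)$ the expected query time is $O\big(n^{1/t}\cdot(m/n)\cdot\log n+\log t\big)$; in particular, it is $O\big(n^{1/t}\cdot(m/n)\cdot\log n\big)$ whenever $t\le n$. -/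

import Mathlib

open scoped Classical

noncomputable section

namespace PathOracle

/-! ## Weighted graphs, distances, and a consistent choice of shortest paths -/

/-- An undirected graph on the vertices `0, …, n - 1` whose edges have positive weights. -/
structure WGraph (n : ℕ) where
  graph : SimpleGraph (Fin n)
  wt : Sym2 (Fin n) → ℝ
  wt_pos : ∀ e ∈ graph.edgeSet, 0 < wt e

namespace WGraph

variable {n : ℕ} (W : WGraph n)

/-- All edges have weight one. -/
def Unweighted : Prop := ∀ e ∈ W.graph.edgeSet, W.wt e = 1

/-- The weighted length of a walk. -/
def len {u v : Fin n} (p : W.graph.Walk u v) : ℝ := (p.edges.map W.wt).sum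

/-- The weighted graph distance `d_G(u, v)` (of two vertices in the same component). -/
def dist (u v : Fin n) : ℝ := ⨅ p : W.graph.Walk u v, W.len p

/-- The neighbours of `v`. -/
def nbrs (v : Fin n) : Finset (Fin n) := Finset.univ.filter fun x => W.graph.Adj v x

/-- The degree of `v`. -/
def deg (v : Fin n) : ℕ := (W.nbrs v).card

/-- The number `m` of edges. -/
def numEdges : ℕ := W.graph.edgeSet.ncard

/-- The graph as it is stored: the list of the edges at `v`, each with its weight. -/
def adj (v : Fin n) : List (Fin n × ℝ) := ((W.nbrs v).sort).map fun x => (x, W.wt s(v, x))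

/-- A number that determines the edge set of a path; it serves to break ties between shortest
paths in a way that is symmetric and consistent on subpaths. -/
def code {u v : Fin n} (p : W.graph.Walk u v) : ℕ :=
  (p.darts.map fun d => 2 ^ ((min d.fst d.snd : Fin n).val * n + (max d.fst d.snd : Fin n).val)).sum

theorem exists_canonical {u v : Fin n} (h : W.graph.Reachable u v) :
    ∃ p : W.graph.Path u v, ∀ q : W.graph.Path u v,
      toLex (W.len p.1, W.code p.1) ≤ toLex (W.len q.1, W.code q.1) := by
  obtain ⟨p⟩ := h
  have : Nonempty (W.graph.Path u v) := ⟨p.toPath⟩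
  exact Finite.exists_min fun q : W.graph.Path u v => toLex (W.len q.1, W.code q.1)

/-- The vertex list of the chosen shortest path `Π(u, v)` from `u` to `v`. -/
def sp (u v : Fin n) : List (Fin n) :=
  if h : W.graph.Reachable u v then (W.exists_canonical h).choose.1.support else []

end WGraph

/-- The vertex that follows `x` on the path `l`, if any. -/
def succOn {n : ℕ} : List (Fin n) → Fin n → Option (Fin n)
  | a :: b :: l, x => if a = x then some b else succOn (b :: l) x
  | _, _ => none

/-- The vertex that precedes `x` on the path `l`, if any. -/
def predOn {n : ℕ} (l : List (Fin n)) (x : Fin n) : Option (Fin n) := succOn l.reverse x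

/-! ## Computations with a step count -/

/-- A value together with the number of unit-cost steps spent on computing it. A step is a constant
number of operations on machine words: a memory access, a look-up in a hash table whose keys
consist of a constant number of words, a comparison or an addition. -/
structure Timed (α : Type) where
  val : α
  cost : ℕ

instance : Monad Timed where
  pure a := ⟨a, 0⟩
  bind x f := ⟨(f x.val).val, x.cost + (f x.val).cost⟩

/-- Spend `k` steps. -/
def tick (k : ℕ) : Timed Unit := ⟨(), k⟩

/-! ## A mergeable priority queue (leftist heap) -/

inductive Heap (α : Type) where
  | empty : Heap α
  | node (rank : ℕ) (key : ℝ) (val : α) (left right : Heap α) : Heap α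

namespace Heap

variable {α : Type}

def rank : Heap α → ℕ
  | empty => 0
  | node r _ _ _ _ => r

def mk (k : ℝ) (x : α) (a b : Heap α) : Heap α :=
  if b.rank ≤ a.rank then node (b.rank + 1) k x a b else node (a.rank + 1) k x b a

def merge : Heap α → Heap α → Timed (Heap α)
  | empty, b => do tick 1; return b
  | node r k x l s, empty => do tick 1; return node r k x l s
  | node r k x l s, node r' k' x' l' s' =>
    if k ≤ k' then do
      tick 1
      let t ← merge s (node r' k' x' l' s')
      return mk k x l t
    else do
      tick 1
      let t ← merge (node r k x l s) s'
      return mk k' x' l' t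

end Heap

/-! ## The two graph explorations

Both explorations start at `src` and settle vertices one by one. They end at the first settled
vertex that is `target` or satisfies `halt`. If it is `target` then the result is the table of
parent pointers of the search tree, otherwise it is `none`. The first argument of a loop only
makes the recursion structural. -/

/-- The memory of a search: tentative distances, parent pointers, settled marks, priority queue. -/
structure DState (n : ℕ) where
  dist : Fin n → Option ℝ
  par : Fin n → Option (Fin n)
  settled : Fin n → Bool
  heap : Heap (Fin n)

/-- Relax the edges from `x`, which is at distance `k` from the source. -/
def relaxAll {n : ℕ} (x : Fin n) (k : ℝ) : List (Fin n × ℝ) → DState n → Timed (DState n)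
  | [], s => do tick 1; return s
  | (y, w) :: l, s => do
    tick 1
    let improves : Bool := match s.dist y with
      | none => true
      | some d => decide (k + w < d)
    if improves then do
      let hp ← Heap.merge s.heap (Heap.node 1 (k + w) y Heap.empty Heap.empty)
      relaxAll x k l
        { s with
          dist := Function.update s.dist y (some (k + w))
          par := Function.update s.par y (some x)
          heap := hp }
    else relaxAll x k l s

def dijkstraLoop {n : ℕ} (adj : Fin n → List (Fin n × ℝ)) (halt : Fin n → Bool)
    (target : Fin n) : ℕ → DState n → Timed (Option (Fin n → Option (Fin n)))
  | 0, _ => return none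
  | f + 1, s => do
    tick 1
    match s.heap with
    | Heap.empty => return none
    | Heap.node _ k x l r => do
      let hp ← Heap.merge l r
      if s.settled x then dijkstraLoop adj halt target f { s with heap := hp }
      else if x = target then return some s.par
      else if halt x then return none
      else do
        let s' ← relaxAll x k (adj x)
          { s with heap := hp, settled := Function.update s.settled x true }
        dijkstraLoop adj halt target f s'

/-- Dijkstra's algorithm. -/
def dijkstra {n : ℕ} (adj : Fin n → List (Fin n × ℝ)) (halt : Fin n → Bool)
    (src target : Fin n) : Timed (Option (Fin n → Option (Fin n))) :=
  dijkstraLoop adj halt target (n * n + 2)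
    { dist := Function.update (fun _ => none) src (some 0)
      par := fun _ => none
      settled := fun _ => false
      heap := Heap.node 1 0 src Heap.empty Heap.empty }

/-- The memory of a breadth-first search: parent pointers, discovered marks, and a FIFO queue
(an array with two pointers, so that each queue operation is one step). -/
structure BState (n : ℕ) where
  par : Fin n → Option (Fin n)
  seen : Fin n → Bool
  queue : List (Fin n)

def scanAll {n : ℕ} (x : Fin n) : List (Fin n × ℝ) → BState n → Timed (BState n)
  | [], s => do tick 1; return s
  | (y, _) :: l, s => do
    tick 1
    if s.seen y then scanAll x l s
    else
      scanAll x l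
        { par := Function.update s.par y (some x)
          seen := Function.update s.seen y true
          queue := s.queue ++ [y] }

def bfsLoop {n : ℕ} (adj : Fin n → List (Fin n × ℝ)) (halt : Fin n → Bool)
    (target : Fin n) : ℕ → BState n → Timed (Option (Fin n → Option (Fin n)))
  | 0, _ => return none
  | f + 1, s => do
    tick 1
    match s.queue with
    | [] => return none
    | x :: q =>
      if x = target then return some s.par
      else if halt x then return none
      else do
        let s' ← scanAll x (adj x) { s with queue := q }
        bfsLoop adj halt target f s'

/-- Breadth-first search, the exploration for unweighted graphs. -/
def bfs {n : ℕ} (adj : Fin n → List (Fin n × ℝ)) (halt : Fin n → Bool)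
    (src target : Fin n) : Timed (Option (Fin n → Option (Fin n))) :=
  bfsLoop adj halt target (n + 1)
    { par := fun _ => none
      seen := Function.update (fun _ => false) src true
      queue := [src] }

/-- An exploration procedure: stored graph, stopping predicate, source, target. -/
abbrev Search (n : ℕ) : Type :=
  (Fin n → List (Fin n × ℝ)) → (Fin n → Bool) → Fin n → Fin n →
    Timed (Option (Fin n → Option (Fin n)))

/-! ## The distance-preserving path-reporting oracle (DPPRO) -/

/-- A stored (hash) table: a partial map, of which only the keys with a value are stored. -/
def entries {K A : Type} [Fintype K] (T : K → Option A) : ℕ :=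
  (Finset.univ.filter fun k => (T k).isSome).card

/-- The data of a DPPRO for a set of ordered pairs. The pair `(x, y)` serves as the identity of the
path `Π(x, y)`. An edge of a path at a known vertex is given by its other endpoint; it is `none`
where the path starts or ends. -/
structure Dppro (n : ℕ) where
  /-- for each pair `(x, y)`, the first and the last edge of `Π(x, y)` -/
  ends : Fin n × Fin n → Option (Option (Fin n) × Option (Fin n))
  /-- for a vertex `v`, its home path and the two edges of this path at `v` -/
  home : Fin n → Option ((Fin n × Fin n) × Fin n × Fin n)
  /-- for each branching event `(Π, Π', v)`, the edges of `Π` into and out of `v`, and the same for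
  `Π'` -/
  branch : (Fin n × Fin n) × (Fin n × Fin n) × Fin n →
    Option ((Option (Fin n) × Option (Fin n)) × (Option (Fin n) × Option (Fin n)))

/-- The size in machine words; each record is stored with its key. -/
def Dppro.size {n : ℕ} (D : Dppro n) : ℕ :=
  4 * entries D.ends + 5 * entries D.home + 9 * entries D.branch

namespace WGraph

variable {n : ℕ} (W : WGraph n)

/-- The (unordered pair of) neighbours of `x` on `Π(e.1, e.2)`. -/
def around (e : Fin n × Fin n) (x : Fin n) : Sym2 (Option (Fin n)) :=
  s(predOn (W.sp e.1 e.2) x, succOn (W.sp e.1 e.2) x)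

/-- `(Π(e), Π(e'), x)` is a branching event. -/
def IsBranching (e e' : Fin n × Fin n) (x : Fin n) : Prop :=
  W.sp e.1 e.2 ≠ W.sp e'.1 e'.2 ∧ x ∈ W.sp e.1 e.2 ∧ x ∈ W.sp e'.1 e'.2 ∧
    W.around e x ≠ W.around e' x

/-- The DPPRO for the set `P` of pairs. -/
def dppro (P : Finset (Fin n × Fin n)) : Dppro n where
  ends e := if e ∈ P then some (succOn (W.sp e.1 e.2) e.1, predOn (W.sp e.1 e.2) e.2) else none
  home x :=
    if h : ∃ r : (Fin n × Fin n) × Fin n × Fin n, r.1 ∈ P ∧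
        predOn (W.sp r.1.1 r.1.2) x = some r.2.1 ∧ succOn (W.sp r.1.1 r.1.2) x = some r.2.2
    then some h.choose else none
  branch b :=
    if b.1 ∈ P ∧ b.2.1 ∈ P ∧ W.IsBranching b.1 b.2.1 b.2.2 then
      some ((predOn (W.sp b.1.1 b.1.2) b.2.2, succOn (W.sp b.1.1 b.1.2) b.2.2),
        (predOn (W.sp b.2.1.1 b.2.1.2) b.2.2, succOn (W.sp b.2.1.1 b.2.1.2) b.2.2))
    else none

end WGraph

/-- Follow `Π(x, y)` from its inner vertex `z`, which was entered from `prev`, up to `y`, whose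
predecessor on the path is `last`. Visited vertices are pushed on `acc`. -/
def Dppro.walk {n : ℕ} (D : Dppro n) (x y : Fin n) (last : Option (Fin n)) :
    ℕ → Fin n → Fin n → List (Fin n) → Timed (List (Fin n))
  | 0, _, _, acc => return acc
  | f + 1, prev, z, acc => do
    tick 1
    if last = some z then return y :: acc
    else match D.home z with
      | none => return acc
      | some (hm, a, b) => do
        tick 1
        match D.branch (hm, (x, y), z) with
        | some (_, (_, some z')) => D.walk x y last f z z' (z' :: acc)
        | some (_, (_, none)) => return acc
        | none =>
          let z' := if a = prev then b else a
          D.walk x y last f z z' (z' :: acc)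

/-- Report the path `Π(x, y)` of a stored pair; its vertices other than `x` are pushed on `acc`. -/
def Dppro.query {n : ℕ} (D : Dppro n) (x y : Fin n) (acc : List (Fin n)) :
    Timed (List (Fin n)) := do
  tick 1
  match D.ends (x, y) with
  | some (some z, last) =>
    if z = y then return y :: acc
    else D.walk x y last n x z (z :: acc)
  | _ => return acc

/-! ## The oracle with `h` levels -/

/-- The stored data, in addition to the graph. Levels are numbered from `1` to `h`. -/
structure Oracle (n h : ℕ) where
  /-- `forest i`: the parent pointers of the forest of shortest path trees rooted at the
  `i`-landmarks; a root points to itself -/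
  forest : ℕ → Fin n → Option (Fin n)
  /-- `hash i`: the hash table with the pairs in `𝒫_i` -/
  hash : ℕ → Fin n × Fin n → Option Unit
  /-- `dp i`: the DPPRO for `𝒫_i` (for `i = h` that for all pairs of `h`-landmarks) -/
  dp : ℕ → Dppro n

/-- The number of machine words of the oracle, in addition to the stored graph. -/
def Oracle.size {n h : ℕ} (O : Oracle n h) : ℕ :=
  ∑ i ∈ Finset.Icc 1 h, (2 * entries (O.forest i) + 2 * entries (O.hash i) + (O.dp i).size)

/-- Follow parent pointers from `x` to a root, pushing the visited vertices on `acc`. The result is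
the root with the new list. -/
def climb {n : ℕ} (par : Fin n → Option (Fin n)) :
    ℕ → Fin n → List (Fin n) → Timed (Fin n × List (Fin n))
  | 0, x, acc => return (x, acc)
  | f + 1, x, acc => do
    tick 1
    match par x with
    | none => return (x, acc)
    | some y => if y = x then return (x, acc) else climb par f y (y :: acc)

/-- Concatenate the reversal of `a` and `b`. -/
def joinRev {n : ℕ} (a b : List (Fin n)) : Timed (List (Fin n)) := do
  tick a.length
  return a.reverse ++ b

namespace Oracle

variable {n h : ℕ} (O : Oracle n h)

/-- The query algorithm from level `j` on: `u` and `v` are the current `j`-landmarks, `accU` and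
`accV` list the vertices of the paths found so far, from `u` (from `v`) back to the vertex of the
query. -/
def levels : ℕ → ℕ → Fin n → Fin n → List (Fin n) → List (Fin n) → Timed (List (Fin n))
  | 0, _, _, _, _, _ => return []
  | f + 1, j, u, v, accU, accV => do
    tick 1
    if j = h ∨ (O.hash j (u, v)).isSome then do
      let acc ← (O.dp j).query u v accU
      joinRev acc accV.tail
    else do
      let (u', accU') ← climb (O.forest (j + 1)) n u accU
      let (v', accV') ← climb (O.forest (j + 1)) n v accV
      levels f (j + 1) u' v' accU' accV'

/-- The query algorithm. The result is the vertex list of the reported path from `u` to `v`. -/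
def query (search : Search n) (adj : Fin n → List (Fin n × ℝ)) (u v : Fin n) :
    Timed (List (Fin n)) := do
  let halt : Fin n → Bool := fun x => decide (O.forest 1 x = some x)
  match ← search adj halt v u with
  | some par => do
    let (_, path) ← climb par n u [u]
    joinRev path []
  | none => match ← search adj halt u v with
    | some par => do
      let (_, path) ← climb par n v [v]
      return path
    | none => do
      let (u', accU) ← climb (O.forest 1) n u [u]
      let (v', accV) ← climb (O.forest 1) n v [v]
      levels O h 1 u' v' accU accV

end Oracle

namespace WGraph

variable {n : ℕ} (W : WGraph n)

/-- The vertex of `L` closest to `v`; among several ones the one with the least number. -/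
def nearest (L : Finset (Fin n)) (v : Fin n) : Option (Fin n) :=
  let S := L.filter fun z => ∀ z' ∈ L, W.dist v z ≤ W.dist v z'
  if hS : S.Nonempty then some (S.min' hS) else none

/-- `u` is in the `c`-fraction-ball of `v`: `d(v, u) < c · r(v)`, where `r(v)` is the distance from
`v` to the closest vertex of `L` (infinite if `L` is empty). -/
def InBall (c : ℝ) (L : Finset (Fin n)) (v u : Fin n) : Prop :=
  ∀ z ∈ L, W.dist v u < c * W.dist v z

/-- The set `𝒫_i` for the landmark sets `L 1, …, L h`, as a set of ordered pairs. -/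
def pairs (h : ℕ) (L : ℕ → Finset (Fin n)) (i : ℕ) : Finset (Fin n × Fin n) :=
  (L i ×ˢ L i).filter fun e =>
    i = h ∨ W.InBall (1 / 3) (L (i + 1)) e.1 e.2 ∨ W.InBall (1 / 3) (L (i + 1)) e.2 e.1

/-- The oracle for the landmark sets `L 1, …, L h`. -/
def oracle (h : ℕ) (L : ℕ → Finset (Fin n)) : Oracle n h where
  forest i v := (W.nearest (L i) v).map fun z => (succOn (W.sp v z) v).getD v
  hash i e := if e ∈ W.pairs h L i then some () else none
  dp i := W.dppro (W.pairs h L i)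

/-! ## The random landmarks -/

/-- The number `⌈deg(u) / (m / n)⌉` of virtual copies of the vertex `u`. -/
def copies (u : Fin n) : ℕ := ⌈(W.deg u : ℝ) / ((W.numEdges : ℝ) / n)⌉₊

/-- The virtual nodes. -/
abbrev VNode : Type := Σ u : Fin n, Fin (W.copies u)

/-- An outcome of the sampling: for each of the `h` levels the set of selected virtual nodes (level
`i` has index `i - 1`). -/
abbrev Outcome (h : ℕ) : Type := Fin h → Finset W.VNode

/-- The selection probability `ρ_i / n` at level `i`, where `ρ_i = n ^ (1 - (3/4)^(h - i + 1))`. -/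
def selProb (_W : WGraph n) (h i : ℕ) : ℝ :=
  (n : ℝ) ^ (1 - (3 / 4 : ℝ) ^ (h - i + 1)) / n

/-- The probability of an outcome: at each level each virtual node is selected independently. -/
def prob (h : ℕ) (ω : W.Outcome h) : ℝ :=
  ∏ k : Fin h, ∏ x : W.VNode,
    if x ∈ ω k then W.selProb h (k.val + 1) else 1 - W.selProb h (k.val + 1)

/-- The expectation of a random variable. -/
def expect (h : ℕ) (X : W.Outcome h → ℝ) : ℝ := ∑ ω : W.Outcome h, W.prob h ω * X ω

/-- The set of `i`-landmarks: the vertices with a copy that is selected at level `i`. -/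
def landmarks (h : ℕ) (ω : W.Outcome h) (i : ℕ) : Finset (Fin n) :=
  Finset.univ.filter fun u => ∃ k : Fin h, k.val + 1 = i ∧ ∃ c : Fin (W.copies u), ⟨u, c⟩ ∈ ω k

/-- The random oracle `Λ_h` of the graph. -/
def lambdaOracle (h : ℕ) (ω : W.Outcome h) : Oracle n h := W.oracle h (W.landmarks h ω)

/-- The answer of `Λ_h` to the query `(u, v)`, with the time spent on it. -/
def answer (search : Search n) (h : ℕ) (ω : W.Outcome h) (u v : Fin n) : Timed (List (Fin n)) :=
  (W.lambdaOracle h ω).query search W.adj u v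

/-- The expected query time for the query `(u, v)`. -/
def expectedTime (search : Search n) (h : ℕ) (u v : Fin n) : ℝ :=
  W.expect h fun ω => ((W.answer search h ω u v).cost : ℝ)

/-- The expected number of edges of the path reported for the query `(u, v)`. -/
def expectedHops (search : Search n) (h : ℕ) (u v : Fin n) : ℝ :=
  W.expect h fun ω => (((W.answer search h ω u v).val.length - 1 : ℕ) : ℝ)

/-- With certainty, every query `(u, v)` is answered by a walk of the graph from `u` to `v` whose
length is at least `d(u, v)` and at most `s · d(u, v)`. -/
def HasStretch (search : Search n) (h : ℕ) (s : ℝ) : Prop :=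
  ∀ (ω : W.Outcome h) (u v : Fin n), ∃ p : W.graph.Walk u v,
    (W.answer search h ω u v).val = p.support ∧ W.dist u v ≤ W.len p ∧ W.len p ≤ s * W.dist u v

end WGraph

end PathOracle

end

noncomputable section

namespace PathOracle

namespace WGraph

variable {n : ℕ} (W : WGraph n)

/-! ## Lengths of walks and the metric -/

/-! Ties. The code of a path is additive under concatenation, invariant under reversal, and
determines the edge set. Hence the path minimising (length, code) lexicographically is unique, and
subpaths and reversals of chosen paths are chosen (`IsCanon.middle`, `IsCanon.reverse`). Two chosen
paths with two common vertices coincide between them, so they branch at no more than two vertices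
(`card_isBranching_le`). When a stored path and the home path of a vertex do not branch there, the
home path already shows the next edge, so tracing costs O(1) per edge.

Stretch. Write D for d(u,v). If both explorations fail, each end point has a first landmark within
D, and the two landmarks are at distance at most 3D. A pair at distance d that is not stored has
nearest next landmarks within 3d on both sides, so the next pair is at distance at most 7d. The
detours form a geometric series, which `levels_spec` sums exactly and `query_spec` bounds by 7^h;
this is t to the power log_{4/3} 7.

Time. The order in which an exploration processes vertices does not depend on the landmarks; these
only decide where it stops. A vertex with c copies is passed with probability (1-p)^c and costs its
degree, at most c·m/n. By induction along the order the expected number of scanned edges is at most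
(m/n)/p (`expect_scanned_le`), and 1/p_1 = n^(1/t). The leftist heap contributes the logarithm for
Dijkstra. The levels cost O(h) = O(log t) besides O(1) per reported edge.

Space. Branching events are charged to intersecting pairs of stored paths. Below the top level, the
longer of two such paths has an end point whose full ball contains the other three end points
(`inBall_of_crossing`), so the number of intersecting pairs is bounded by the sum of the cubed ball
sizes over the landmarks. A ball is what precedes the first node of level i+1 in the order of
distance; its binomial moments are at most powers of c = p_i/p_{i+1} (`expect_choose_ballCount_le`).
The exponents 3/4 are chosen such that p_i c^3 = 1, so each of the at most 3n virtual nodes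
contributes O(1). At the top level the fourth power of |L_h| counts, and |L_h| has mean at most
3n^(1/4). -/

@[simp] theorem len_nil {u : Fin n} : W.len (SimpleGraph.Walk.nil : W.graph.Walk u u) = 0 := by
  simp [len]

@[simp] theorem len_cons {u v w : Fin n} (h : W.graph.Adj u v) (p : W.graph.Walk v w) :
    W.len (SimpleGraph.Walk.cons h p) = W.wt s(u, v) + W.len p := by
  simp [len]

@[simp] theorem len_append {u v w : Fin n} (p : W.graph.Walk u v) (q : W.graph.Walk v w) :
    W.len (p.append q) = W.len p + W.len q := by
  simp [len]

@[simp] theorem len_reverse {u v : Fin n} (p : W.graph.Walk u v) :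
    W.len p.reverse = W.len p := by
  simp [len]

theorem wt_pos' {u v : Fin n} (h : W.graph.Adj u v) : 0 < W.wt s(u, v) :=
  W.wt_pos _ ((SimpleGraph.mem_edgeSet _).2 h)

theorem len_nonneg {u v : Fin n} (p : W.graph.Walk u v) : 0 ≤ W.len p := by
  induction p with
  | nil => simp
  | cons h p ih => have := W.wt_pos' h; rw [len_cons]; linarith

theorem dist_le_len {u v : Fin n} (p : W.graph.Walk u v) : W.dist u v ≤ W.len p :=
  ciInf_le ⟨0, by rintro _ ⟨q, rfl⟩; exact W.len_nonneg q⟩ p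

theorem dist_nonneg (u v : Fin n) : 0 ≤ W.dist u v :=
  Real.iInf_nonneg fun p => W.len_nonneg p

theorem exists_path_len_le {u v : Fin n} (p : W.graph.Walk u v) :
    ∃ q : W.graph.Walk u v, q.IsPath ∧ W.len q ≤ W.len p := by
  induction p with
  | nil => exact ⟨_, SimpleGraph.Walk.IsPath.nil, le_rfl⟩
  | @cons u w v h p ih =>
    obtain ⟨q, hq, hl⟩ := ih
    have := W.wt_pos' h
    by_cases hu : u ∈ q.support
    · obtain ⟨q₁, q₂, rfl⟩ := SimpleGraph.Walk.mem_support_iff_exists_append.1 hu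
      refine ⟨q₂, hq.of_append_right, ?_⟩
      have := W.len_nonneg q₁
      rw [len_append] at hl
      rw [len_cons]; linarith
    · refine ⟨.cons h q, hq.cons hu, ?_⟩
      rw [len_cons, len_cons]; linarith

/-! ### Codes of paths as binary numbers of edge sets -/

@[simp] theorem code_append {u v w : Fin n} (p : W.graph.Walk u v) (q : W.graph.Walk v w) :
    W.code (p.append q) = W.code p + W.code q := by
  simp [code]

@[simp] theorem code_reverse {u v : Fin n} (p : W.graph.Walk u v) :
    W.code p.reverse = W.code p := by
  unfold code
  rw [SimpleGraph.Walk.darts_reverse, List.map_reverse, List.sum_reverse, List.map_map]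
  congr 1
  refine List.map_congr_left fun d _ => ?_
  simp [min_comm, max_comm]

/-- The exponent that represents an edge in the code of a path. -/
def edgeId : Sym2 (Fin n) → ℕ :=
  Sym2.lift ⟨fun a b => (min a b : Fin n).val * n + (max a b : Fin n).val, fun a b => by
    simp only [min_comm, max_comm]⟩

/-- The end points of the edge, in increasing order, are the two base-`n` digits of the exponent. -/
theorem edgeId_injective : Function.Injective (edgeId (n := n)) := by
  intro e e'
  induction e with | _ a b => ?_
  induction e' with | _ c d => ?_
  intro h
  simp only [edgeId, Sym2.lift_mk] at h
  have hn : 0 < n := a.pos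
  have h1 : (min a b : Fin n) = min c d := by
    have := congrArg (· / n) h
    simp only [Nat.add_comm (_ * n), Nat.add_mul_div_right _ _ hn,
      Nat.div_eq_of_lt (Fin.is_lt _), zero_add] at this
    exact Fin.ext this
  have h2 : (max a b : Fin n) = max c d := by
    rw [h1] at h; exact Fin.ext (by omega)
  rw [Sym2.eq_iff]
  rcases le_total a b with h3 | h3 <;> rcases le_total c d with h4 | h4 <;>
    simp only [min_eq_left h3, max_eq_right h3, min_eq_right h3, max_eq_left h3,
      min_eq_left h4, max_eq_right h4, min_eq_right h4, max_eq_left h4] at h1 h2 <;> simp [h1, h2]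

/-- A path uses no edge twice, so its code is a sum of distinct powers of two; uniqueness of binary
expansions then recovers the edges. -/
theorem code_eq {u v : Fin n} {p : W.graph.Walk u v} (hp : p.IsPath) :
    W.code p = ∑ i ∈ (p.edges.map edgeId).toFinset, 2 ^ i := by
  rw [List.sum_toFinset _ (hp.isTrail.edges_nodup.map edgeId_injective)]
  unfold code
  rw [SimpleGraph.Walk.edges, List.map_map, List.map_map]
  rfl

theorem edges_toFinset_eq_of_code_eq {u v u' v' : Fin n} {p : W.graph.Walk u v}
    {q : W.graph.Walk u' v'} (hp : p.IsPath) (hq : q.IsPath) (h : W.code p = W.code q) (e) :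
    e ∈ p.edges ↔ e ∈ q.edges := by
  rw [W.code_eq hp, W.code_eq hq] at h
  have := Finset.geomSum_injective le_rfl h
  have := congrArg (fun s => edgeId e ∈ s) this
  simpa [edgeId_injective.eq_iff] using this

/-- Only the first edge of a path meets its start, so the edge set determines the second vertex; the
rest follows by induction. -/
theorem path_eq_of_edges {u v : Fin n} {p q : W.graph.Walk u v} (hp : p.IsPath) (hq : q.IsPath)
    (h : ∀ e, e ∈ p.edges ↔ e ∈ q.edges) : p = q := by
  induction p with
  | nil => cases q with
    | nil => rfl
    | cons ha q => exact absurd q.end_mem_support ((SimpleGraph.Walk.cons_isPath_iff _ _).1 hq).2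
  | @cons u w v ha p ih =>
    cases q with
    | nil => simpa using h s(u, w)
    | @cons _ w' _ ha' q =>
      rw [SimpleGraph.Walk.cons_isPath_iff] at hp hq
      have hw : w = w' := by
        have h1 := (h s(u, w)).1 (by simp)
        rw [SimpleGraph.Walk.edges_cons, List.mem_cons] at h1
        rcases h1 with h1 | h1
        · rw [Sym2.eq_iff] at h1
          rcases h1 with h1 | h1
          · exact h1.2
          · exact h1.2.trans h1.1
        · exact absurd (q.fst_mem_support_of_mem_edges h1) hq.2
      subst hw
      rw [ih hp.1 hq.1]
      intro e
      have h1 := h e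
      simp only [SimpleGraph.Walk.edges_cons, List.mem_cons] at h1
      by_cases he : e = s(u, w)
      · subst he
        exact iff_of_false (fun h2 => hp.2 (p.fst_mem_support_of_mem_edges h2))
          (fun h2 => hq.2 (q.fst_mem_support_of_mem_edges h2))
      · simpa [he] using h1

/-- `p` is the chosen shortest path. -/
def IsCanon {u v : Fin n} (p : W.graph.Walk u v) : Prop :=
  p.IsPath ∧ ∀ q : W.graph.Walk u v, q.IsPath →
    toLex (W.len p, W.code p) ≤ toLex (W.len q, W.code q)

variable {W}

theorem IsCanon.eq {u v : Fin n} {p q : W.graph.Walk u v} (hp : W.IsCanon p) (hq : W.IsCanon q) :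
    p = q := by
  have h := le_antisymm (hp.2 q hq.1) (hq.2 p hp.1)
  have h' : (W.len p, W.code p) = (W.len q, W.code q) := toLex.injective h
  exact W.path_eq_of_edges hp.1 hq.1
    (W.edges_toFinset_eq_of_code_eq hp.1 hq.1 (congrArg Prod.snd h'))

theorem IsCanon.len_le {u v : Fin n} {p : W.graph.Walk u v} (hp : W.IsCanon p)
    (q : W.graph.Walk u v) : W.len p ≤ W.len q := by
  obtain ⟨q', hq', hl⟩ := W.exists_path_len_le q
  have := hp.2 q' hq'
  rw [Prod.Lex.toLex_le_toLex] at this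
  rcases this with h | h
  · exact h.le.trans hl
  · exact h.1.le.trans hl

theorem IsCanon.len_eq {u v : Fin n} {p : W.graph.Walk u v} (hp : W.IsCanon p) :
    W.len p = W.dist u v := by
  have : Nonempty (W.graph.Walk u v) := ⟨p⟩
  exact le_antisymm (le_ciInf hp.len_le) (W.dist_le_len p)

theorem IsCanon.reverse {u v : Fin n} {p : W.graph.Walk u v} (hp : W.IsCanon p) :
    W.IsCanon p.reverse := by
  refine ⟨hp.1.reverse, fun q hq => ?_⟩
  simpa using hp.2 q.reverse hq.reverse

theorem exists_isCanon (hc : W.graph.Connected) (u v : Fin n) :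
    ∃ p : W.graph.Walk u v, W.IsCanon p ∧ W.sp u v = p.support := by
  have h : W.graph.Reachable u v := hc.preconnected u v
  refine ⟨(W.exists_canonical h).choose.1, ⟨(W.exists_canonical h).choose.2, fun q hq => ?_⟩, ?_⟩
  · exact (W.exists_canonical h).choose_spec ⟨q, hq⟩
  · rw [sp, dif_pos h]

theorem IsCanon.sp_eq (hc : W.graph.Connected) {u v : Fin n} {p : W.graph.Walk u v}
    (hp : W.IsCanon p) : W.sp u v = p.support := by
  obtain ⟨q, hq, h⟩ := exists_isCanon hc u v
  rw [h, hq.eq hp]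

/-! ### The metric and the consistency of chosen paths -/

@[simp] theorem dist_self (u : Fin n) : W.dist u u = 0 :=
  le_antisymm (by simpa using W.dist_le_len (SimpleGraph.Walk.nil : W.graph.Walk u u))
    (W.dist_nonneg u u)

theorem dist_triangle (hc : W.graph.Connected) (u v w : Fin n) :
    W.dist u w ≤ W.dist u v + W.dist v w := by
  obtain ⟨p, hp, -⟩ := exists_isCanon hc u v
  obtain ⟨q, hq, -⟩ := exists_isCanon hc v w
  rw [← hp.len_eq, ← hq.len_eq, ← len_append]
  exact W.dist_le_len _

theorem dist_comm (hc : W.graph.Connected) (u v : Fin n) : W.dist u v = W.dist v u := by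
  obtain ⟨p, hp, -⟩ := exists_isCanon hc u v
  rw [← hp.len_eq, ← hp.reverse.len_eq, len_reverse]

theorem dist_le_wt {u v : Fin n} (h : W.graph.Adj u v) : W.dist u v ≤ W.wt s(u, v) := by
  simpa using W.dist_le_len (SimpleGraph.Walk.cons h .nil)

theorem dist_pos (hc : W.graph.Connected) {u v : Fin n} (h : u ≠ v) : 0 < W.dist u v := by
  obtain ⟨p, hp, -⟩ := exists_isCanon hc u v
  rw [← hp.len_eq]
  cases p with
  | nil => exact absurd rfl h
  | cons h p => have := W.wt_pos' h; have := W.len_nonneg p; rw [len_cons]; linarith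

/-- A return to the start would leave a tail with the same end points that is shorter by a positive
weight. This lets a walk spliced from shortest pieces compete with the chosen path, which is minimal
among paths only. -/
theorem isPath_of_len_le_dist (hc : W.graph.Connected) {u v : Fin n} (p : W.graph.Walk u v)
    (h : W.len p ≤ W.dist u v) : p.IsPath := by
  induction p with
  | nil => exact .nil
  | @cons u w v ha p ih =>
    rw [len_cons] at h
    have h1 := dist_triangle hc u w v
    have h2 := dist_le_wt ha
    refine (ih (by linarith)).cons fun hu => ?_
    obtain ⟨p₁, p₂, rfl⟩ := SimpleGraph.Walk.mem_support_iff_exists_append.1 hu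
    have h3 := W.dist_le_len p₂
    have h4 := W.len_nonneg p₁
    have h5 := W.wt_pos' ha
    rw [len_append] at h
    linarith

/-- The chosen shortest paths are consistent on subpaths. -/
theorem IsCanon.middle (hc : W.graph.Connected) {u x y v : Fin n} {a : W.graph.Walk u x}
    {s : W.graph.Walk x y} {b : W.graph.Walk y v} (h : W.IsCanon ((a.append s).append b)) :
    W.IsCanon s := by
  refine ⟨h.1.of_append_left.of_append_right, fun q hq => ?_⟩
  have hl := h.len_le ((a.append q).append b)
  simp only [len_append] at hl
  rw [Prod.Lex.toLex_le_toLex]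
  rcases lt_or_eq_of_le (show W.len s ≤ W.len q by linarith) with h1 | h1
  · exact Or.inl h1
  · refine Or.inr ⟨h1, ?_⟩
    -- With `q` of the same length as `s`, the spliced walk is again shortest, hence a path.
    -- Comparing codes, the contributions of `a` and `b` cancel.
    have hle : W.len ((a.append q).append b) ≤ W.dist u v := by
      rw [← h.len_eq]; simp [h1]
    have h2 := h.2 _ (isPath_of_len_le_dist hc _ hle)
    rw [Prod.Lex.toLex_le_toLex] at h2
    simp only [len_append, code_append, h1, lt_irrefl, true_and, false_or] at h2 ⊢
    omega

theorem IsCanon.right (hc : W.graph.Connected) {u x v : Fin n} {a : W.graph.Walk u x}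
    {s : W.graph.Walk x v} (h : W.IsCanon (a.append s)) : W.IsCanon s :=
  IsCanon.middle hc (a := a) (b := .nil) (by simpa using h)

theorem IsCanon.left (hc : W.graph.Connected) {u x v : Fin n} {a : W.graph.Walk u x}
    {s : W.graph.Walk x v} (h : W.IsCanon (a.append s)) : W.IsCanon a :=
  IsCanon.middle hc (a := .nil) (b := s) (by simpa using h)

theorem sp_reverse (hc : W.graph.Connected) (u v : Fin n) :
    W.sp v u = (W.sp u v).reverse := by
  obtain ⟨p, hp, h⟩ := exists_isCanon hc u v
  rw [h, hp.reverse.sp_eq hc, SimpleGraph.Walk.support_reverse]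

theorem nodup_sp (hc : W.graph.Connected) (u v : Fin n) : (W.sp u v).Nodup := by
  obtain ⟨p, hp, h⟩ := exists_isCanon hc u v
  rw [h]; exact hp.1.support_nodup

theorem dist_add_of_mem_sp (hc : W.graph.Connected) {u v x : Fin n} (hx : x ∈ W.sp u v) :
    W.dist u v = W.dist u x + W.dist x v := by
  obtain ⟨p, hp, h⟩ := exists_isCanon hc u v
  rw [h] at hx
  obtain ⟨a, b, rfl⟩ := SimpleGraph.Walk.mem_support_iff_exists_append.1 hx
  rw [← hp.len_eq, len_append, (hp.left hc).len_eq, (hp.right hc).len_eq]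

theorem exists_split_of_mem_sp (hc : W.graph.Connected) {u v x y : Fin n} (hx : x ∈ W.sp u v)
    (hy : y ∈ W.sp u v) (h : W.dist u x ≤ W.dist u y) :
    ∃ (a : W.graph.Walk u x) (s : W.graph.Walk x y) (b : W.graph.Walk y v),
      W.IsCanon ((a.append s).append b) := by
  obtain ⟨p, hp, h'⟩ := exists_isCanon hc u v
  rw [h'] at hx hy
  obtain ⟨p₁, b, rfl⟩ := SimpleGraph.Walk.mem_support_iff_exists_append.1 hy
  have hx' : x ∈ p₁.support := by
    rw [SimpleGraph.Walk.mem_support_append_iff] at hx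
    rcases hx with hx | hx
    · exact hx
    · obtain ⟨b₁, b₂, rfl⟩ := SimpleGraph.Walk.mem_support_iff_exists_append.1 hx
      -- If `x` came strictly after `y` on the path, it would be strictly farther from `u`.
      by_cases hxy : x = y
      · subst hxy; simp
      · have h1 := dist_pos hc (Ne.symm hxy)
        have h2 : W.IsCanon (p₁.append b₁) := by
          rw [SimpleGraph.Walk.append_assoc] at hp; exact hp.left hc
        have h3 := h2.len_eq
        rw [len_append, (hp.left hc).len_eq, (h2.right hc).len_eq] at h3
        linarith
  obtain ⟨a, s, rfl⟩ := SimpleGraph.Walk.mem_support_iff_exists_append.1 hx'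
  exact ⟨a, s, b, hp⟩

theorem _root_.SimpleGraph.Walk.support_infix_append {V : Type*} {G : SimpleGraph V} {u x y v : V}
    (a : G.Walk u x) (s : G.Walk x y) (b : G.Walk y v) :
    s.support <:+: ((a.append s).append b).support := by
  rw [SimpleGraph.Walk.support_append, SimpleGraph.Walk.support_append_eq_support_dropLast_append]
  exact ⟨_, _, rfl⟩

theorem sp_infix (hc : W.graph.Connected) {u v x y : Fin n} (hx : x ∈ W.sp u v)
    (hy : y ∈ W.sp u v) (h : W.dist u x ≤ W.dist u y) : W.sp x y <:+: W.sp u v := by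
  obtain ⟨a, s, b, hp⟩ := exists_split_of_mem_sp hc hx hy h
  rw [hp.sp_eq hc, (hp.middle hc).sp_eq hc]
  exact SimpleGraph.Walk.support_infix_append a s b

/-- Distance from `u` is strictly increasing along the chosen path, so it orders the vertices of the
path. The part from `x` to `z` is the chosen path of these two and contains all vertices in between.
-/
theorem mem_sp_between (hc : W.graph.Connected) {u v x y z : Fin n} (hx : x ∈ W.sp u v)
    (hy : y ∈ W.sp u v) (hz : z ∈ W.sp u v) (h : W.dist u x ≤ W.dist u y)
    (h' : W.dist u y ≤ W.dist u z) : y ∈ W.sp x z := by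
  obtain ⟨a, s, b, hp⟩ := exists_split_of_mem_sp hc hy hz h'
  have hx' : x ∈ (a.append s).support := by
    rw [hp.sp_eq hc, SimpleGraph.Walk.mem_support_append_iff] at hx
    rcases hx with hx | hx
    · exact hx
    · obtain ⟨b₁, b₂, rfl⟩ := SimpleGraph.Walk.mem_support_iff_exists_append.1 hx
      by_cases hxz : x = z
      · subst hxz; simp
      · have h1 := dist_pos hc (Ne.symm hxz)
        have h2 : W.IsCanon ((a.append s).append b₁) := by
          rw [SimpleGraph.Walk.append_assoc] at hp; exact hp.left hc
        have h3 := h2.len_eq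
        rw [len_append, (hp.left hc).len_eq, (h2.right hc).len_eq] at h3
        linarith
  have hp' := hp.left hc
  rw [← hp'.sp_eq hc] at hx'
  obtain ⟨a', s', b', hq⟩ := exists_split_of_mem_sp hc hx' (by rw [hp'.sp_eq hc]; simp) h
  have h4 : W.IsCanon (s'.append b') := by
    rw [← SimpleGraph.Walk.append_assoc] at hq; exact hq.right hc
  rw [h4.sp_eq hc]; simp

end WGraph

/-! ## Successors and predecessors on duplicate-free lists -/

theorem mem_of_succOn {n : ℕ} {l : List (Fin n)} {x y : Fin n} (h : succOn l x = some y) :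
    [x, y] <:+: l := by
  induction l with
  | nil => simp [succOn] at h
  | cons a l ih =>
    cases l with
    | nil => simp [succOn] at h
    | cons b l =>
      rw [succOn] at h
      split_ifs at h with hax
      · cases h; subst hax; exact ⟨[], l, rfl⟩
      · exact (ih h).trans (List.suffix_cons _ _).isInfix

theorem succOn_of_infix {n : ℕ} {l : List (Fin n)} (hl : l.Nodup) {x y : Fin n}
    (h : [x, y] <:+: l) : succOn l x = some y := by
  induction l with
  | nil => simp at h
  | cons a l ih =>
    have hl' := List.nodup_cons.1 hl
    cases l with
    | nil => have := h.length_le; simp at this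
    | cons b l =>
      rw [succOn]
      rw [List.infix_cons_iff] at h
      rcases h with h | h
      · simp only [List.cons_prefix_cons] at h
        rw [if_pos h.1.symm, h.2.1]
      · rw [if_neg, ih hl'.2 h]
        rintro rfl
        exact hl'.1 (h.subset (by simp))

/-- As two-element infixes, successors and predecessors pass from a subpath to the whole path. -/
theorem succOn_eq_some_iff {n : ℕ} {l : List (Fin n)} (hl : l.Nodup) {x y : Fin n} :
    succOn l x = some y ↔ [x, y] <:+: l :=
  ⟨mem_of_succOn, succOn_of_infix hl⟩

theorem predOn_eq_some_iff {n : ℕ} {l : List (Fin n)} (hl : l.Nodup) {x y : Fin n} :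
    predOn l x = some y ↔ [y, x] <:+: l := by
  rw [predOn, succOn_eq_some_iff (List.nodup_reverse.2 hl), ← List.reverse_infix]
  simp

namespace WGraph

variable {n : ℕ} {W : WGraph n}

theorem exists_succ (hc : W.graph.Connected) {u v x : Fin n} (hx : x ∈ W.sp u v) (hxv : x ≠ v) :
    ∃ y, W.graph.Adj x y ∧ succOn (W.sp u v) x = some y ∧ y ∈ W.sp u v ∧
      W.dist x v = W.wt s(x, y) + W.dist y v := by
  obtain ⟨p, hp, h⟩ := exists_isCanon hc u v
  rw [h] at hx ⊢
  obtain ⟨a, s, rfl⟩ := SimpleGraph.Walk.mem_support_iff_exists_append.1 hx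
  cases s with
  | nil => exact absurd rfl hxv
  | @cons _ y _ ha s =>
    refine ⟨y, ha, ?_, by simp, ?_⟩
    · refine succOn_of_infix hp.1.support_nodup ?_
      rw [SimpleGraph.Walk.support_append_eq_support_dropLast_append,
        SimpleGraph.Walk.support_cons, ← s.cons_tail_support]
      exact ⟨a.support.dropLast, s.support.tail, by simp⟩
    · have h1 := hp.right hc
      have h2 : W.IsCanon s := IsCanon.right hc (a := SimpleGraph.Walk.cons ha .nil) h1
      rw [← h1.len_eq, ← h2.len_eq, len_cons]

theorem left_mem_sp (hc : W.graph.Connected) (u v : Fin n) : u ∈ W.sp u v := by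
  obtain ⟨p, hp, h⟩ := exists_isCanon hc u v
  simp [h]

theorem mem_sp_comm (hc : W.graph.Connected) {u v x : Fin n} : x ∈ W.sp u v ↔ x ∈ W.sp v u := by
  rw [sp_reverse hc v u, List.mem_reverse]

theorem predOn_sp (hc : W.graph.Connected) (u v x : Fin n) :
    predOn (W.sp u v) x = succOn (W.sp v u) x := by
  rw [predOn, sp_reverse hc u v]

theorem succOn_sp_self (hc : W.graph.Connected) (u v : Fin n) : succOn (W.sp u v) v = none := by
  by_contra h
  obtain ⟨y, hy⟩ := Option.ne_none_iff_exists'.1 h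
  have h1 : y ∈ W.sp u v := (mem_of_succOn hy).subset (by simp)
  obtain ⟨s, t, hst⟩ := mem_of_succOn hy
  obtain ⟨p, hp, h'⟩ := exists_isCanon hc u v
  have hnd := nodup_sp hc u v
  have hlast : (W.sp u v).getLast? = some v := by
    rw [h', List.getLast?_eq_getLast_of_ne_nil (by simp), SimpleGraph.Walk.getLast_support]
  rw [← hst] at hlast hnd
  rw [List.getLast?_append, List.getLast?_append] at hlast
  simp only [List.getLast?_cons_cons, List.getLast?_singleton, Option.some_or] at hlast
  rcases ht : t.getLast? with _ | w
  · rw [ht] at hlast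
    simp only [Option.none_or, Option.some.injEq] at hlast
    subst hlast
    simp [List.nodup_append] at hnd
  · rw [ht] at hlast
    simp only [Option.some_or, Option.some.injEq] at hlast
    subst hlast
    have := List.mem_of_getLast? ht
    rw [List.nodup_append] at hnd
    exact hnd.2.2 w (by simp) w this rfl

theorem succOn_sp_adj (hc : W.graph.Connected) {u v x y : Fin n}
    (h : succOn (W.sp u v) x = some y) :
    W.graph.Adj x y ∧ x ∈ W.sp u v ∧ y ∈ W.sp u v ∧
      W.dist x v = W.wt s(x, y) + W.dist y v := by
  have hx : x ∈ W.sp u v := (mem_of_succOn h).subset (by simp)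
  have hxv : x ≠ v := by rintro rfl; rw [succOn_sp_self hc] at h; cases h
  obtain ⟨y', h1, h2, h3, h4⟩ := exists_succ hc hx hxv
  rw [h] at h2; cases h2
  exact ⟨h1, hx, h3, h4⟩

theorem exists_pred (hc : W.graph.Connected) {u v x : Fin n} (hx : x ∈ W.sp u v) (hxu : x ≠ u) :
    ∃ y, predOn (W.sp u v) x = some y ∧ y ∈ W.sp u v := by
  obtain ⟨y, -, h, h1, -⟩ := exists_succ hc ((mem_sp_comm hc).1 hx) hxu
  exact ⟨y, by rw [predOn_sp hc, h], (mem_sp_comm hc).1 h1⟩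

/-! ## Branching events -/

/-- An inner vertex of the subpath has both of its neighbours within the subpath. -/
theorem around_eq_of_infix (hc : W.graph.Connected) {e : Fin n × Fin n} {a b x : Fin n}
    (h : W.sp a b <:+: W.sp e.1 e.2) (hx : x ∈ W.sp a b) (hxa : x ≠ a) (hxb : x ≠ b) :
    W.around e x = W.around (a, b) x := by
  obtain ⟨y, -, hy, -⟩ := exists_succ hc hx hxb
  obtain ⟨z, hz, -⟩ := exists_pred hc hx hxa
  have h1 := (succOn_eq_some_iff (nodup_sp hc _ _)).1 hy
  have h2 := (predOn_eq_some_iff (nodup_sp hc _ _)).1 hz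
  have h3 := (succOn_eq_some_iff (nodup_sp hc _ _)).2 (h1.trans h)
  have h4 := (predOn_eq_some_iff (nodup_sp hc _ _)).2 (h2.trans h)
  simp only [around, hy, hz, h3, h4]

theorem around_swap (hc : W.graph.Connected) (a b x : Fin n) :
    W.around (b, a) x = W.around (a, b) x := by
  simp only [around, predOn_sp hc, Sym2.eq_swap]

theorem around_eq_of_mem (hc : W.graph.Connected) {e : Fin n × Fin n} {a b x : Fin n}
    (ha : a ∈ W.sp e.1 e.2) (hb : b ∈ W.sp e.1 e.2)
    (hx : x ∈ W.sp a b) (hxa : x ≠ a) (hxb : x ≠ b) :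
    W.around e x = W.around (a, b) x := by
  rcases le_total (W.dist e.1 a) (W.dist e.1 b) with h | h
  · exact around_eq_of_infix hc (sp_infix hc ha hb h) hx hxa hxb
  · rw [← around_swap hc a b]
    exact around_eq_of_infix hc (sp_infix hc hb ha h) ((mem_sp_comm hc).1 hx) hxb hxa

/-- Both paths run along the chosen path of `a` and `b`, possibly in opposite directions, so they
have the same unordered neighbours at the inner vertex `x`. -/
theorem not_isBranching_between (hc : W.graph.Connected) {e e' : Fin n × Fin n} {a x b : Fin n}
    (ha : W.IsBranching e e' a) (hx : W.IsBranching e e' x) (hb : W.IsBranching e e' b)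
    (hax : a ≠ x) (hxb : x ≠ b) (h : W.dist e.1 a ≤ W.dist e.1 x)
    (h' : W.dist e.1 x ≤ W.dist e.1 b) : False := by
  have hm := mem_sp_between hc ha.2.1 hx.2.1 hb.2.1 h h'
  exact hx.2.2.2 ((around_eq_of_mem hc ha.2.1 hb.2.1 hm hax.symm hxb).trans
    (around_eq_of_mem hc ha.2.2.1 hb.2.2.1 hm hax.symm hxb).symm)

/-- Two of the chosen shortest paths branch at two vertices at most. -/
theorem card_isBranching_le (hc : W.graph.Connected) (e e' : Fin n × Fin n) :
    (Finset.univ.filter fun x => W.IsBranching e e' x).card ≤ 2 := by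
  by_contra hcard
  obtain ⟨a, ha, b, hb, c, hcc, hab, hac, hbc⟩ := Finset.two_lt_card.1 (not_le.1 hcard)
  simp only [Finset.mem_filter, Finset.mem_univ, true_and] at ha hb hcc
  -- Ordered by distance from the start of the first path, one of the three vertices lies between
  -- the other two.
  rcases le_total (W.dist e.1 a) (W.dist e.1 b) with h1 | h1 <;>
  rcases le_total (W.dist e.1 b) (W.dist e.1 c) with h2 | h2 <;>
  rcases le_total (W.dist e.1 a) (W.dist e.1 c) with h3 | h3
  · exact not_isBranching_between hc ha hb hcc hab hbc h1 h2
  · exact not_isBranching_between hc ha hb hcc hab hbc h1 h2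
  · exact not_isBranching_between hc ha hcc hb hac hbc.symm h3 h2
  · exact not_isBranching_between hc hcc ha hb hac.symm hab h3 h1
  · exact not_isBranching_between hc hb ha hcc hab.symm hac h1 h3
  · exact not_isBranching_between hc hb hcc ha hbc hac.symm h2 h3
  · exact not_isBranching_between hc hcc hb ha hbc.symm hab.symm h2 h1
  · exact not_isBranching_between hc hcc hb ha hbc.symm hab.symm h2 h1

end WGraph

/-! ## Correctness and cost of the path-reporting part of a query -/

namespace Timed

variable {α β : Type}

@[simp] theorem val_bind (x : Timed α) (f : α → Timed β) : (x >>= f).val = (f x.val).val := rfl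

@[simp] theorem cost_bind (x : Timed α) (f : α → Timed β) :
    (x >>= f).cost = x.cost + (f x.val).cost := rfl

@[simp] theorem val_pure (x : α) : (pure x : Timed α).val = x := rfl

@[simp] theorem cost_pure (x : α) : (pure x : Timed α).cost = 0 := rfl

@[simp] theorem cost_tick (k : ℕ) : (tick k).cost = k := rfl

end Timed

namespace WGraph

variable {n : ℕ} {W : WGraph n}

/-- The number of vertices with smaller potential is the measure that shows that fuel `n` suffices
for following pointers. -/
theorem card_filter_lt_card {D : Fin n → ℝ} {x y : Fin n} (h : D y < D x) :
    (Finset.univ.filter fun w => D w < D y).card < (Finset.univ.filter fun w => D w < D x).card := by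
  refine Finset.card_lt_card ⟨fun w hw => ?_, fun hs => ?_⟩
  · simp only [Finset.mem_filter, Finset.mem_univ, true_and] at hw ⊢
    exact hw.trans h
  · have := hs (show y ∈ Finset.univ.filter fun w => D w < D x by simpa using h)
    simp at this

theorem card_filter_lt_lt (D : Fin n → ℝ) (x : Fin n) :
    (Finset.univ.filter fun w => D w < D x).card < n := by
  have h : x ∉ Finset.univ.filter fun w => D w < D x := by simp
  simpa using Finset.card_lt_univ_of_notMem h

/-- `good` is an invariant of the pointer chain and `D` a potential that drops by the edge weight at
each step, so the length telescopes. The accumulator is always the vertex list of a walk from the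
current vertex back to `u`, which each step extends at its front. Every step is paid for by a new
vertex, except for the last one, at the root. -/
theorem climb_spec_fuel {par : Fin n → Option (Fin n)} {z : Fin n} {good : Fin n → Prop}
    {D : Fin n → ℝ} (hroot : par z = none ∨ par z = some z)
    (hstep : ∀ x, good x → x ≠ z → ∃ y, par x = some y ∧ W.graph.Adj y x ∧ good y ∧
      D x = D y + W.wt s(y, x)) (f : ℕ) :
    ∀ x u, good x → (Finset.univ.filter fun w => D w < D x).card < f →
      ∀ p : W.graph.Walk x u, ∃ q : W.graph.Walk z u,
        (climb par f x p.support).val = (z, q.support) ∧ W.len q = D x - D z + W.len p ∧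
        (climb par f x p.support).cost + p.support.length ≤ q.support.length + 1 := by
  induction f with
  | zero => intro x u _ h; exact absurd h (Nat.not_lt_zero _)
  | succ f ih =>
    intro x u hx hf p
    by_cases hxz : x = z
    · subst hxz
      refine ⟨p, ?_, by simp, ?_⟩
      · rcases hroot with h | h <;> simp [climb, h]
      · rcases hroot with h | h <;> simp [climb, h, add_comm]
    · obtain ⟨y, hy, ha, hgy, hD⟩ := hstep x hx hxz
      have hlt : D y < D x := by have := W.wt_pos' ha; linarith
      have hcard := card_filter_lt_card hlt
      obtain ⟨q, h1, h2, h3⟩ := ih y u hgy (by omega) (.cons ha p)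
      have hyx : y ≠ x := ha.ne
      rw [SimpleGraph.Walk.support_cons] at h1 h3
      refine ⟨q, ?_, ?_, ?_⟩
      · simp [climb, hy, hyx, h1]
      · rw [h2, len_cons]; linarith
      · simp only [climb, hy, hyx, Timed.cost_bind, Timed.cost_tick, if_false]
        simp only [List.length_cons] at h3
        omega

theorem climb_spec {par : Fin n → Option (Fin n)} {z : Fin n} {good : Fin n → Prop}
    {D : Fin n → ℝ} (hroot : par z = none ∨ par z = some z)
    (hstep : ∀ x, good x → x ≠ z → ∃ y, par x = some y ∧ W.graph.Adj y x ∧ good y ∧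
      D x = D y + W.wt s(y, x)) {x u : Fin n} (hx : good x) (p : W.graph.Walk x u) :
    ∃ q : W.graph.Walk z u,
      (climb par n x p.support).val = (z, q.support) ∧ W.len q = D x - D z + W.len p ∧
      (climb par n x p.support).cost + p.support.length ≤ q.support.length + 1 :=
  climb_spec_fuel hroot hstep n x u hx (card_filter_lt_lt D x) p

/-! ### The path oracle -/

/-- The distance to `y` is the potential that bounds the number of iterations, and `prev` tells
which of the two edges at `z` was used to enter. Each new vertex costs two steps: one for the home
record and one for the branching record. -/
theorem dppro_walk_spec (hc : W.graph.Connected) {P : Finset (Fin n × Fin n)} {x y u : Fin n}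
    (hP : (x, y) ∈ P) (f : ℕ) :
    ∀ prev z, succOn (W.sp x y) prev = some z → z ≠ y →
      (Finset.univ.filter fun w => W.dist w y < W.dist z y).card ≤ f →
      ∀ p : W.graph.Walk z u, ∃ q : W.graph.Walk y u,
        ((W.dppro P).walk x y (predOn (W.sp x y) y) f prev z p.support).val = q.support ∧
        W.len q = W.dist z y + W.len p ∧
        ((W.dppro P).walk x y (predOn (W.sp x y) y) f prev z p.support).cost
          + 2 * p.support.length ≤ 2 * q.support.length := by
  induction f with
  | zero =>
    intro prev z _ hzy h
    -- Fuel zero cannot occur before the end of the path: `y` itself is counted.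
    have : y ∈ Finset.univ.filter fun w => W.dist w y < W.dist z y := by
      simpa using dist_pos hc hzy
    rw [Finset.card_eq_zero.1 (Nat.le_zero.1 h)] at this
    simp at this
  | succ f ih =>
    intro prev z hprev hzy hf p
    obtain ⟨hadj, -, hz, -⟩ := succOn_sp_adj hc hprev
    obtain ⟨z', ha, hs, hz', hd⟩ := exists_succ hc hz hzy
    have hpz : predOn (W.sp x y) z = some prev :=
      (predOn_eq_some_iff (nodup_sp hc _ _)).2 ((succOn_eq_some_iff (nodup_sp hc _ _)).1 hprev)
    have hlast : predOn (W.sp x y) y = some z ↔ z' = y := by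
      rw [predOn_eq_some_iff (nodup_sp hc _ _), ← succOn_eq_some_iff (nodup_sp hc _ _), hs,
        Option.some_inj]
    by_cases hl : z' = y
    · have hlast' := hlast.2 hl
      subst hl
      refine ⟨.cons ha.symm p, ?_, ?_, ?_⟩
      · simp [Dppro.walk, hlast']
      · rw [len_cons, hd, dist_self, Sym2.eq_swap]; ring
      · simp [Dppro.walk, hlast']; omega
    · have hlast' : predOn (W.sp x y) y ≠ some z := fun h => hl (hlast.1 h)
      have hlt : W.dist z' y < W.dist z y := by have := W.wt_pos' ha; linarith
      have hcard := card_filter_lt_card (D := fun w => W.dist w y) hlt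
      obtain ⟨q, h1, h2, h3⟩ := ih z z' hs hl (by omega) (.cons ha.symm p)
      rw [SimpleGraph.Walk.support_cons] at h1 h3
      have hex : ∃ r : (Fin n × Fin n) × Fin n × Fin n, r.1 ∈ P ∧
          predOn (W.sp r.1.1 r.1.2) z = some r.2.1 ∧ succOn (W.sp r.1.1 r.1.2) z = some r.2.2 :=
        ⟨((x, y), prev, z'), hP, hpz, hs⟩
      -- Whatever path was chosen as home of `z`, one iteration moves to the true successor `z'`: a
      -- branching record names it, and without a record the home path has the same two edges at
      -- `z`.
      have key : ((W.dppro P).walk x y (predOn (W.sp x y) y) (f + 1) prev z p.support) =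
          (do tick 2; (W.dppro P).walk x y (predOn (W.sp x y) y) f z z' (z' :: p.support)) := by
        rw [Dppro.walk, if_neg hlast']
        have hhome : (W.dppro P).home z = some hex.choose := dif_pos hex
        obtain ⟨hr1, hr2, hr3⟩ := hex.choose_spec
        generalize hex.choose = r at hhome hr1 hr2 hr3
        obtain ⟨hm, a, b⟩ := r
        simp only at hr1 hr2 hr3
        rw [hhome]
        by_cases hb : W.IsBranching hm (x, y) z
        · have : (W.dppro P).branch (hm, (x, y), z) = some
            ((predOn (W.sp hm.1 hm.2) z, succOn (W.sp hm.1 hm.2) z),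
             (predOn (W.sp x y) z, succOn (W.sp x y) z)) := if_pos ⟨hr1, hP, hb⟩
          simp only [this, hs]
          change Timed.mk _ _ = Timed.mk _ _
          simp; omega
        · have hnone : (W.dppro P).branch (hm, (x, y), z) = none := if_neg fun h => hb h.2.2
          have haround : W.around hm z = W.around (x, y) z := by
            by_contra hne
            refine hb ⟨fun heq => hne ?_, ?_, hz, hne⟩
            · simp only [around] at heq ⊢; rw [heq]
            · exact (mem_of_succOn hr3).subset (by simp)
          -- The home path may traverse `z` in either direction; the neighbour other than `prev` is
          -- the right one.
          have hz'' : (if a = prev then b else a) = z' := by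
            simp only [around, hr2, hr3, hpz, hs, Sym2.eq_iff, Option.some_inj] at haround
            rcases haround with ⟨h1, h2⟩ | ⟨h1, h2⟩
            · rw [if_pos h1, h2]
            · split_ifs with h
              · rw [h2, ← h, h1]
              · exact h1
          simp only [hnone, hz'']
          change Timed.mk _ _ = Timed.mk _ _
          simp; omega
      refine ⟨q, ?_, ?_, ?_⟩
      · rw [key]; simpa using h1
      · rw [h2, len_cons, hd, Sym2.eq_swap]; ring
      · rw [key]
        simp only [Timed.cost_bind, Timed.cost_tick, List.length_cons] at h3 ⊢
        omega

theorem dppro_query_spec (hc : W.graph.Connected) {P : Finset (Fin n × Fin n)} {x y u : Fin n}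
    (hP : (x, y) ∈ P) (p : W.graph.Walk x u) : ∃ q : W.graph.Walk y u,
      ((W.dppro P).query x y p.support).val = q.support ∧ W.len q = W.dist x y + W.len p ∧
      ((W.dppro P).query x y p.support).cost + 2 * p.support.length ≤
        2 * q.support.length + 1 := by
  have hends : (W.dppro P).ends (x, y) = some (succOn (W.sp x y) x, predOn (W.sp x y) y) :=
    if_pos hP
  -- For `x = y` the stored first edge is `none`, so the query returns the accumulator unchanged.
  by_cases hxy : x = y
  · subst hxy
    refine ⟨p, ?_, by simp, ?_⟩ <;> simp [Dppro.query, hends, succOn_sp_self hc]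
    omega
  · obtain ⟨z, ha, hs, -, hd⟩ := exists_succ hc (left_mem_sp hc x y) hxy
    by_cases hzy : z = y
    · subst hzy
      refine ⟨.cons ha.symm p, ?_, ?_, ?_⟩
      · simp [Dppro.query, hends, hs]
      · rw [len_cons, hd, dist_self, Sym2.eq_swap]; ring
      · simp [Dppro.query, hends, hs]; omega
    · obtain ⟨q, h1, h2, h3⟩ := dppro_walk_spec hc hP n x z hs hzy
        (card_filter_lt_lt (fun w => W.dist w y) z).le (.cons ha.symm p)
      rw [SimpleGraph.Walk.support_cons] at h1 h3
      refine ⟨q, ?_, ?_, ?_⟩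
      · simpa [Dppro.query, hends, hs, hzy] using h1
      · rw [h2, len_cons, hd, Sym2.eq_swap]; ring
      · simp only [Dppro.query, hends, hs, hzy, if_false, Timed.cost_bind, Timed.cost_tick,
          List.length_cons] at h3 ⊢
        omega

/-! ### The forests -/

theorem nearest_eq_some_iff {L : Finset (Fin n)} {v z : Fin n} :
    W.nearest L v = some z ↔ (z ∈ L ∧ ∀ z' ∈ L, W.dist v z ≤ W.dist v z') ∧
      ∀ y ∈ L, (∀ z' ∈ L, W.dist v y ≤ W.dist v z') → z ≤ y := by
  unfold nearest
  constructor
  · intro h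
    simp only at h
    split_ifs at h with hS
    cases h
    have := Finset.min'_mem _ hS
    simp only [Finset.mem_filter] at this
    exact ⟨this, fun y h1 h2 => Finset.min'_le _ _ (Finset.mem_filter.2 ⟨h1, h2⟩)⟩
  · intro h
    have hz : z ∈ L.filter fun z => ∀ z' ∈ L, W.dist v z ≤ W.dist v z' :=
      Finset.mem_filter.2 h.1
    simp only
    rw [dif_pos ⟨z, hz⟩]
    refine congrArg some (le_antisymm (Finset.min'_le _ _ hz) ?_)
    refine Finset.le_min' _ _ _ fun y hy => ?_
    rw [Finset.mem_filter] at hy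
    exact h.2 y hy.1 hy.2

theorem exists_nearest {L : Finset (Fin n)} (hL : L.Nonempty) (v : Fin n) :
    ∃ z, W.nearest L v = some z := by
  obtain ⟨z, hz, h⟩ := Finset.exists_min_image L (W.dist v) hL
  refine ⟨_, dif_pos (⟨z, Finset.mem_filter.2 ⟨hz, h⟩⟩ : Finset.Nonempty _)⟩

/-- A step towards `z` shortens the distance to `z` by the full edge weight and to any other
landmark by no more. So `z` stays nearest, and a landmark that ties with it at `y` ties at `v` too,
where `z` has the least number. Hence the parent pointers never leave the tree of `z`. -/
theorem nearest_of_succOn (hc : W.graph.Connected) {L : Finset (Fin n)} {v y z : Fin n}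
    (h : W.nearest L v = some z) (hs : succOn (W.sp v z) v = some y) :
    W.nearest L y = some z := by
  rw [nearest_eq_some_iff] at h ⊢
  obtain ⟨ha, -, -, hd⟩ := succOn_sp_adj hc hs
  have h1 : ∀ z' ∈ L, W.dist y z ≤ W.dist y z' := fun z' hz' => by
    have := h.1.2 z' hz'
    have := dist_triangle hc v y z'
    have := dist_le_wt ha
    linarith
  refine ⟨⟨h.1.1, h1⟩, fun w hw hw' => h.2 w hw fun z' hz' => ?_⟩
  have := h.1.2 z' hz'
  have := hw' z h.1.1
  have := dist_triangle hc v y w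
  have := dist_le_wt ha
  linarith

/-- Only for a landmark is the chosen path to the nearest one trivial, where the default of `getD`
makes it its own parent. This turns the stopping test of the query into membership in `L 1`. -/
theorem forest_eq_self_iff (hc : W.graph.Connected) (h : ℕ) (L : ℕ → Finset (Fin n)) (i : ℕ)
    (x : Fin n) : (W.oracle h L).forest i x = some x ↔ x ∈ L i := by
  change (W.nearest (L i) x).map _ = some x ↔ _
  constructor
  · intro hx
    obtain ⟨z, hz, hzx⟩ := Option.map_eq_some_iff.1 hx
    by_cases hxz : x = z
    · subst hxz; exact (nearest_eq_some_iff.1 hz).1.1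
    · obtain ⟨y, ha, hs, -⟩ := exists_succ hc (left_mem_sp hc x z) hxz
      rw [hs, Option.getD_some] at hzx
      exact absurd hzx.symm ha.ne
  · intro hx
    have : W.nearest (L i) x = some x := by
      rw [nearest_eq_some_iff]
      refine ⟨⟨hx, fun z' _ => by rw [dist_self]; exact W.dist_nonneg _ _⟩, fun y hy h' => ?_⟩
      by_contra hne
      have h1 := h' x hx
      have h2 := dist_pos hc (show x ≠ y by rintro rfl; exact hne le_rfl)
      rw [dist_self] at h1
      linarith
    rw [this, Option.map_some, succOn_sp_self hc, Option.getD_none]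

theorem forest_climb_spec (hc : W.graph.Connected) (h : ℕ) (L : ℕ → Finset (Fin n)) (i : ℕ)
    {x z u : Fin n} (hz : W.nearest (L i) x = some z) (p : W.graph.Walk x u) :
    ∃ q : W.graph.Walk z u, (climb ((W.oracle h L).forest i) n x p.support).val = (z, q.support) ∧
      W.len q = W.dist x z + W.len p ∧
      (climb ((W.oracle h L).forest i) n x p.support).cost + p.support.length ≤
        q.support.length + 1 := by
  have hzL := (nearest_eq_some_iff.1 hz).1.1
  have := climb_spec (W := W) (par := (W.oracle h L).forest i) (z := z)
    (good := fun x => W.nearest (L i) x = some z) (D := fun x => W.dist x z)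
    (Or.inr ((forest_eq_self_iff hc h L i z).2 hzL)) (fun x hx hxz => by
      obtain ⟨y, ha, hs, -, hd⟩ := exists_succ hc (left_mem_sp hc x z) hxz
      refine ⟨y, ?_, ha.symm, nearest_of_succOn hc hx hs, ?_⟩
      · change (W.nearest (L i) x).map _ = some y
        rw [hx, Option.map_some, hs, Option.getD_some]
      · rw [hd, Sym2.eq_swap, add_comm]) hz p
  simpa using this

/-! ### The levels -/

/-- Here `f` is the number of levels still above `j`. The factor a_f = 2·7^f - 1 solves a_0 = 1,
a_{f+1} = 3 + 3 + 7·a_f: two climbs of at most three times the current distance, then a pair at most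
seven times as far apart. In the cost, a vertex of `p` weighs 2 and one of `q` weighs 1, so that
climbing and tracing are paid for by the growth of the walks. -/
theorem levels_spec (hc : W.graph.Connected) (h : ℕ) (L : ℕ → Finset (Fin n)) {u₀ v₀ : Fin n}
    (f : ℕ) : ∀ (j : ℕ) (u v : Fin n), j + f = h → u ∈ L j → v ∈ L j →
      ∀ (p : W.graph.Walk u u₀) (q : W.graph.Walk v v₀), ∃ r : W.graph.Walk u₀ v₀,
        ((W.oracle h L).levels (f + 1) j u v p.support q.support).val = r.support ∧
        W.len r ≤ W.len p + W.len q + (2 * 7 ^ f - 1) * W.dist u v ∧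
        ((W.oracle h L).levels (f + 1) j u v p.support q.support).cost + 2 * p.support.length
          + q.support.length ≤ 4 * f + 3 * r.support.length + 5 := by
  induction f with
  | zero =>
    intro j u v hj hu hv p q
    obtain rfl : j = h := by omega
    have hP : (u, v) ∈ W.pairs j L j := Finset.mem_filter.2 ⟨Finset.mk_mem_product hu hv, .inl rfl⟩
    obtain ⟨r, h1, h2, h3⟩ := dppro_query_spec hc hP p
    change (((W.oracle j L).dp j).query u v p.support).val = _ at h1
    change (((W.oracle j L).dp j).query u v p.support).cost + _ ≤ _ at h3
    refine ⟨r.reverse.append q, ?_, ?_, ?_⟩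
    · simp [Oracle.levels, joinRev, h1, SimpleGraph.Walk.support_append]
    · rw [len_append, len_reverse, h2]; linarith
    · simp only [Oracle.levels, true_or, if_true, joinRev, Timed.cost_bind,
        Timed.cost_tick, Timed.cost_pure, h1, SimpleGraph.Walk.length_support,
        SimpleGraph.Walk.length_append, SimpleGraph.Walk.length_reverse] at h3 ⊢
      omega
  | succ f ih =>
    intro j u v hj hu hv p q
    have hjh : j ≠ h := by omega
    by_cases hP : (u, v) ∈ W.pairs h L j
    · have hhash : (((W.oracle h L).hash j (u, v)).isSome : Prop) := by
        simp [oracle, hP]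
      obtain ⟨r, h1, h2, h3⟩ := dppro_query_spec hc hP p
      change (((W.oracle h L).dp j).query u v p.support).val = _ at h1
      change (((W.oracle h L).dp j).query u v p.support).cost + _ ≤ _ at h3
      refine ⟨r.reverse.append q, ?_, ?_, ?_⟩
      · rw [Oracle.levels]
        simp [hhash, joinRev, h1, SimpleGraph.Walk.support_append]
      · have : (1 : ℝ) ≤ 7 ^ (f + 1) := one_le_pow₀ (by norm_num)
        have := mul_le_mul_of_nonneg_right this (W.dist_nonneg u v)
        rw [len_append, len_reverse, h2]; linarith
      · rw [Oracle.levels]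
        simp only [hhash, or_true, if_true, joinRev, Timed.cost_bind,
          Timed.cost_tick, Timed.cost_pure, h1, SimpleGraph.Walk.length_support,
          SimpleGraph.Walk.length_append, SimpleGraph.Walk.length_reverse] at h3 ⊢
        omega
    · have hhash : ¬ ((W.oracle h L).hash j (u, v)).isSome := by
        simp [oracle, hP]
      have hball : ¬ W.InBall (1 / 3) (L (j + 1)) u v ∧ ¬ W.InBall (1 / 3) (L (j + 1)) v u := by
        by_contra hcon
        refine hP (Finset.mem_filter.2 ⟨Finset.mk_mem_product hu hv, Or.inr ?_⟩)
        simp only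
        tauto
      -- Lying outside the ball also shows that there is a landmark at the next level, since with no
      -- landmark every vertex is in the ball.
      have hnear : ∀ {a b}, ¬ W.InBall (1 / 3) (L (j + 1)) a b → ∃ z, W.nearest (L (j + 1)) a
          = some z ∧ z ∈ L (j + 1) ∧ W.dist a z ≤ 3 * W.dist a b := by
        intro a b hab
        simp only [InBall, not_forall, not_lt] at hab
        obtain ⟨z', hz', hd⟩ := hab
        obtain ⟨z, hz⟩ := exists_nearest (W := W) ⟨z', hz'⟩ a
        obtain ⟨⟨hzL, hz1⟩, -⟩ := nearest_eq_some_iff.1 hz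
        have := hz1 z' hz'
        exact ⟨z, hz, hzL, by linarith⟩
      obtain ⟨a, ha, haL, had⟩ := hnear hball.1
      obtain ⟨b, hb, hbL, hbd⟩ := hnear hball.2
      rw [dist_comm hc v u] at hbd
      obtain ⟨p', hp1, hp2, hp3⟩ := forest_climb_spec hc h L (j + 1) ha p
      obtain ⟨q', hq1, hq2, hq3⟩ := forest_climb_spec hc h L (j + 1) hb q
      obtain ⟨r, hr1, hr2, hr3⟩ := ih (j + 1) a b (by omega) haL hbL p' q'
      -- 7 = 3 + 1 + 3, through `u` and `v`.
      have hd : W.dist a b ≤ 7 * W.dist u v := by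
        have h1 := dist_triangle hc a u b
        have h2 := dist_triangle hc u v b
        rw [dist_comm hc a u] at h1
        linarith
      refine ⟨r, ?_, ?_, ?_⟩
      · rw [Oracle.levels]
        simp [hhash, hjh, hp1, hq1, hr1]
      · have h1 : (0 : ℝ) ≤ 2 * 7 ^ f - 1 := by
          have : (1 : ℝ) ≤ 7 ^ f := one_le_pow₀ (by norm_num)
          linarith
        have := mul_le_mul_of_nonneg_left hd h1
        rw [hp2, hq2] at hr2
        rw [pow_succ]
        linarith
      · rw [Oracle.levels]
        simp only [hhash, hjh, or_self, Bool.false_eq_true, if_false, Timed.cost_bind, Timed.cost_tick, hp1, hq1]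
        omega

/-- An exploration reports a shortest path, or it met a vertex with `halt` that is at most as far
away as the target. -/
def SearchCorrect (W : WGraph n) (S : Search n) : Prop :=
  ∀ halt src target,
    (∀ par, (S W.adj halt src target).val = some par → ∃ q : W.graph.Walk src target,
      (climb par n target [target]).val = (src, q.support) ∧ W.len q = W.dist src target ∧
      (climb par n target [target]).cost ≤ q.support.length) ∧
    ((S W.adj halt src target).val = none →
      ∃ z, halt z = true ∧ W.dist src z ≤ W.dist src target)

/-- The stopping predicate of the explorations. -/
def haltAt (L : Finset (Fin n)) (x : Fin n) : Bool := decide (x ∈ L)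

/-- With D = d(u,v) and h = f + 1, a query that reaches the levels reports length at most D + D +
(2·7^f - 1)·3D = (6·7^f - 1)·D, below 7^h·D. The time apart from the two explorations is linear in
`h` and in the number of reported vertices. -/
theorem query_spec (hc : W.graph.Connected) {S : Search n} (hS : W.SearchCorrect S) {h : ℕ}
    (hh : 1 ≤ h) (L : ℕ → Finset (Fin n)) (u v : Fin n) : ∃ r : W.graph.Walk u v,
      ((W.oracle h L).query S W.adj u v).val = r.support ∧
      W.len r ≤ 7 ^ h * W.dist u v ∧
      ((W.oracle h L).query S W.adj u v).cost ≤ (S W.adj (haltAt (L 1)) v u).cost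
        + (S W.adj (haltAt (L 1)) u v).cost + 4 * h + 5 * r.support.length + 10 := by
  have hhalt : (fun x => decide ((W.oracle h L).forest 1 x = some x)) = haltAt (L 1) := by
    funext x; simp only [haltAt, forest_eq_self_iff hc]
  have hpow : (1 : ℝ) ≤ 7 ^ h := one_le_pow₀ (by norm_num)
  have hmul := mul_le_mul_of_nonneg_right hpow (W.dist_nonneg u v)
  unfold Oracle.query
  simp only [hhalt]
  rcases h1 : (S W.adj (haltAt (L 1)) v u).val with _ | par
  swap
  · obtain ⟨q, hq1, hq2, hq3⟩ := (hS (haltAt (L 1)) v u).1 par h1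
    refine ⟨q.reverse, ?_, ?_, ?_⟩
    · simp [h1, hq1, joinRev]
    · rw [len_reverse, hq2, dist_comm hc]; linarith
    · simp only [Timed.cost_bind, h1, hq1, joinRev, Timed.cost_tick, Timed.cost_pure,
        SimpleGraph.Walk.support_reverse, List.length_reverse]
      omega
  rcases h2 : (S W.adj (haltAt (L 1)) u v).val with _ | par
  swap
  · obtain ⟨q, hq1, hq2, hq3⟩ := (hS (haltAt (L 1)) u v).1 par h2
    refine ⟨q, ?_, ?_, ?_⟩
    · simp [h1, h2, hq1]
    · rw [hq2]; linarith
    · simp only [Timed.cost_bind, h1, h2, hq1, Timed.cost_pure]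
      omega
  -- A failed exploration met a landmark no farther away than the target, so the nearest landmark
  -- exists and is that close.
  have hnear : ∀ {a b}, (S W.adj (haltAt (L 1)) a b).val = none → ∃ z, W.nearest (L 1) a
      = some z ∧ z ∈ L 1 ∧ W.dist a z ≤ W.dist a b := by
    intro a b hab
    obtain ⟨z', hz', hd⟩ := (hS _ _ _).2 hab
    have hz' : z' ∈ L 1 := by simpa [haltAt] using hz'
    obtain ⟨z, hz⟩ := exists_nearest (W := W) ⟨z', hz'⟩ a
    obtain ⟨⟨hzL, hz1⟩, -⟩ := nearest_eq_some_iff.1 hz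
    exact ⟨z, hz, hzL, (hz1 z' hz').trans hd⟩
  obtain ⟨b, hb, hbL, hbd⟩ := hnear h1
  obtain ⟨a, ha, haL, had⟩ := hnear h2
  rw [dist_comm hc v u] at hbd
  obtain ⟨p, hp1, hp2, hp3⟩ := forest_climb_spec hc h L 1 ha (.nil : W.graph.Walk u u)
  obtain ⟨q, hq1, hq2, hq3⟩ := forest_climb_spec hc h L 1 hb (.nil : W.graph.Walk v v)
  rw [SimpleGraph.Walk.support_nil] at hp1 hp3 hq1 hq3
  obtain ⟨f, rfl⟩ : ∃ f, h = f + 1 := ⟨h - 1, by omega⟩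
  obtain ⟨r, hr1, hr2, hr3⟩ := levels_spec hc (f + 1) L f 1 a b (by omega) haL hbL p q
  refine ⟨r, ?_, ?_, ?_⟩
  · simp [h1, h2, hp1, hq1, hr1]
  · have hd : W.dist a b ≤ 3 * W.dist u v := by
      have h1 := dist_triangle hc a u b
      have h2 := dist_triangle hc u v b
      rw [dist_comm hc a u] at h1
      linarith
    have h1 : (0 : ℝ) ≤ 2 * 7 ^ f - 1 := by
      have : (1 : ℝ) ≤ 7 ^ f := one_le_pow₀ (by norm_num)
      linarith
    have := mul_le_mul_of_nonneg_left hd h1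
    have h3 : (0 : ℝ) ≤ 7 ^ f * W.dist u v := mul_nonneg (by positivity) (W.dist_nonneg u v)
    have h4 := W.dist_nonneg u v
    rw [hp2, hq2, len_nil, len_nil] at hr2
    rw [pow_succ]
    linarith
  · simp only [Timed.cost_bind, h1, h2, hp1, hq1]
    simp only [List.length_singleton] at hp3 hq3
    omega

end WGraph

/-! ## Leftist heaps -/

namespace Heap

variable {α : Type}

theorem rank_node (r : ℕ) (k : ℝ) (x : α) (a b : Heap α) : (node r k x a b).rank = r := rfl

/-- The keys and values of a heap. -/
def elems : Heap α → Multiset (ℝ × α)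
  | empty => 0
  | node _ k x l r => (k, x) ::ₘ (l.elems + r.elems)

/-- The invariant of leftist heaps. -/
def Ok : Heap α → Prop
  | empty => True
  | node n k _ l r => l.Ok ∧ r.Ok ∧ n = r.rank + 1 ∧ r.rank ≤ l.rank ∧
      ∀ e ∈ l.elems + r.elems, k ≤ e.1

theorem ok_mk {k : ℝ} {x : α} {a b : Heap α} (ha : a.Ok) (hb : b.Ok)
    (h : ∀ e ∈ a.elems + b.elems, k ≤ e.1) :
    (mk k x a b).Ok ∧ (mk k x a b).elems = (k, x) ::ₘ (a.elems + b.elems) := by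
  unfold mk
  split_ifs with hr
  · exact ⟨⟨ha, hb, rfl, hr, h⟩, rfl⟩
  · refine ⟨⟨hb, ha, rfl, by omega, by rwa [add_comm]⟩, ?_⟩
    rw [elems, add_comm a.elems]

theorem Ok.key_le {r : ℕ} {k : ℝ} {x : α} {a b : Heap α} (h : (node r k x a b).Ok) :
    ∀ e ∈ (node r k x a b).elems, k ≤ e.1 := by
  intro e he
  rw [elems, Multiset.mem_cons] at he
  rcases he with rfl | he
  · exact le_rfl
  · exact h.2.2.2.2 e he

/-- Merging descends along the two right spines only, and the rank of a leftist heap is the length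
of its right spine. -/
theorem merge_spec (a b : Heap α) (ha : a.Ok) (hb : b.Ok) :
    (merge a b).val.Ok ∧ (merge a b).val.elems = a.elems + b.elems ∧
      (merge a b).cost ≤ a.rank + b.rank + 1 := by
  induction a, b using Heap.merge.induct with
  | case1 b => simp [merge, hb, elems]
  | case2 r k x l s => simp [merge, ha, elems]
  | case3 r k x l s r' k' x' l' s' hk ih =>
    obtain ⟨h1, h2, h3⟩ := ih ha.2.1 hb
    rw [merge, if_pos hk]
    have hle : ∀ e ∈ l.elems + (merge s (node r' k' x' l' s')).val.elems, k ≤ e.1 := by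
      intro e he
      rw [h2, ← add_assoc, Multiset.mem_add] at he
      rcases he with he | he
      · exact ha.2.2.2.2 e he
      · exact hk.trans (hb.key_le e he)
    obtain ⟨h4, h5⟩ := ok_mk (x := x) ha.1 h1 hle
    refine ⟨h4, ?_, ?_⟩
    · simp only [Timed.val_bind, Timed.val_pure]
      rw [h5, h2]
      simp only [elems, Multiset.cons_add, add_assoc]
    · have := ha.2.2.1
      simp only [Timed.cost_bind, Timed.cost_tick, Timed.cost_pure, rank_node] at h3 ⊢
      omega
  | case4 r k x l s r' k' x' l' s' hk ih =>
    obtain ⟨h1, h2, h3⟩ := ih ha hb.2.1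
    rw [merge, if_neg hk]
    have hle : ∀ e ∈ l'.elems + (merge (node r k x l s) s').val.elems, k' ≤ e.1 := by
      intro e he
      rw [h2, add_left_comm, Multiset.mem_add] at he
      rcases he with he | he
      · exact (not_le.1 hk).le.trans (ha.key_le e he)
      · exact hb.2.2.2.2 e he
    obtain ⟨h4, h5⟩ := ok_mk (x := x') hb.1 h1 hle
    refine ⟨h4, ?_, ?_⟩
    · simp only [Timed.val_bind, Timed.val_pure]
      rw [h5, h2, add_left_comm, ← Multiset.add_cons]
      rfl
    · have := hb.2.2.1
      simp only [Timed.cost_bind, Timed.cost_tick, Timed.cost_pure, rank_node] at h3 ⊢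
      omega

/-- The right child has the smaller rank, so both children satisfy the bound with exponent one less,
and the sizes at least double. -/
theorem two_pow_rank_le (a : Heap α) (ha : a.Ok) : 2 ^ a.rank ≤ a.elems.card + 1 := by
  induction a with
  | empty => simp [rank, elems]
  | node r k x l s ihl ihs =>
    obtain ⟨h1, h2, h3, h4, -⟩ := ha
    have h5 := ihl h1
    have h6 := ihs h2
    have h7 : 2 ^ s.rank ≤ 2 ^ l.rank := Nat.pow_le_pow_right (by norm_num) h4
    simp only [rank_node, elems, Multiset.card_cons, Multiset.card_add, h3, pow_succ]
    omega

theorem rank_le_log (a : Heap α) (ha : a.Ok) {N : ℕ} (h : a.elems.card ≤ N) :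
    a.rank ≤ Nat.log 2 (N + 1) :=
  Nat.le_log_of_pow_le (by norm_num) ((a.two_pow_rank_le ha).trans (by omega))

theorem ok_singleton (k : ℝ) (x : α) : (node 1 k x empty empty).Ok :=
  ⟨trivial, trivial, rfl, le_rfl, by simp [elems]⟩

end Heap

/-! ## Dijkstra's algorithm -/

/-- The new distance `c` improves on the recorded distance. -/
def Improves (d : Option ℝ) (c : ℝ) : Prop := ∀ a, d = some a → c < a

/-- An unset distance is improved by anything, vacuously in `Improves`; this merges the two cases of
the test. -/
theorem relaxAll_cons {n : ℕ} (x : Fin n) (k : ℝ) (y : Fin n) (w : ℝ) (l : List (Fin n × ℝ))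
    (s : DState n) : relaxAll x k ((y, w) :: l) s =
      if Improves (s.dist y) (k + w) then do
        tick 1
        let hp ← Heap.merge s.heap (Heap.node 1 (k + w) y Heap.empty Heap.empty)
        relaxAll x k l
          { s with
            dist := Function.update s.dist y (some (k + w))
            par := Function.update s.par y (some x)
            heap := hp }
      else (do
        tick 1
        relaxAll x k l s) := by
  rw [relaxAll]
  rcases h : s.dist y with _ | d
  · have : Improves none (k + w) := by intro a ha; cases ha
    simp [this]
  · have : Improves (some d) (k + w) ↔ k + w < d := by simp [Improves]
    by_cases hd : k + w < d <;> simp [this, hd]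

/-- The neighbours in the list are distinct, so each test sees the label that the neighbour had at
the start, and the result can be described by the initial state alone. Improved vertices are
inserted again without removing the old entry. `N` bounds the queue size throughout, so each
insertion has the same logarithmic bound. -/
theorem relaxAll_spec {n : ℕ} (x : Fin n) (k : ℝ) (l : List (Fin n × ℝ))
    (hl : (l.map Prod.fst).Nodup) : ∀ s : DState n, s.heap.Ok →
      let s' := (relaxAll x k l s).val
      s'.settled = s.settled ∧ s'.heap.Ok ∧
      (∀ y w, (y, w) ∈ l → Improves (s.dist y) (k + w) →
        s'.dist y = some (k + w) ∧ s'.par y = some x) ∧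
      (∀ y, (∀ w, (y, w) ∈ l → ¬ Improves (s.dist y) (k + w)) →
        s'.dist y = s.dist y ∧ s'.par y = s.par y) ∧
      (∀ e, e ∈ s'.heap.elems ↔ e ∈ s.heap.elems ∨
        ∃ y w, (y, w) ∈ l ∧ Improves (s.dist y) (k + w) ∧ e = (k + w, y)) ∧
      s'.heap.elems.card ≤ s.heap.elems.card + l.length ∧
      ∀ N, s.heap.elems.card + l.length ≤ N →
        (relaxAll x k l s).cost ≤ l.length * (Nat.log 2 (N + 1) + 3) + 1 := by
  induction l with
  | nil => intro s hs; simp [relaxAll, hs]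
  | cons a l ih =>
    obtain ⟨y, w⟩ := a
    rw [List.map_cons, List.nodup_cons] at hl
    have hy : ∀ w', (y, w') ∉ l := fun w' h => hl.1 (List.mem_map.2 ⟨_, h, rfl⟩)
    intro s hs
    rw [relaxAll_cons]
    by_cases himp : Improves (s.dist y) (k + w)
    · rw [if_pos himp]
      obtain ⟨hm1, hm2, hm3⟩ := Heap.merge_spec s.heap _ hs (Heap.ok_singleton (k + w) y)
      obtain ⟨h1, h2, h3, h4, h5, h6, h7⟩ := ih hl.2 { s with
            dist := Function.update s.dist y (some (k + w))
            par := Function.update s.par y (some x)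
            heap := (Heap.merge s.heap (Heap.node 1 (k + w) y Heap.empty Heap.empty)).val } hm1
      simp only [Timed.val_bind, Timed.cost_bind, Timed.cost_tick]
      have hupd : ∀ z w', (z, w') ∈ l → z ≠ y := by rintro z w' hz rfl; exact hy _ hz
      refine ⟨h1, h2, ?_, ?_, ?_, ?_, ?_⟩
      · intro z w' hz hi
        rcases List.mem_cons.1 hz with hz | hz
        · cases hz
          have := h4 y fun w' hw' => absurd hw' (hy w')
          simpa using this
        · refine h3 z w' hz ?_
          simpa only [Function.update_of_ne (hupd z w' hz)] using hi
      · intro z hz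
        have hzy : z ≠ y := by rintro rfl; exact hz w (by simp) himp
        have := h4 z fun w' hw' => by
          simp only [Function.update_of_ne hzy]
          exact hz w' (List.mem_cons_of_mem _ hw')
        simpa [Function.update_of_ne hzy] using this
      · intro e
        rw [h5]
        simp only [hm2, Heap.elems, Multiset.mem_add, add_zero, Multiset.mem_cons,
          Multiset.notMem_zero, or_false, List.mem_cons]
        constructor
        · rintro ((h | h) | ⟨z, w', hz, hi, he⟩)
          · exact .inl h
          · exact .inr ⟨y, w, .inl rfl, himp, h⟩
          · rw [Function.update_of_ne (hupd z w' hz)] at hi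
            exact .inr ⟨z, w', .inr hz, hi, he⟩
        · rintro (h | ⟨z, w', hz | hz, hi, he⟩)
          · exact .inl (.inl h)
          · cases hz; exact .inl (.inr he)
          · refine .inr ⟨z, w', hz, ?_, he⟩
            simpa only [Function.update_of_ne (hupd z w' hz)] using hi
      · simp only [hm2, Heap.elems, Multiset.card_add, Multiset.card_cons, Multiset.card_zero,
          List.length_cons] at h6 ⊢
        omega
      · intro N hN
        simp only [hm2, Heap.elems, Multiset.card_add, Multiset.card_cons, Multiset.card_zero,
          List.length_cons] at h7 hN ⊢
        have h8 := h7 N (by omega)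
        have h9 := Heap.rank_le_log s.heap hs (N := N) (by omega)
        simp only [Heap.rank_node] at hm3
        rw [Nat.add_mul]
        omega
    · rw [if_neg himp]
      obtain ⟨h1, h2, h3, h4, h5, h6, h7⟩ := ih hl.2 s hs
      simp only [Timed.val_bind, Timed.cost_bind, Timed.cost_tick]
      refine ⟨h1, h2, ?_, ?_, ?_, ?_, ?_⟩
      · intro z w' hz hi
        rcases List.mem_cons.1 hz with hz | hz
        · cases hz; exact absurd hi himp
        · exact h3 z w' hz hi
      · intro z hz
        exact h4 z fun w' hw' => hz w' (List.mem_cons_of_mem _ hw')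
      · intro e
        rw [h5]
        refine or_congr Iff.rfl ⟨?_, ?_⟩
        · rintro ⟨z, w', hz, hi, he⟩; exact ⟨z, w', List.mem_cons_of_mem _ hz, hi, he⟩
        · rintro ⟨z, w', hz, hi, he⟩
          rcases List.mem_cons.1 hz with hz | hz
          · cases hz; exact absurd hi himp
          · exact ⟨z, w', hz, hi, he⟩
      · simp only [List.length_cons]; omega
      · intro N hN
        simp only [List.length_cons] at hN ⊢
        have h8 := h7 N (by omega)
        rw [Nat.add_mul]
        omega

namespace WGraph

variable {n : ℕ} {W : WGraph n}

theorem mem_adj {x y : Fin n} {w : ℝ} :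
    (y, w) ∈ W.adj x ↔ W.graph.Adj x y ∧ w = W.wt s(x, y) := by
  simp only [adj, List.mem_map, Finset.mem_sort, nbrs, Finset.mem_filter, Finset.mem_univ,
    true_and, Prod.mk.injEq]
  constructor
  · rintro ⟨z, h, rfl, rfl⟩; exact ⟨h, rfl⟩
  · rintro ⟨h, rfl⟩; exact ⟨y, h, rfl, rfl⟩

theorem adj_map_fst (x : Fin n) : (W.adj x).map Prod.fst = (W.nbrs x).sort := by
  simp [adj, Function.comp_def]

theorem nodup_adj (x : Fin n) : ((W.adj x).map Prod.fst).Nodup := by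
  rw [adj_map_fst]; exact Finset.sort_nodup _ _

theorem length_adj (x : Fin n) : (W.adj x).length = W.deg x := by
  simp [adj, deg]

/-- The invariant of Dijkstra's algorithm. -/
structure DInv (W : WGraph n) (src : Fin n) (s : DState n) : Prop where
  heap_ok : s.heap.Ok
  src_dist : s.dist src = some 0
  src_par : s.par src = none
  par : ∀ x k, s.dist x = some k → x ≠ src → ∃ y, s.par x = some y ∧ s.settled y = true ∧
    W.graph.Adj y x ∧ k = W.dist src y + W.wt s(y, x)
  settled : ∀ x, s.settled x = true → s.dist x = some (W.dist src x)
  relaxed : ∀ y z, s.settled y = true → W.graph.Adj y z →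
    ∃ k, s.dist z = some k ∧ k ≤ W.dist src y + W.wt s(y, z)
  queued : ∀ x k, s.settled x = false → s.dist x = some k → (k, x) ∈ s.heap.elems
  heap_le : ∀ x k, (k, x) ∈ s.heap.elems → ∃ k', s.dist x = some k' ∧ k' ≤ k

theorem dist_le_add_wt (hc : W.graph.Connected) (u : Fin n) {y x : Fin n}
    (h : W.graph.Adj y x) : W.dist u x ≤ W.dist u y + W.wt s(y, x) :=
  (dist_triangle hc u y x).trans (by have := dist_le_wt h; linarith)

theorem DInv.dist_le (hc : W.graph.Connected) {src : Fin n} {s : DState n} (h : DInv W src s)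
    {x : Fin n} {k : ℝ} (hx : s.dist x = some k) : W.dist src x ≤ k := by
  by_cases hxs : x = src
  · subst hxs; rw [h.src_dist] at hx; cases hx; simp
  · obtain ⟨y, -, -, ha, rfl⟩ := h.par x k hx hxs
    exact dist_le_add_wt hc src ha

/-- Where the walk first leaves the settled vertices, the edge was relaxed from an exact label, and
the new end point is queued with a key at most the length so far. -/
theorem DInv.frontier_walk (hc : W.graph.Connected) {src : Fin n} {s : DState n}
    (h : DInv W src s) {a x : Fin n} (p : W.graph.Walk a x) (ha : s.settled a = true)
    (hx : s.settled x = false) :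
    ∃ k z, (k, z) ∈ s.heap.elems ∧ k ≤ W.dist src a + W.len p := by
  induction p with
  | nil => rw [ha] at hx; cases hx
  | @cons a b x hab p ih =>
    have h0 := W.len_nonneg p
    rw [len_cons]
    cases hb : s.settled b with
    | true =>
      obtain ⟨k, z, hz, hk⟩ := ih hb hx
      have := dist_le_add_wt hc src hab
      exact ⟨k, z, hz, by linarith⟩
    | false =>
      obtain ⟨k, hk, hle⟩ := h.relaxed a b ha hab
      exact ⟨k, b, h.queued b k hb hk, by linarith⟩

theorem DInv.frontier (hc : W.graph.Connected) {src : Fin n} {s : DState n}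
    (h : DInv W src s) {x : Fin n} (hx : s.settled x = false) :
    ∃ k z, (k, z) ∈ s.heap.elems ∧ k ≤ W.dist src x := by
  cases hs : s.settled src with
  | true =>
    obtain ⟨p, hp, -⟩ := exists_isCanon hc src x
    obtain ⟨k, z, hz, hk⟩ := h.frontier_walk hc p hs hx
    rw [dist_self, hp.len_eq, zero_add] at hk
    exact ⟨k, z, hz, hk⟩
  | false => exact ⟨0, src, h.queued _ _ hs h.src_dist, W.dist_nonneg _ _⟩

/-- The minimal key is at most the frontier key, hence at most the distance of `x`; it is at least
that distance because no label is below the true distance. -/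
theorem DInv.pop_key (hc : W.graph.Connected) {src : Fin n} {s : DState n}
    (h : DInv W src s) {r : ℕ} {k : ℝ} {x : Fin n} {a b : Heap (Fin n)}
    (hh : s.heap = .node r k x a b) (hx : s.settled x = false) :
    k = W.dist src x ∧ s.dist x = some (W.dist src x) := by
  obtain ⟨k', hk', hle⟩ := h.heap_le x k (by rw [hh]; simp [Heap.elems])
  have h1 := h.dist_le hc hk'
  obtain ⟨k₂, z, hz, hk₂⟩ := h.frontier hc hx
  have h2 : k ≤ k₂ := by
    have hok := h.heap_ok
    rw [hh] at hok hz
    exact hok.key_le _ hz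
  have h3 : k' = W.dist src x := by linarith
  exact ⟨by linarith, by rw [hk', h3]⟩

theorem DInv.pop {src : Fin n} {s : DState n}
    (h : DInv W src s) {r : ℕ} {k : ℝ} {x : Fin n} {a b : Heap (Fin n)}
    (hh : s.heap = .node r k x a b) (hx : s.settled x = true) :
    DInv W src { s with heap := (Heap.merge a b).val } := by
  have hok := h.heap_ok
  rw [hh] at hok
  obtain ⟨hm1, hm2, -⟩ := Heap.merge_spec a b hok.1 hok.2.1
  refine ⟨hm1, h.src_dist, h.src_par, h.par, h.settled, h.relaxed, fun y c hy hd => ?_,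
    fun y c hy => ?_⟩
  · have := h.queued y c hy hd
    rw [hh, Heap.elems, Multiset.mem_cons] at this
    rcases this with h1 | h1
    · cases h1
      rw [show s.settled x = false from hy] at hx
      cases hx
    · rwa [hm2]
  · refine h.heap_le y c ?_
    rw [hh, Heap.elems, Multiset.mem_cons]
    right; rwa [← hm2]

/-- The state of Dijkstra's algorithm after the vertex `x` at distance `k` was settled. -/
def expand (W : WGraph n) (s : DState n) (k : ℝ) (x : Fin n) (a b : Heap (Fin n)) :
    Timed (DState n) :=
  relaxAll x k (W.adj x)
    { s with heap := (Heap.merge a b).val, settled := Function.update s.settled x true }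

theorem DInv.expand (hc : W.graph.Connected) {src : Fin n} {s : DState n}
    (h : DInv W src s) {r : ℕ} {k : ℝ} {x : Fin n} {a b : Heap (Fin n)}
    (hh : s.heap = .node r k x a b) (hx : s.settled x = false) :
    DInv W src (W.expand s k x a b).val := by
  have hok := h.heap_ok
  rw [hh] at hok
  obtain ⟨hm1, hm2, -⟩ := Heap.merge_spec a b hok.1 hok.2.1
  obtain ⟨hk, hxd⟩ := h.pop_key hc hh hx
  obtain ⟨h1, h2, h3, h4, h5, -, -⟩ := relaxAll_spec x k (W.adj x) (nodup_adj x)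
    { s with heap := (Heap.merge a b).val, settled := Function.update s.settled x true } hm1
  change (W.expand s k x a b).val.settled = _ at h1
  change (W.expand s k x a b).val.heap.Ok at h2
  change ∀ y w, _ → _ → (W.expand s k x a b).val.dist y = _ ∧
    (W.expand s k x a b).val.par y = _ at h3
  change ∀ y, _ → (W.expand s k x a b).val.dist y = _ ∧
    (W.expand s k x a b).val.par y = _ at h4
  change ∀ e, e ∈ (W.expand s k x a b).val.heap.elems ↔ _ at h5
  generalize (W.expand s k x a b).val = s' at *
  simp only [hm2] at h1 h3 h4 h5
  have hset : ∀ y, s'.settled y = true ↔ y = x ∨ s.settled y = true := by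
    intro y
    rw [h1]
    by_cases hy : y = x
    · subst hy; simp
    · simp [hy]
  have cases : ∀ y, (W.graph.Adj x y ∧ Improves (s.dist y) (k + W.wt s(x, y)) ∧
      s'.dist y = some (k + W.wt s(x, y)) ∧ s'.par y = some x) ∨
      ((W.graph.Adj x y → ¬ Improves (s.dist y) (k + W.wt s(x, y))) ∧
        s'.dist y = s.dist y ∧ s'.par y = s.par y) := by
    intro y
    by_cases hy : W.graph.Adj x y ∧ Improves (s.dist y) (k + W.wt s(x, y))
    · exact .inl ⟨hy.1, hy.2, h3 y _ (mem_adj.2 ⟨hy.1, rfl⟩) hy.2⟩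
    · refine .inr ⟨fun h6 h7 => hy ⟨h6, h7⟩, h4 y fun w hw h6 => ?_⟩
      obtain ⟨h7, rfl⟩ := mem_adj.1 hw
      exact hy ⟨h7, h6⟩
  -- An exact label cannot be improved, so settled vertices and the source keep their labels and
  -- parents.
  have keep : ∀ y, s.dist y = some (W.dist src y) →
      s'.dist y = s.dist y ∧ s'.par y = s.par y := by
    intro y hy
    rcases cases y with ⟨h6, h7, -⟩ | h6
    · have := h7 _ hy
      have := dist_le_add_wt hc src h6
      linarith
    · exact h6.2
  have hsrc := keep src (by rw [h.src_dist, dist_self])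
  refine ⟨h2, hsrc.1.trans h.src_dist, hsrc.2.trans h.src_par, ?_, ?_, ?_, ?_, ?_⟩
  · intro y c hy hys
    rcases cases y with ⟨h6, -, h7, h8⟩ | ⟨-, h6, h7⟩
    · rw [h7] at hy; cases hy
      exact ⟨x, h8, (hset x).2 (.inl rfl), h6, by rw [hk]⟩
    · rw [h6] at hy
      obtain ⟨z, hz1, hz2, hz3, hz4⟩ := h.par y c hy hys
      exact ⟨z, h7.trans hz1, (hset z).2 (.inr hz2), hz3, hz4⟩
  · intro y hy
    have hd : s.dist y = some (W.dist src y) := by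
      rcases (hset y).1 hy with rfl | hy
      · exact hxd
      · exact h.settled y hy
    exact (keep y hd).1.trans hd
  · intro y z hy hyz
    rcases (hset y).1 hy with rfl | hy
    · rcases cases z with ⟨h6, -, h7, h8⟩ | ⟨h6, h7, -⟩
      · exact ⟨_, h7, by rw [hk]⟩
      · have := h6 hyz
        simp only [Improves, not_forall, not_lt] at this
        obtain ⟨c, hc1, hc2⟩ := this
        exact ⟨c, h7.trans hc1, by rwa [← hk]⟩
    · obtain ⟨c, hc1, hc2⟩ := h.relaxed y z hy hyz
      rcases cases z with ⟨-, h6, h7, -⟩ | ⟨-, h7, -⟩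
      · exact ⟨_, h7, (h6 c hc1).le.trans hc2⟩
      · exact ⟨c, h7.trans hc1, hc2⟩
  · intro y c hy hd
    have hy' : y ≠ x ∧ s.settled y = false := by
      have := (hset y).not.1 (by simp [hy])
      simpa using this
    rw [h5]
    rcases cases y with ⟨h6, h7, h8, -⟩ | ⟨-, h7, -⟩
    · rw [h8] at hd; cases hd
      exact .inr ⟨y, _, mem_adj.2 ⟨h6, rfl⟩, h7, rfl⟩
    · rw [h7] at hd
      have := h.queued y c hy'.2 hd
      rw [hh, Heap.elems, Multiset.mem_cons] at this
      rcases this with h8 | h8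
      · cases h8; exact absurd rfl hy'.1
      · exact .inl h8
  · intro y c hy
    rw [h5] at hy
    rcases hy with hy | ⟨z, w, hz, hi, he⟩
    · obtain ⟨c', hc1, hc2⟩ := h.heap_le y c (by
        rw [hh, Heap.elems, Multiset.mem_cons]; exact .inr hy)
      rcases cases y with ⟨-, h6, h7, -⟩ | ⟨-, h7, -⟩
      · exact ⟨_, h7, (h6 c' hc1).le.trans hc2⟩
      · exact ⟨c', h7.trans hc1, hc2⟩
    · cases he
      exact ⟨_, (h3 y w hz hi).1, le_rfl⟩

/-- The queue entries that a run of Dijkstra's algorithm can still process. -/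
def pending (W : WGraph n) (s : DState n) : ℕ :=
  s.heap.elems.card + ∑ y ∈ Finset.univ.filter (fun y => s.settled y = false), W.deg y

theorem pending_pop {s : DState n} (hs : s.heap.Ok) {r : ℕ} {k : ℝ} {x : Fin n}
    {a b : Heap (Fin n)} (hh : s.heap = .node r k x a b) :
    W.pending { s with heap := (Heap.merge a b).val } + 1 = W.pending s := by
  rw [hh] at hs
  obtain ⟨hm1, hm2, -⟩ := Heap.merge_spec a b hs.1 hs.2.1
  simp only [pending, hm2, hh, Heap.elems, Multiset.card_cons]
  omega

theorem sum_unsettled {s : DState n} {x : Fin n} (hx : s.settled x = false) :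
    (∑ y ∈ Finset.univ.filter (fun y => Function.update s.settled x true y = false), W.deg y)
      + W.deg x = ∑ y ∈ Finset.univ.filter (fun y => s.settled y = false), W.deg y := by
  have : Finset.univ.filter (fun y => Function.update s.settled x true y = false) =
      (Finset.univ.filter (fun y => s.settled y = false)).erase x := by
    ext y
    by_cases hy : y = x
    · subst hy; simp
    · simp [hy]
  rw [this, Finset.sum_erase_add _ _ (by simpa using hx)]

/-- Settling `x` removes one entry and adds at most `W.deg x`, which is the amount by which the
degree sum of the unsettled vertices falls. So `pending` strictly decreases and bounds both the fuel
and the queue size. -/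
theorem expand_spec {s : DState n} (hs : s.heap.Ok) {r : ℕ} {k : ℝ} {x : Fin n}
    {a b : Heap (Fin n)} (hh : s.heap = .node r k x a b) (hx : s.settled x = false) :
    (W.expand s k x a b).val.settled = Function.update s.settled x true ∧
    (W.expand s k x a b).val.heap.Ok ∧
    (W.expand s k x a b).val.heap.elems.card + 1 ≤ s.heap.elems.card + W.deg x ∧
    W.pending (W.expand s k x a b).val + 1 ≤ W.pending s ∧
    ∀ N, W.pending s ≤ N →
      (W.expand s k x a b).cost ≤ W.deg x * (Nat.log 2 (N + 1) + 3) + 1 := by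
  have hsum := sum_unsettled (W := W) hx
  rw [hh] at hs
  obtain ⟨hm1, hm2, -⟩ := Heap.merge_spec a b hs.1 hs.2.1
  obtain ⟨h1, h2, -, -, -, h6, h7⟩ := relaxAll_spec x k (W.adj x) (nodup_adj x)
    { s with heap := (Heap.merge a b).val, settled := Function.update s.settled x true } hm1
  have hcard : s.heap.elems.card = (Heap.merge a b).val.elems.card + 1 := by
    rw [hh, hm2, Heap.elems, Multiset.card_cons]
  change (W.expand s k x a b).val.settled = _ at h1
  change (W.expand s k x a b).val.heap.elems.card ≤ _ at h6
  change ∀ N, _ → (W.expand s k x a b).cost ≤ _ at h7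
  simp only [length_adj] at h6 h7
  refine ⟨h1, h2, by omega, ?_, fun N hN => h7 N ?_⟩
  · simp only [pending, h1] at hsum ⊢
    omega
  · simp only [pending] at hN
    omega

theorem dijkstraLoop_spec (hc : W.graph.Connected) (halt : Fin n → Bool) (src target : Fin n)
    (f : ℕ) : ∀ s, DInv W src s → s.settled target = false → W.pending s < f →
      (∀ par, (dijkstraLoop W.adj halt target f s).val = some par →
        ∃ s', DInv W src s' ∧ s'.par = par ∧ s'.dist target = some (W.dist src target)) ∧
      ((dijkstraLoop W.adj halt target f s).val = none →
        ∃ z, halt z = true ∧ W.dist src z ≤ W.dist src target) := by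
  induction f with
  | zero => intro s _ _ h; exact absurd h (Nat.not_lt_zero _)
  | succ f ih =>
    intro s hs ht hf
    -- This excludes an empty queue while the target is unsettled. It also bounds every popped key
    -- by the distance of the target, which gives the bound for a halting vertex.
    obtain ⟨k₀, z₀, hz₀, hk₀⟩ := hs.frontier hc ht
    rcases hh : s.heap with _ | ⟨r, k, x, a, b⟩
    · rw [hh] at hz₀; simp [Heap.elems] at hz₀
    · cases hx : s.settled x with
      | true =>
        have := pending_pop (W := W) hs.heap_ok hh
        simpa [dijkstraLoop, hh, hx] using ih _ (hs.pop hh hx) ht (by omega)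
      | false =>
        obtain ⟨hk, hxd⟩ := hs.pop_key hc hh hx
        by_cases hxt : x = target
        · subst hxt
          simp only [dijkstraLoop, hh, hx, Timed.val_bind]
          refine ⟨fun par hpar => ⟨s, hs, ?_, hxd⟩, fun h => ?_⟩
          · simpa using hpar
          · simp at h
        · cases hhx : halt x with
          | true =>
            simp only [dijkstraLoop, hh, hx, Timed.val_bind]
            refine ⟨fun par hpar => ?_, fun _ => ⟨x, hhx, ?_⟩⟩
            · simp [hxt, hhx] at hpar
            · have hok := hs.heap_ok
              rw [hh] at hok hz₀
              have := hok.key_le _ hz₀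
              rw [← hk]
              exact this.trans hk₀
          | false =>
            obtain ⟨h1, -, -, h4, -⟩ := expand_spec (W := W) hs.heap_ok hh hx
            have := ih _ (hs.expand hc hh hx)
              (by rw [h1, Function.update_of_ne (Ne.symm hxt)]; exact ht) (by omega)
            simpa [dijkstraLoop, hh, hx, hxt, hhx, expand] using this

/-- The vertices in the order in which Dijkstra's algorithm settles them if it never stops. -/
def dijkstraOrder (W : WGraph n) : ℕ → DState n → List (Fin n)
  | 0, _ => []
  | f + 1, s =>
    match s.heap with
    | .empty => []
    | .node _ k x a b =>
      if s.settled x then dijkstraOrder W f { s with heap := (Heap.merge a b).val }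
      else x :: dijkstraOrder W f (W.expand s k x a b).val

/-- The number of edges that are scanned if the vertices in the list are processed one after
another until a vertex with `halt` occurs. -/
def scanned (W : WGraph n) (halt : Fin n → Bool) : List (Fin n) → ℕ
  | [] => 0
  | x :: l => if halt x then 0 else W.deg x + scanned W halt l

theorem dijkstraOrder_nodup (f : ℕ) : ∀ s : DState n, s.heap.Ok →
    (W.dijkstraOrder f s).Nodup ∧ ∀ y ∈ W.dijkstraOrder f s, s.settled y = false := by
  induction f with
  | zero => intro s _; simp [dijkstraOrder]
  | succ f ih =>
    intro s hs
    rcases hh : s.heap with _ | ⟨r, k, x, a, b⟩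
    · simp [dijkstraOrder, hh]
    · cases hx : s.settled x with
      | true =>
        have hok := hs
        rw [hh] at hok
        have := ih { s with heap := (Heap.merge a b).val } (Heap.merge_spec a b hok.1 hok.2.1).1
        simpa [dijkstraOrder, hh, hx] using this
      | false =>
        obtain ⟨h1, h2, -⟩ := expand_spec (W := W) hs hh hx
        obtain ⟨h3, h4⟩ := ih _ h2
        simp only [h1] at h4
        simp only [dijkstraOrder, hh, hx, Bool.false_eq_true, if_false, List.nodup_cons,
          List.mem_cons]
        refine ⟨⟨fun hm => ?_, h3⟩, ?_⟩
        · have := h4 x hm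
          simp at this
        · rintro y (rfl | hy)
          · exact hx
          · have := h4 y hy
            by_cases hyx : y = x
            · subst hyx; exact hx
            · simpa [hyx] using this

/-- Amortised with K = `Nat.log 2 (N + 1)`: each queue entry holds 2K + 3 steps for its own removal
(and one to start a scan), and each scanned edge pays K + 3 for its relaxation and 2K + 3 for the
entry it may create, together 3K + 6. The list of vertices depends neither on `halt` nor on
`target`. -/
theorem dijkstraLoop_cost (halt : Fin n → Bool) (target : Fin n) (N f : ℕ) :
    ∀ s : DState n, s.heap.Ok → W.pending s ≤ N →
      (dijkstraLoop W.adj halt target f s).cost ≤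
        (2 * Nat.log 2 (N + 1) + 3) * s.heap.elems.card + 1 +
          (3 * Nat.log 2 (N + 1) + 6) * W.scanned halt (W.dijkstraOrder f s) := by
  induction f with
  | zero => intro s _ _; simp [dijkstraLoop]
  | succ f ih =>
    intro s hs hN
    rcases hh : s.heap with _ | ⟨r, k, x, a, b⟩
    · simp only [dijkstraLoop, hh, Timed.cost_bind, Timed.cost_tick, Timed.cost_pure]
      omega
    · have hok := hs
      rw [hh] at hok
      obtain ⟨hm1, hm2, hm3⟩ := Heap.merge_spec a b hok.1 hok.2.1
      have hcard : s.heap.elems.card = a.elems.card + b.elems.card + 1 := by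
        rw [hh, Heap.elems, Multiset.card_cons, Multiset.card_add]
      have hle : s.heap.elems.card ≤ N := by simp only [pending] at hN; omega
      have hra := Heap.rank_le_log a hok.1 (N := N) (by omega)
      have hrb := Heap.rank_le_log b hok.2.1 (N := N) (by omega)
      have hpop := pending_pop (W := W) hs hh
      rw [← hh, hcard]
      obtain ⟨K, hK⟩ : ∃ K, K = Nat.log 2 (N + 1) := ⟨_, rfl⟩
      rw [← hK] at hra hrb ⊢
      simp only [← hK] at ih
      cases hx : s.settled x with
      | true =>
        have := ih { s with heap := (Heap.merge a b).val } hm1 (by omega)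
        simp only [hm2, Multiset.card_add] at this
        simp only [dijkstraLoop, hh, hx, if_true, Timed.cost_bind, Timed.cost_tick,
          dijkstraOrder]
        rw [Nat.mul_add, Nat.mul_one]
        omega
      | false =>
        by_cases hxt : x = target
        · subst hxt
          simp only [dijkstraLoop, hh, hx, if_true, Timed.cost_bind, Timed.cost_tick,
            Timed.cost_pure, Bool.false_eq_true, if_false]
          rw [Nat.mul_add, Nat.mul_one]
          omega
        · cases hhx : halt x with
          | true =>
            simp only [dijkstraLoop, hh, hx, hxt, hhx, if_true, Timed.cost_bind, Timed.cost_tick,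
              Timed.cost_pure, Bool.false_eq_true, if_false]
            rw [Nat.mul_add, Nat.mul_one]
            omega
          | false =>
            obtain ⟨h1, h2, h3, h4, h5⟩ := expand_spec (W := W) hs hh hx
            have h6 := ih _ h2 (by omega)
            have h7 := h5 N hN
            rw [← hK] at h7
            rw [hcard] at h3
            simp only [dijkstraLoop, hh, hx, hxt, hhx, if_false, Timed.cost_bind, Timed.cost_tick,
              Bool.false_eq_true, dijkstraOrder, scanned]
            change 1 + ((Heap.merge a b).cost + ((W.expand s k x a b).cost +
              (dijkstraLoop W.adj halt target f (W.expand s k x a b).val).cost)) ≤ _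
            generalize (W.expand s k x a b).val.heap.elems.card = c at *
            generalize W.scanned halt (W.dijkstraOrder f (W.expand s k x a b).val) = T at *
            have h8 : (2 * K + 3) * c ≤ (2 * K + 3) * (a.elems.card + b.elems.card + W.deg x) :=
              Nat.mul_le_mul_left _ (by omega)
            nlinarith

end WGraph

/-- The initial state of Dijkstra's algorithm. -/
def DState.init {n : ℕ} (src : Fin n) : DState n where
  dist := Function.update (fun _ => none) src (some 0)
  par := fun _ => none
  settled := fun _ => false
  heap := Heap.node 1 0 src Heap.empty Heap.empty

/-- The initial state of the breadth-first search. -/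
def BState.init {n : ℕ} (src : Fin n) : BState n where
  par := fun _ => none
  seen := Function.update (fun _ => false) src true
  queue := [src]

/-- Since the listed neighbours are distinct, every test refers to the marks before the scan. -/
theorem scanAll_spec {n : ℕ} (x : Fin n) (l : List (Fin n × ℝ)) (hl : (l.map Prod.fst).Nodup) :
    ∀ s : BState n,
      (∀ y, (scanAll x l s).val.seen y = true ↔ s.seen y = true ∨ y ∈ l.map Prod.fst) ∧
      (∀ y, s.seen y = true → (scanAll x l s).val.par y = s.par y) ∧
      (∀ y, s.seen y = false → y ∈ l.map Prod.fst → (scanAll x l s).val.par y = some x) ∧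
      (scanAll x l s).val.queue = s.queue ++ (l.map Prod.fst).filter (fun y => !s.seen y) ∧
      (scanAll x l s).cost = l.length + 1 := by
  induction l with
  | nil => intro s; simp [scanAll]
  | cons a l ih =>
    obtain ⟨y, w⟩ := a
    rw [List.map_cons, List.nodup_cons] at hl
    intro s
    cases hy : s.seen y with
    | true =>
      obtain ⟨h1, h2, h3, h4, h5⟩ := ih hl.2 s
      have heq : scanAll x ((y, w) :: l) s = (do tick 1; scanAll x l s) := by simp [scanAll, hy]
      rw [heq]
      simp only [Timed.val_bind, Timed.cost_bind, Timed.cost_tick, List.map_cons, List.mem_cons,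
        List.length_cons]
      refine ⟨fun z => ?_, h2, fun z hz hm => ?_, ?_, by omega⟩
      · rw [h1]
        constructor
        · tauto
        · rintro (h | rfl | h)
          · exact .inl h
          · exact .inl hy
          · exact .inr h
      · rcases hm with rfl | hm
        · rw [hy] at hz; cases hz
        · exact h3 z hz hm
      · rw [h4, List.filter_cons_of_neg (by simp [hy])]
    | false =>
      obtain ⟨h1, h2, h3, h4, h5⟩ := ih hl.2
        { par := Function.update s.par y (some x)
          seen := Function.update s.seen y true
          queue := s.queue ++ [y] }
      have heq : scanAll x ((y, w) :: l) s = (do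
          tick 1
          scanAll x l
            { par := Function.update s.par y (some x)
              seen := Function.update s.seen y true
              queue := s.queue ++ [y] }) := by simp [scanAll, hy]
      rw [heq]
      simp only [Timed.val_bind, Timed.cost_bind, Timed.cost_tick, List.map_cons, List.mem_cons,
        List.length_cons] at *
      refine ⟨fun z => ?_, fun z hz => ?_, fun z hz hm => ?_, ?_, by omega⟩
      · rw [h1]
        by_cases hzy : z = y
        · subst hzy; simp
        · simp [hzy]
      · have hzy : z ≠ y := by rintro rfl; rw [hy] at hz; cases hz
        rw [h2 z (by simpa [hzy] using hz), Function.update_of_ne hzy]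
      · by_cases hzy : z = y
        · subst hzy
          rw [h2 z (by simp), Function.update_self]
        · exact h3 z (by simpa [hzy] using hz) (hm.resolve_left hzy)
      · rw [h4, List.filter_cons_of_pos (by simp [hy]), List.append_assoc, List.singleton_append]
        congr 2
        refine List.filter_congr fun z hz => ?_
        have hzy : z ≠ y := by rintro rfl; exact hl.1 hz
        rw [Function.update_of_ne hzy]

namespace WGraph

variable {n : ℕ} {W : WGraph n}

theorem deg_pos (hc : W.graph.Connected) (hn : 2 ≤ n) (x : Fin n) : 1 ≤ W.deg x := by
  have : Nontrivial (Fin n) := Fin.nontrivial_iff_two_le.2 hn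
  obtain ⟨y, hy⟩ := exists_ne x
  obtain ⟨z, hz, -⟩ := exists_succ hc (left_mem_sp hc x y) hy.symm
  exact Finset.card_pos.2 ⟨z, by simpa [nbrs] using hz⟩

theorem deg_le (x : Fin n) : W.deg x ≤ n := by
  simpa [deg] using Finset.card_le_univ (W.nbrs x)

theorem init_dInv (src : Fin n) : DInv W src (DState.init src) where
  heap_ok := Heap.ok_singleton _ _
  src_dist := by simp [DState.init]
  src_par := rfl
  par x k h hx := by simp [DState.init, hx] at h
  settled x h := by simp [DState.init] at h
  relaxed x z h := by simp [DState.init] at h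
  queued x k _ h := by
    by_cases hx : x = src
    · subst hx
      simp only [DState.init, Function.update_self, Option.some_inj] at h
      simp [DState.init, Heap.elems, h]
    · simp [DState.init, hx] at h
  heap_le x k h := by
    simp only [DState.init, Heap.elems, add_zero, Multiset.mem_cons, Prod.mk.injEq,
      Multiset.notMem_zero, or_false] at h
    obtain ⟨rfl, rfl⟩ := h
    exact ⟨0, by simp [DState.init], le_rfl⟩

/-- One entry and a degree sum of at most `n * n`; the fuel `n * n + 2` of `dijkstra` exceeds it. -/
theorem pending_init (src : Fin n) : W.pending (DState.init src) ≤ n * n + 1 := by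
  have : ∑ y : Fin n, W.deg y ≤ ∑ _y : Fin n, n := Finset.sum_le_sum fun y _ => deg_le y
  simp only [Finset.sum_const, Finset.card_univ, Fintype.card_fin, smul_eq_mul] at this
  simp only [pending, DState.init, Heap.elems, Multiset.card_cons, add_zero, Multiset.card_zero,
    Finset.filter_true]
  omega

theorem dijkstra_correct (hc : W.graph.Connected) : W.SearchCorrect dijkstra := by
  intro halt src target
  obtain ⟨h1, h2⟩ := dijkstraLoop_spec hc halt src target (n * n + 2) _ (init_dInv src) rfl
    (Nat.lt_succ_of_le (pending_init src))
  refine ⟨fun par hpar => ?_, h2⟩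
  obtain ⟨s, hs, rfl, ht⟩ := h1 par hpar
  -- Parents are settled, so their labels are exact: exactness of the label is the invariant of the
  -- climb.
  obtain ⟨q, hq1, hq2, hq3⟩ := climb_spec (W := W) (par := s.par) (z := src)
    (good := fun x => s.dist x = some (W.dist src x)) (D := fun x => W.dist src x)
    (.inl hs.src_par) (fun x hx hxs => by
      obtain ⟨y, hy1, hy2, hy3, hy4⟩ := hs.par x _ hx hxs
      exact ⟨y, hy1, hy3, hs.settled y hy2, hy4⟩) ht (.nil : W.graph.Walk target target)
  refine ⟨q, by simpa using hq1, by simpa using hq2, ?_⟩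
  simpa using hq3

theorem dijkstra_cost_le (halt : Fin n → Bool) (src target : Fin n) :
    (dijkstra W.adj halt src target).cost ≤ 2 * Nat.log 2 (n * n + 2) + 4 +
      (3 * Nat.log 2 (n * n + 2) + 6) *
        W.scanned halt (W.dijkstraOrder (n * n + 2) (DState.init src)) := by
  have := dijkstraLoop_cost (W := W) halt target (n * n + 1) (n * n + 2) _
    (init_dInv (W := W) src).heap_ok (pending_init src)
  refine this.trans (le_of_eq ?_)
  simp [DState.init, Heap.elems]

/-! ## Breadth-first search -/

theorem Unweighted.one_le_dist (hu : W.Unweighted) (hc : W.graph.Connected) {u v : Fin n}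
    (h : u ≠ v) : 1 ≤ W.dist u v := by
  obtain ⟨p, hp, -⟩ := exists_isCanon hc u v
  rw [← hp.len_eq]
  cases p with
  | nil => exact absurd rfl h
  | cons h p =>
    have := W.len_nonneg p
    rw [len_cons, hu _ ((SimpleGraph.mem_edgeSet _).2 h)]; linarith

theorem Unweighted.wt_eq (hu : W.Unweighted) {u v : Fin n} (h : W.graph.Adj u v) :
    W.wt s(u, v) = 1 := hu _ ((SimpleGraph.mem_edgeSet _).2 h)

/-- The invariant of the breadth-first search. -/
structure BInv (W : WGraph n) (src : Fin n) (s : BState n) : Prop where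
  src_seen : s.seen src = true
  src_par : s.par src = none
  par : ∀ x, s.seen x = true → x ≠ src → ∃ y, s.par x = some y ∧ s.seen y = true ∧
    y ∉ s.queue ∧ W.graph.Adj y x ∧ W.dist src x = W.dist src y + W.wt s(y, x)
  relaxed : ∀ y z, s.seen y = true → y ∉ s.queue → W.graph.Adj y z → s.seen z = true
  queue_seen : ∀ x ∈ s.queue, s.seen x = true
  nodup : s.queue.Nodup
  sorted : s.queue.Pairwise fun x y => W.dist src x ≤ W.dist src y
  window : ∀ x ∈ s.queue, ∀ y ∈ s.queue, W.dist src y ≤ W.dist src x + 1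

/-- The walk starts at a processed vertex, all of whose neighbours are discovered, so it must meet
the queue before it can reach an undiscovered vertex. -/
theorem BInv.frontier_walk (hc : W.graph.Connected) {src : Fin n} {s : BState n}
    (h : BInv W src s) {a x : Fin n} (p : W.graph.Walk a x) (ha : s.seen a = true)
    (ha' : a ∉ s.queue) (hx : s.seen x = true → x ∈ s.queue) :
    ∃ z ∈ s.queue, W.dist src z + W.dist z x ≤ W.dist src a + W.len p := by
  induction p with
  | nil => exact absurd (hx ha) ha'
  | @cons a b x hab p ih =>
    have h0 := W.dist_le_len p
    have h1 := dist_le_add_wt hc src hab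
    rw [len_cons]
    by_cases hb : b ∈ s.queue
    · exact ⟨b, hb, by linarith⟩
    · obtain ⟨z, hz, hd⟩ := ih (h.relaxed a b ha ha' hab) hb hx
      exact ⟨z, hz, by linarith⟩

theorem BInv.frontier (hc : W.graph.Connected) {src : Fin n} {s : BState n}
    (h : BInv W src s) {x : Fin n} (hx : s.seen x = true → x ∈ s.queue) :
    ∃ z ∈ s.queue, W.dist src z + W.dist z x ≤ W.dist src x := by
  by_cases hs : src ∈ s.queue
  · exact ⟨src, hs, by simp⟩
  · obtain ⟨p, hp, -⟩ := exists_isCanon hc src x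
    simpa [hp.len_eq] using h.frontier_walk hc p h.src_seen hs hx

/-- The state of the breadth-first search after the head `x` of the queue was processed. -/
def scan (W : WGraph n) (s : BState n) (x : Fin n) (q : List (Fin n)) : Timed (BState n) :=
  scanAll x (W.adj x) { s with queue := q }

theorem mem_adj_map_fst {x y : Fin n} : y ∈ (W.adj x).map Prod.fst ↔ W.graph.Adj x y := by
  rw [adj_map_fst, Finset.mem_sort]; simp [nbrs]

theorem scan_spec (s : BState n) (x : Fin n) (q : List (Fin n)) :
    (∀ y, (W.scan s x q).val.seen y = true ↔ s.seen y = true ∨ W.graph.Adj x y) ∧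
    (∀ y, s.seen y = true → (W.scan s x q).val.par y = s.par y) ∧
    (∀ y, s.seen y = false → W.graph.Adj x y → (W.scan s x q).val.par y = some x) ∧
    (∃ l : List (Fin n), l.Nodup ∧ (∀ y, y ∈ l ↔ W.graph.Adj x y ∧ s.seen y = false) ∧
      (W.scan s x q).val.queue = q ++ l) ∧
    (W.scan s x q).cost = W.deg x + 1 := by
  obtain ⟨h1, h2, h3, h4, h5⟩ := scanAll_spec x (W.adj x) (nodup_adj x) { s with queue := q }
  simp only [mem_adj_map_fst] at h1 h3
  rw [length_adj] at h5
  refine ⟨h1, h2, h3, ⟨_, (nodup_adj x).filter _, fun y => ?_, h4⟩, h5⟩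
  rw [List.mem_filter, mem_adj_map_fst]
  simp

theorem BInv.scan (hc : W.graph.Connected) (hu : W.Unweighted) {src : Fin n} {s : BState n}
    (h : BInv W src s) {x : Fin n} {q : List (Fin n)} (hq : s.queue = x :: q) :
    BInv W src (W.scan s x q).val := by
  obtain ⟨h1, h2, h3, ⟨l, hl, hml, h4⟩, -⟩ := scan_spec (W := W) s x q
  generalize (W.scan s x q).val = s' at *
  have hxs : s.seen x = true := h.queue_seen x (by simp [hq])
  have hnd := h.nodup
  have hsort := h.sorted
  rw [hq, List.nodup_cons] at hnd
  rw [hq, List.pairwise_cons] at hsort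
  have hqs : ∀ y ∈ q, s.seen y = true := fun y hy => h.queue_seen y (by simp [hq, hy])
  have hxl : x ∉ l := fun hx => by rw [hml, hxs] at hx; simp at hx
  -- The edge from `x` gives the upper bound. For the lower one, some queued vertex `z` other than
  -- `y` lies on a shortest way to `y`, at least one unit before it, and `x` is the closest in the
  -- queue.
  have hnew : ∀ y ∈ l, W.dist src y = W.dist src x + 1 := by
    intro y hy
    obtain ⟨ha, hys⟩ := (hml y).1 hy
    refine le_antisymm ?_ ?_
    · have := dist_le_add_wt hc src ha
      rwa [hu.wt_eq ha] at this
    · obtain ⟨z, hz, hd⟩ := h.frontier hc (x := y) (by simp [hys])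
      have hzy : z ≠ y := by rintro rfl; rw [h.queue_seen z hz] at hys; cases hys
      have := hu.one_le_dist hc hzy
      have : W.dist src x ≤ W.dist src z := by
        rw [hq, List.mem_cons] at hz
        rcases hz with rfl | hz
        · exact le_rfl
        · exact hsort.1 z hz
      linarith
  have hwin : ∀ y ∈ q, W.dist src y ≤ W.dist src x + 1 := fun y hy =>
    h.window x (by simp [hq]) y (by simp [hq, hy])
  refine ⟨(h1 src).2 (.inl h.src_seen), (h2 src h.src_seen).trans h.src_par, ?_, ?_, ?_, ?_, ?_, ?_⟩
  · intro y hy hys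
    cases hsy : s.seen y with
    | true =>
      obtain ⟨z, hz1, hz2, hz3, hz4⟩ := h.par y hsy hys
      refine ⟨z, (h2 y hsy).trans hz1, (h1 z).2 (.inl hz2), fun hz => ?_, hz4⟩
      rw [h4, List.mem_append, hml, hz2] at hz
      rw [hq, List.mem_cons] at hz3
      simp at hz; tauto
    | false =>
      have ha : W.graph.Adj x y := ((h1 y).1 hy).resolve_left (by simp [hsy])
      refine ⟨x, h3 y hsy ha, (h1 x).2 (.inl hxs), fun hx => ?_, ha, ?_⟩
      · rw [h4, List.mem_append] at hx; tauto
      · rw [hnew y ((hml y).2 ⟨ha, hsy⟩), hu.wt_eq ha]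
  · intro y z hy hyq hyz
    rw [h4, List.mem_append, not_or] at hyq
    rw [h1]
    by_cases hyx : y = x
    · subst hyx; exact .inr hyz
    · left
      have hsy : s.seen y = true := by
        rcases (h1 y).1 hy with h5 | h5
        · exact h5
        · by_contra h6
          exact hyq.2 ((hml y).2 ⟨h5, by simpa using h6⟩)
      exact h.relaxed y z hsy (by rw [hq, List.mem_cons]; tauto) hyz
  · intro y hy
    rw [h4, List.mem_append] at hy
    rw [h1]
    rcases hy with hy | hy
    · exact .inl (hqs y hy)
    · exact .inr ((hml y).1 hy).1
  · rw [h4, List.nodup_append]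
    refine ⟨hnd.2, hl, ?_⟩
    rintro y hy z hz rfl
    have := ((hml y).1 hz).2
    rw [hqs y hy] at this
    cases this
  · rw [h4, List.pairwise_append]
    refine ⟨hsort.2, List.pairwise_iff_getElem.2 fun i j hi hj _ => ?_, fun y hy z hz => ?_⟩
    · rw [hnew _ (l.getElem_mem hi), hnew _ (l.getElem_mem hj)]
    · rw [hnew z hz]; exact hwin y hy
  · intro y hy z hz
    rw [h4, List.mem_append] at hy hz
    rcases hy with hy | hy <;> rcases hz with hz | hz
    · exact h.window y (by simp [hq, hy]) z (by simp [hq, hz])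
    · rw [hnew z hz]; have := hsort.1 y hy; linarith
    · rw [hnew y hy]; have := hwin z hz; linarith
    · rw [hnew y hy, hnew z hz]; linarith

/-- The vertices that a breadth-first search can still process. -/
def bPending (s : BState n) : ℕ :=
  s.queue.length + (Finset.univ.filter fun y => s.seen y = false).card

theorem bPending_scan (s : BState n) (x : Fin n) (q : List (Fin n)) (hq : s.queue = x :: q) :
    bPending (W.scan s x q).val + 1 = bPending s := by
  obtain ⟨h1, -, -, ⟨l, hl, hml, h4⟩, -⟩ := scan_spec (W := W) s x q
  generalize (W.scan s x q).val = s' at *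
  have : (Finset.univ.filter fun y => s.seen y = false) =
      (Finset.univ.filter fun y => s'.seen y = false) ∪ l.toFinset := by
    ext y
    simp only [Finset.mem_filter, Finset.mem_univ, true_and, Finset.mem_union, List.mem_toFinset,
      hml, ← Bool.not_eq_true, h1]
    tauto
  have hdisj : Disjoint (Finset.univ.filter fun y => s'.seen y = false) l.toFinset := by
    rw [Finset.disjoint_left]
    intro y hy hy'
    simp only [Finset.mem_filter, Finset.mem_univ, true_and, List.mem_toFinset, hml,
      ← Bool.not_eq_true, h1] at hy hy'
    tauto
  simp only [bPending, this, Finset.card_union_of_disjoint hdisj, h4, hq, List.length_append,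
    List.length_cons, List.toFinset_card_of_nodup hl]
  omega

theorem bfsLoop_spec (hc : W.graph.Connected) (hu : W.Unweighted) (halt : Fin n → Bool)
    (src target : Fin n) (f : ℕ) : ∀ s, BInv W src s → (s.seen target = true → target ∈ s.queue) →
      bPending s < f →
      (∀ par, (bfsLoop W.adj halt target f s).val = some par →
        ∃ s', BInv W src s' ∧ s'.par = par ∧ s'.seen target = true) ∧
      ((bfsLoop W.adj halt target f s).val = none →
        ∃ z, halt z = true ∧ W.dist src z ≤ W.dist src target) := by
  induction f with
  | zero => intro s _ _ h; exact absurd h (Nat.not_lt_zero _)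
  | succ f ih =>
    intro s hs ht hf
    obtain ⟨z₀, hz₀, hd₀⟩ := hs.frontier hc ht
    rcases hq : s.queue with _ | ⟨x, q⟩
    · rw [hq] at hz₀; simp at hz₀
    · by_cases hxt : x = target
      · subst hxt
        simp only [bfsLoop, hq, Timed.val_bind]
        refine ⟨fun par hpar => ⟨s, hs, ?_, hs.queue_seen _ (by simp [hq])⟩, fun h => ?_⟩
        · simpa using hpar
        · simp at h
      · cases hhx : halt x with
        | true =>
          simp only [bfsLoop, hq, Timed.val_bind]
          refine ⟨fun par hpar => ?_, fun _ => ⟨x, hhx, ?_⟩⟩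
          · simp [hxt, hhx] at hpar
          · have hsort := hs.sorted
            rw [hq, List.pairwise_cons] at hsort
            rw [hq, List.mem_cons] at hz₀
            have := W.dist_nonneg z₀ target
            rcases hz₀ with rfl | hz₀
            · linarith
            · have := hsort.1 z₀ hz₀
              linarith
        | false =>
          have h1 := bPending_scan (W := W) s x q hq
          obtain ⟨h2, -, -, ⟨l, -, hml, h4⟩, -⟩ := scan_spec (W := W) s x q
          have := ih _ (hs.scan hc hu hq) (fun h5 => by
            rw [h4, List.mem_append, hml]
            rcases (h2 target).1 h5 with h6 | h6
            · have := ht h6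
              rw [hq, List.mem_cons] at this
              exact .inl (this.resolve_left (Ne.symm hxt))
            · cases h7 : s.seen target with
              | true =>
                have := ht h7
                rw [hq, List.mem_cons] at this
                exact .inl (this.resolve_left (Ne.symm hxt))
              | false => exact .inr ⟨h6, rfl⟩) (by omega)
          simpa [bfsLoop, hq, hxt, hhx, scan] using this

/-- The vertices in the order in which the breadth-first search processes them if it never
stops. -/
def bfsOrder (W : WGraph n) : ℕ → BState n → List (Fin n)
  | 0, _ => []
  | f + 1, s =>
    match s.queue with
    | [] => []
    | x :: q => x :: bfsOrder W f (W.scan s x q).val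

theorem bfsOrder_nodup (hc : W.graph.Connected) (hu : W.Unweighted) {src : Fin n} (f : ℕ) :
    ∀ s : BState n, BInv W src s →
    (W.bfsOrder f s).Nodup ∧ ∀ y ∈ W.bfsOrder f s, s.seen y = true → y ∈ s.queue := by
  induction f with
  | zero => intro s _; simp [bfsOrder]
  | succ f ih =>
    intro s hs
    rcases hq : s.queue with _ | ⟨x, q⟩
    · simp [bfsOrder, hq]
    · obtain ⟨h3, h4⟩ := ih _ (hs.scan hc hu hq)
      obtain ⟨h1, -, -, ⟨l, -, hml, hql⟩, -⟩ := scan_spec (W := W) s x q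
      have hxs : s.seen x = true := hs.queue_seen x (by simp [hq])
      have hnd := hs.nodup
      rw [hq, List.nodup_cons] at hnd
      simp only [hql, List.mem_append, hml, h1] at h4
      simp only [bfsOrder, hq, List.nodup_cons, List.mem_cons]
      refine ⟨⟨fun hm => ?_, h3⟩, ?_⟩
      · have := h4 x hm (.inl hxs)
        rw [hxs] at this
        simp [hnd.1] at this
      · rintro y (rfl | hy) hys
        · exact .inl rfl
        · have := h4 y hy (.inl hys)
          rw [hys] at this
          simp at this
          exact .inr this

/-- Processing `x` takes `W.deg x + 2` steps, at most three per scanned edge because no vertex is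
isolated. -/
theorem bfsLoop_cost (hc : W.graph.Connected) (hn : 2 ≤ n) (halt : Fin n → Bool)
    (target : Fin n) (f : ℕ) : ∀ s : BState n,
      (bfsLoop W.adj halt target f s).cost ≤ 1 + 3 * W.scanned halt (W.bfsOrder f s) := by
  induction f with
  | zero => intro s; simp [bfsLoop]
  | succ f ih =>
    intro s
    rcases hq : s.queue with _ | ⟨x, q⟩
    · simp [bfsLoop, hq]
    · by_cases hxt : x = target
      · subst hxt
        simp [bfsLoop, hq]
      · cases hhx : halt x with
        | true => simp [bfsLoop, hq, hhx, hxt]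
        | false =>
          obtain ⟨-, -, -, -, h5⟩ := scan_spec (W := W) s x q
          have h6 := ih (W.scan s x q).val
          have h7 := deg_pos hc hn x
          simp only [bfsLoop, hq, hxt, hhx, if_false, Timed.cost_bind, Timed.cost_tick,
            Bool.false_eq_true, bfsOrder, scanned]
          change 1 + ((W.scan s x q).cost + (bfsLoop W.adj halt target f (W.scan s x q).val).cost)
            ≤ _
          omega

theorem init_bInv (src : Fin n) : BInv W src (BState.init src) where
  src_seen := by simp [BState.init]
  src_par := rfl
  par x h hx := by simp [BState.init, hx] at h
  relaxed y z h hq := by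
    by_cases hy : y = src
    · subst hy; simp [BState.init] at hq
    · simp [BState.init, hy] at h
  queue_seen x h := by
    simp only [BState.init, List.mem_singleton] at h
    simp [BState.init, h]
  nodup := by simp [BState.init]
  sorted := by simp [BState.init]
  window x hx y hy := by
    simp only [BState.init, List.mem_singleton] at hx hy
    simp [hx, hy]

theorem bPending_init (src : Fin n) : bPending (BState.init src) < n + 1 := by
  have h : src ∉ Finset.univ.filter fun y => (BState.init src).seen y = false := by
    rw [Finset.mem_filter]
    simp [BState.init]
  have := Finset.card_lt_univ_of_notMem h
  rw [Fintype.card_fin] at this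
  have h' : (BState.init src).queue.length = 1 := rfl
  rw [bPending, h']
  omega

theorem bfs_correct (hc : W.graph.Connected) (hu : W.Unweighted) : W.SearchCorrect bfs := by
  intro halt src target
  obtain ⟨h1, h2⟩ := bfsLoop_spec hc hu halt src target (n + 1) _ (init_bInv src) (fun h => by
    by_contra hne
    have : target ≠ src := fun h => hne (by simp [BState.init, h])
    simp [BState.init, this] at h) (bPending_init src)
  refine ⟨fun par hpar => ?_, h2⟩
  obtain ⟨s, hs, rfl, ht⟩ := h1 par hpar
  obtain ⟨q, hq1, hq2, hq3⟩ := climb_spec (W := W) (par := s.par) (z := src)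
    (good := fun x => s.seen x = true) (D := fun x => W.dist src x)
    (.inl hs.src_par) (fun x hx hxs => by
      obtain ⟨y, hy1, hy2, -, hy3, hy4⟩ := hs.par x hx hxs
      exact ⟨y, hy1, hy3, hy2, hy4⟩) ht (.nil : W.graph.Walk target target)
  refine ⟨q, by simpa using hq1, by simpa using hq2, ?_⟩
  simpa using hq3

theorem bfs_cost_le (hc : W.graph.Connected) (hn : 2 ≤ n) (halt : Fin n → Bool)
    (src target : Fin n) :
    (bfs W.adj halt src target).cost ≤
      1 + 3 * W.scanned halt (W.bfsOrder (n + 1) (BState.init src)) :=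
  bfsLoop_cost hc hn halt target (n + 1) _

end WGraph

namespace WGraph

variable {n : ℕ} {W : WGraph n} {h : ℕ}

/-! ## The sampling -/

theorem selProb_eq (hn : 2 ≤ n) (i : ℕ) :
    W.selProb h i = (n : ℝ) ^ (-(3 / 4 : ℝ) ^ (h - i + 1)) := by
  have hn' : (0 : ℝ) < n := by positivity
  rw [selProb, sub_eq_add_neg, Real.rpow_add hn', Real.rpow_one]
  field_simp

theorem selProb_pos (hn : 2 ≤ n) (i : ℕ) : 0 < W.selProb h i := by
  rw [selProb_eq hn]; positivity

theorem selProb_le_one (hn : 2 ≤ n) (i : ℕ) : W.selProb h i ≤ 1 := by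
  rw [selProb_eq hn]
  refine Real.rpow_le_one_of_one_le_of_nonpos (by exact_mod_cast (by omega : 1 ≤ n)) ?_
  have : (0 : ℝ) ≤ (3 / 4 : ℝ) ^ (h - i + 1) := by positivity
  linarith

theorem prob_nonneg (hn : 2 ≤ n) (ω : W.Outcome h) : 0 ≤ W.prob h ω := by
  refine Finset.prod_nonneg fun k _ => Finset.prod_nonneg fun x _ => ?_
  have := W.selProb_pos (h := h) hn (k.val + 1)
  have := W.selProb_le_one (h := h) hn (k.val + 1)
  split_ifs <;> linarith

theorem expect_mono (hn : 2 ≤ n) {F G : W.Outcome h → ℝ} (hFG : ∀ ω, F ω ≤ G ω) :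
    W.expect h F ≤ W.expect h G :=
  Finset.sum_le_sum fun ω _ => mul_le_mul_of_nonneg_left (hFG ω) (prob_nonneg hn ω)

theorem expect_nonneg (hn : 2 ≤ n) {F : W.Outcome h → ℝ} (hF : ∀ ω, 0 ≤ F ω) :
    0 ≤ W.expect h F :=
  Finset.sum_nonneg fun ω _ => mul_nonneg (prob_nonneg hn ω) (hF ω)

theorem expect_add (F G : W.Outcome h → ℝ) :
    W.expect h (fun ω => F ω + G ω) = W.expect h F + W.expect h G := by
  simp only [expect, mul_add, Finset.sum_add_distrib]

theorem expect_mul_left (c : ℝ) (F : W.Outcome h → ℝ) :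
    W.expect h (fun ω => c * F ω) = c * W.expect h F := by
  simp only [expect, Finset.mul_sum]
  exact Finset.sum_congr rfl fun ω _ => by ring

theorem expect_sum {ι : Type*} (s : Finset ι) (F : ι → W.Outcome h → ℝ) :
    W.expect h (fun ω => ∑ i ∈ s, F i ω) = ∑ i ∈ s, W.expect h (F i) := by
  simp only [expect, Finset.mul_sum]
  exact Finset.sum_comm

theorem expect_const (c : ℝ) : W.expect h (fun _ => c) = c := by
  have h1 : ∑ ω : W.Outcome h, W.prob h ω = 1 := by
    have h2 : ∀ k : Fin h, ∑ s : Finset W.VNode, ∏ x : W.VNode,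
        (if x ∈ s then W.selProb h (k.val + 1) else 1 - W.selProb h (k.val + 1)) = 1 := by
      intro k
      -- Expanding the product of p + (1 - p) over all virtual nodes gives the sum over the selected
      -- sets of one level.
      have h3 := Finset.prod_add (fun _ : W.VNode => W.selProb h (k.val + 1))
        (fun _ => 1 - W.selProb h (k.val + 1)) Finset.univ
      simp only [add_sub_cancel, Finset.prod_const_one, Finset.powerset_univ] at h3
      refine Eq.trans (Finset.sum_congr rfl fun s _ => ?_) h3.symm
      rw [Finset.prod_ite]
      congr 1
      · refine Finset.prod_congr ?_ fun _ _ => rfl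
        ext; simp
      · refine Finset.prod_congr ?_ fun _ _ => rfl
        ext; simp
    have h4 := Finset.prod_univ_sum (fun _ : Fin h => (Finset.univ : Finset (Finset W.VNode)))
      (fun k s => ∏ x : W.VNode,
        if x ∈ s then W.selProb h (k.val + 1) else 1 - W.selProb h (k.val + 1))
    simp only [h2, Finset.prod_const_one, Fintype.piFinset_univ] at h4
    exact h4.symm
  rw [expect, ← Finset.sum_mul, h1, one_mul]

/-- The outcome with the virtual node `x` selected at the level of index `k`. -/
def sel (k : Fin h) (x : W.VNode) (ω : W.Outcome h) : W.Outcome h :=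
  Function.update ω k (insert x (ω k))

/-- The outcome with the virtual node `x` not selected at the level of index `k`. -/
def unsel (k : Fin h) (x : W.VNode) (ω : W.Outcome h) : W.Outcome h :=
  Function.update ω k ((ω k).erase x)

theorem mem_sel {k k' : Fin h} {x y : W.VNode} {ω : W.Outcome h} :
    y ∈ sel k x ω k' ↔ (k' = k ∧ y = x) ∨ y ∈ ω k' := by
  unfold sel
  by_cases hk : k' = k
  · subst hk; simp
  · simp [hk]

theorem mem_unsel {k k' : Fin h} {x y : W.VNode} {ω : W.Outcome h} :
    y ∈ unsel k x ω k' ↔ ¬ (k' = k ∧ y = x) ∧ y ∈ ω k' := by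
  unfold unsel
  by_cases hk : k' = k
  · subst hk; simp
  · simp [hk]

/-- The probability of the choices other than that for the virtual node `x` at index `k`. -/
def restProb (k : Fin h) (x : W.VNode) (ω : W.Outcome h) : ℝ :=
  ∏ e ∈ (Finset.univ : Finset (Fin h × W.VNode)).erase (k, x),
    if e.2 ∈ ω e.1 then W.selProb h (e.1.val + 1) else 1 - W.selProb h (e.1.val + 1)

theorem prob_eq (k : Fin h) (x : W.VNode) (ω : W.Outcome h) : W.prob h ω =
    (if x ∈ ω k then W.selProb h (k.val + 1) else 1 - W.selProb h (k.val + 1)) *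
      restProb k x ω := by
  rw [restProb, Finset.mul_prod_erase Finset.univ (fun e : Fin h × W.VNode =>
    if e.2 ∈ ω e.1 then W.selProb h (e.1.val + 1) else 1 - W.selProb h (e.1.val + 1))
    (Finset.mem_univ (k, x)), Fintype.prod_prod_type]
  rfl

theorem restProb_congr {k : Fin h} {x : W.VNode} {ω ω' : W.Outcome h}
    (hω : ∀ k' y, (k', y) ≠ (k, x) → (y ∈ ω k' ↔ y ∈ ω' k')) :
    restProb k x ω = restProb k x ω' := by
  refine Finset.prod_congr rfl fun e he => ?_
  simp only [hω e.1 e.2 (Finset.ne_of_mem_erase he)]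

theorem restProb_unsel (k : Fin h) (x : W.VNode) (ω : W.Outcome h) :
    restProb k x (unsel k x ω) = restProb k x ω :=
  restProb_congr fun k' y hne => by
    rw [mem_unsel]; simp only [ne_eq, Prod.mk.injEq] at hne; tauto

/-- A random variable that does not depend on whether `x` is selected at index `k`. -/
def Indep (k : Fin h) (x : W.VNode) {α : Type*} (F : W.Outcome h → α) : Prop :=
  ∀ ω, F (sel k x ω) = F ω ∧ F (unsel k x ω) = F ω

/-- Flipping the choice for `x` matches the outcomes with and without it and changes neither the
other factors nor `A`. -/
theorem sum_sel_eq_sum_unsel (k : Fin h) (x : W.VNode) {A : W.Outcome h → ℝ}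
    (hA : Indep k x A) :
    ∑ ω ∈ Finset.univ.filter (fun ω : W.Outcome h => x ∈ ω k), restProb k x ω * A ω =
      ∑ ω ∈ Finset.univ.filter (fun ω : W.Outcome h => ¬ x ∈ ω k), restProb k x ω * A ω := by
  refine Finset.sum_bij' (fun ω _ => unsel k x ω) (fun ω _ => sel k x ω) ?_ ?_ ?_ ?_ ?_
  · intro ω _; simp [mem_unsel]
  · intro ω _; simp [mem_sel]
  · intro ω hω
    simp only [Finset.mem_filter, Finset.mem_univ, true_and] at hω
    funext k'; ext y
    rw [mem_sel, mem_unsel]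
    constructor
    · rintro (⟨rfl, rfl⟩ | h1)
      · exact hω
      · exact h1.2
    · tauto
  · intro ω hω
    simp only [Finset.mem_filter, Finset.mem_univ, true_and] at hω
    funext k'; ext y
    rw [mem_unsel, mem_sel]
    constructor
    · tauto
    · intro h1
      refine ⟨?_, .inr h1⟩
      rintro ⟨rfl, rfl⟩; exact hω h1
  · intro ω _
    rw [restProb_unsel, (hA ω).2]

theorem expect_eq_rest (k : Fin h) (x : W.VNode) {A : W.Outcome h → ℝ} (hA : Indep k x A) :
    W.expect h A = ∑ ω ∈ Finset.univ.filter (fun ω : W.Outcome h => x ∈ ω k),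
      restProb k x ω * A ω := by
  have h1 := sum_sel_eq_sum_unsel k x hA
  rw [expect, ← Finset.sum_filter_add_sum_filter_not Finset.univ (fun ω : W.Outcome h => x ∈ ω k)]
  have h2 : ∀ ω ∈ Finset.univ.filter (fun ω : W.Outcome h => x ∈ ω k), W.prob h ω * A ω =
      W.selProb h (k.val + 1) * (restProb k x ω * A ω) := by
    intro ω hω
    rw [Finset.mem_filter] at hω
    rw [prob_eq k x, if_pos hω.2, mul_assoc]
  have h3 : ∀ ω ∈ Finset.univ.filter (fun ω : W.Outcome h => ¬ x ∈ ω k), W.prob h ω * A ω =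
      (1 - W.selProb h (k.val + 1)) * (restProb k x ω * A ω) := by
    intro ω hω
    rw [Finset.mem_filter] at hω
    rw [prob_eq k x, if_neg hω.2, mul_assoc]
  rw [Finset.sum_congr rfl h2, Finset.sum_congr rfl h3, ← Finset.mul_sum, ← Finset.mul_sum, ← h1]
  ring

/-- Conditioning on a single selection; all uses of independence below reduce to this. -/
theorem expect_ite (k : Fin h) (x : W.VNode) {A B : W.Outcome h → ℝ} (hA : Indep k x A)
    (hB : Indep k x B) : W.expect h (fun ω => if x ∈ ω k then A ω else B ω) =
      W.selProb h (k.val + 1) * W.expect h A + (1 - W.selProb h (k.val + 1)) * W.expect h B := by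
  rw [expect_eq_rest k x hA, expect_eq_rest k x hB, sum_sel_eq_sum_unsel k x hB, expect,
    ← Finset.sum_filter_add_sum_filter_not Finset.univ (fun ω : W.Outcome h => x ∈ ω k),
    Finset.mul_sum, Finset.mul_sum]
  congr 1 <;> refine Finset.sum_congr rfl fun ω hω => ?_ <;> rw [Finset.mem_filter] at hω
  · rw [prob_eq k x, if_pos hω.2, if_pos hω.2, mul_assoc]
  · rw [prob_eq k x, if_neg hω.2, if_neg hω.2, mul_assoc]

theorem expect_none_selected (k : Fin h) (A : Finset W.VNode) {G : W.Outcome h → ℝ}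
    (hG : ∀ x ∈ A, Indep k x G) :
    W.expect h (fun ω => if ∃ x ∈ A, x ∈ ω k then 0 else G ω) =
      (1 - W.selProb h (k.val + 1)) ^ A.card * W.expect h G := by
  induction A using Finset.induction_on with
  | empty => simp
  | insert a A ha ih =>
    have h1 : (fun ω : W.Outcome h => if ∃ x ∈ insert a A, x ∈ ω k then 0 else G ω) =
        fun ω => if a ∈ ω k then 0 else (if ∃ x ∈ A, x ∈ ω k then 0 else G ω) := by
      funext ω
      by_cases hω : a ∈ ω k <;> simp [hω]
    rw [h1, expect_ite k a (A := fun _ => 0), expect_const,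
      ih fun x hx => hG x (Finset.mem_insert_of_mem hx), Finset.card_insert_of_notMem ha]
    · ring
    · intro ω; exact ⟨rfl, rfl⟩
    · intro ω
      have h2 : ∀ x ∈ A, x ≠ a := by rintro x hx rfl; exact ha hx
      have h3 := hG a (Finset.mem_insert_self _ _) ω
      constructor
      · have : (∃ x ∈ A, x ∈ sel k a ω k) ↔ ∃ x ∈ A, x ∈ ω k :=
          exists_congr fun x => and_congr_right fun hx => by simp [mem_sel, h2 x hx]
        simp only [this, h3.1]
      · have : (∃ x ∈ A, x ∈ unsel k a ω k) ↔ ∃ x ∈ A, x ∈ ω k :=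
          exists_congr fun x => and_congr_right fun hx => by simp [mem_unsel, h2 x hx]
        simp only [this, h3.2]

/-! ### The expected cost of an exploration -/

theorem mem_landmarks {ω : W.Outcome h} {k : Fin h} {u : Fin n} :
    u ∈ W.landmarks h ω (k.val + 1) ↔ ∃ c : Fin (W.copies u), (⟨u, c⟩ : W.VNode) ∈ ω k := by
  simp only [landmarks, Finset.mem_filter, Finset.mem_univ, true_and]
  constructor
  · rintro ⟨k', hk', hc⟩
    rwa [← Fin.ext (Nat.succ_injective hk')]
  · intro hc; exact ⟨k, rfl, hc⟩

theorem scanned_congr {H H' : Fin n → Bool} {l : List (Fin n)} (hl : ∀ x ∈ l, H x = H' x) :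
    W.scanned H l = W.scanned H' l := by
  induction l with
  | nil => rfl
  | cons a l ih =>
    rw [scanned, scanned, hl a (by simp), ih fun x hx => hl x (by simp [hx])]

theorem le_numEdges_add_one (hc : W.graph.Connected) : n ≤ W.numEdges + 1 := by
  have h1 := hc.card_vert_le_card_edgeSet_add_one
  rwa [Nat.card_coe_set_eq, Nat.card_eq_fintype_card, Fintype.card_fin] at h1

/-- A connected graph has at least n - 1 edges, and n - 1 ≥ n/2. Keeping m/n away from zero lets
additive constants be absorbed later. -/
theorem half_le_ratio (hc : W.graph.Connected) (hn : 2 ≤ n) :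
    (1 / 2 : ℝ) ≤ (W.numEdges : ℝ) / n := by
  have h1 : (n : ℝ) ≤ W.numEdges + 1 := by exact_mod_cast le_numEdges_add_one hc
  have h2 : (2 : ℝ) ≤ n := by exact_mod_cast hn
  rw [le_div_iff₀ (by linarith)]
  linarith

theorem deg_le_copies (hc : W.graph.Connected) (hn : 2 ≤ n) (u : Fin n) :
    (W.deg u : ℝ) ≤ W.copies u * ((W.numEdges : ℝ) / n) := by
  have h1 : (0 : ℝ) < (W.numEdges : ℝ) / n := by
    have := half_le_ratio hc hn; linarith
  rw [← div_le_iff₀ h1]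
  exact Nat.le_ceil _

/-- Bernoulli's inequality bounds cp + 1 by (1+p)^c, and (1-p)(1+p) ≤ 1. -/
theorem one_sub_pow_mul_le {p : ℝ} (hp : 0 ≤ p) (hp' : p ≤ 1) (c : ℕ) :
    (1 - p) ^ c * (c * p + 1) ≤ 1 := by
  have h1 : (c : ℝ) * p + 1 ≤ (1 + p) ^ c := by
    have := one_add_mul_le_pow (a := p) (by linarith) c
    linarith
  have h2 : (0 : ℝ) ≤ (1 - p) ^ c := pow_nonneg (by linarith) c
  calc (1 - p) ^ c * (c * p + 1) ≤ (1 - p) ^ c * (1 + p) ^ c := mul_le_mul_of_nonneg_left h1 h2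
    _ = (1 - p ^ 2) ^ c := by rw [← mul_pow]; ring
    _ ≤ 1 := pow_le_one₀ (by nlinarith) (by nlinarith)

/-- It is essential that `l` is fixed before the sampling. Induction on `l`: the first vertex and
the rest count only if none of the c copies of `x` is selected, and for the rest, which does not
involve these copies, the bound M/p holds by induction, with M = m/n. -/
theorem expect_scanned_le (hc : W.graph.Connected) (hn : 2 ≤ n) (k : Fin h) (l : List (Fin n))
    (hl : l.Nodup) :
    W.expect h (fun ω => (W.scanned (haltAt (W.landmarks h ω (k.val + 1))) l : ℝ)) ≤
      (W.numEdges : ℝ) / n / W.selProb h (k.val + 1) := by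
  have hp := W.selProb_pos (h := h) hn (k.val + 1)
  have hp' := W.selProb_le_one (h := h) hn (k.val + 1)
  have hM : (0 : ℝ) ≤ (W.numEdges : ℝ) / n := by positivity
  induction l with
  | nil =>
    simp only [scanned, Nat.cast_zero, expect_const]
    positivity
  | cons x l ih =>
    rw [List.nodup_cons] at hl
    have ih := ih hl.2
    set A : Finset W.VNode := Finset.univ.filter fun y => y.1 = x with hA
    have hcard : A.card = W.copies x := by
      have : A = Finset.univ.map ⟨fun c : Fin (W.copies x) => (⟨x, c⟩ : W.VNode),
          fun a b hab => by simpa using hab⟩ := by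
        ext ⟨y, c⟩
        simp only [hA, Finset.mem_filter, Finset.mem_univ, true_and, Finset.mem_map]
        constructor
        · rintro rfl; exact ⟨c, rfl⟩
        · rintro ⟨c', hc'⟩; exact (congrArg Sigma.fst hc').symm
      rw [this, Finset.card_map, Finset.card_univ, Fintype.card_fin]
    have h1 : (fun ω : W.Outcome h =>
        (W.scanned (haltAt (W.landmarks h ω (k.val + 1))) (x :: l) : ℝ)) =
        fun ω => if ∃ y ∈ A, y ∈ ω k then 0 else
          (W.deg x : ℝ) + W.scanned (haltAt (W.landmarks h ω (k.val + 1))) l := by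
      funext ω
      have h2 : (∃ y ∈ A, y ∈ ω k) ↔ x ∈ W.landmarks h ω (k.val + 1) := by
        rw [mem_landmarks]
        constructor
        · rintro ⟨⟨y, c⟩, hy, hω⟩
          obtain rfl : y = x := by simpa [hA] using hy
          exact ⟨c, hω⟩
        · rintro ⟨c, hω⟩; exact ⟨⟨x, c⟩, by simp [hA], hω⟩
      by_cases h3 : x ∈ W.landmarks h ω (k.val + 1)
      · rw [if_pos (h2.2 h3)]; simp [scanned, haltAt, h3]
      · rw [if_neg (mt h2.1 h3)]; simp [scanned, haltAt, h3]
    have hind : ∀ y ∈ A, Indep k y (fun ω : W.Outcome h =>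
        (W.deg x : ℝ) + W.scanned (haltAt (W.landmarks h ω (k.val + 1))) l) := by
      intro y hy ω
      obtain rfl : y.1 = x := by simpa [hA] using hy
      have h4 : ∀ z ∈ l, ∀ c : Fin (W.copies z), (⟨z, c⟩ : W.VNode) ≠ y := by
        rintro z hz c rfl; exact hl.1 hz
      constructor
      · refine congrArg (fun m : ℕ => (W.deg y.1 : ℝ) + m) (scanned_congr fun z hz => ?_)
        simp only [haltAt, mem_landmarks, mem_sel, h4 z hz, and_false, false_or]
      · refine congrArg (fun m : ℕ => (W.deg y.1 : ℝ) + m) (scanned_congr fun z hz => ?_)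
        simp only [haltAt, mem_landmarks, mem_unsel, h4 z hz, and_false, not_false_iff, true_and]
    rw [h1, expect_none_selected k A hind, expect_add, expect_const, hcard]
    have hd := deg_le_copies hc hn x
    have hq : (0 : ℝ) ≤ (1 - W.selProb h (k.val + 1)) ^ W.copies x :=
      pow_nonneg (by linarith) _
    generalize W.selProb h (k.val + 1) = p at *
    generalize (W.numEdges : ℝ) / n = M at *
    -- The copies are numerous enough that the degree is at most c·M; then M/p factors out.
    calc _ ≤ (1 - p) ^ W.copies x * (W.copies x * M + M / p) :=
          mul_le_mul_of_nonneg_left (add_le_add hd ih) hq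
      _ = ((1 - p) ^ W.copies x * (W.copies x * p + 1)) * (M / p) := by field_simp
      _ ≤ 1 * (M / p) :=
          mul_le_mul_of_nonneg_right (one_sub_pow_mul_le hp.le hp' _) (by positivity)
      _ = M / p := one_mul _

/-! ### Moments of the numbers of landmarks -/

/-- The number of selected nodes in a list. -/
def selCount (k : Fin h) (ω : W.Outcome h) : List W.VNode → ℕ
  | [] => 0
  | x :: l => (if x ∈ ω k then 1 else 0) + selCount k ω l

theorem indep_selCount (k : Fin h) {x : W.VNode} {l : List W.VNode} (hx : x ∉ l) :
    Indep k x fun ω => selCount k ω l := by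
  induction l with
  | nil => intro ω; exact ⟨rfl, rfl⟩
  | cons y l ih =>
    rw [List.mem_cons, not_or] at hx
    intro ω
    have h1 := ih hx.2 ω
    simp only [selCount, mem_sel, mem_unsel, Ne.symm hx.1, and_false, false_or, not_false_iff,
      true_and, h1, and_self]

theorem Indep.comp {k : Fin h} {x : W.VNode} {α β : Type*} {F : W.Outcome h → α}
    (hF : Indep k x F) (g : α → β) : Indep k x fun ω => g (F ω) :=
  fun ω => ⟨congrArg g (hF ω).1, congrArg g (hF ω).2⟩

/-- Binomial coefficients satisfy Pascal's recursion, so conditioning on one node at a time closes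
the induction, without independence of powers of the count. -/
theorem expect_choose_selCount_le (hn : 2 ≤ n) (k : Fin h) (l : List W.VNode) (hl : l.Nodup)
    (j : ℕ) : W.expect h (fun ω => ((selCount k ω l).choose j : ℝ)) ≤
      (l.length * W.selProb h (k.val + 1)) ^ j := by
  have hp := W.selProb_pos (h := h) hn (k.val + 1)
  induction l generalizing j with
  | nil =>
    cases j with
    | zero => simp [selCount, expect_const]
    | succ j => simp [selCount, expect_const]
  | cons x l ih =>
    rw [List.nodup_cons] at hl
    cases j with
    | zero => simp [expect_const]
    | succ j =>
      have h1 : (fun ω : W.Outcome h => ((selCount k ω (x :: l)).choose (j + 1) : ℝ)) =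
          fun ω => if x ∈ ω k then ((selCount k ω l).choose j : ℝ) +
            (selCount k ω l).choose (j + 1) else ((selCount k ω l).choose (j + 1) : ℝ) := by
        funext ω
        by_cases hx : x ∈ ω k
        · simp only [selCount, hx, if_true]
          rw [add_comm, Nat.choose_succ_succ, Nat.cast_add]
        · simp [selCount, hx]
      have hind := indep_selCount k hl.1
      rw [h1, expect_ite k x (hind.comp fun m => ((m.choose j : ℝ) + m.choose (j + 1)))
        (hind.comp fun m => (m.choose (j + 1) : ℝ)), expect_add]
      have h2 := ih hl.2 j
      have h3 := ih hl.2 (j + 1)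
      rw [List.length_cons, Nat.cast_add, Nat.cast_one]
      generalize W.selProb h (k.val + 1) = p at *
      have h5 : (l.length * p) ^ j ≤ ((l.length + 1) * p) ^ j :=
        pow_le_pow_left₀ (by positivity) (by nlinarith) j
      have h4 : p * (l.length * p) ^ j + (l.length * p) ^ (j + 1) ≤
          ((l.length + 1) * p) ^ (j + 1) := by
        rw [pow_succ, pow_succ]
        have := mul_le_mul_of_nonneg_right h5 (show 0 ≤ (l.length + 1) * p by positivity)
        linarith
      have := mul_le_mul_of_nonneg_left h2 hp.le
      linarith

/-- The number of nodes selected at index `k` before the first node selected at index `k'`. -/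
def ballCount (k k' : Fin h) (ω : W.Outcome h) : List W.VNode → ℕ
  | [] => 0
  | x :: l => if x ∈ ω k' then 0 else (if x ∈ ω k then 1 else 0) + ballCount k k' ω l

theorem indep_ballCount (k k' k₀ : Fin h) {x : W.VNode} {l : List W.VNode} (hx : x ∉ l) :
    Indep k₀ x fun ω => ballCount k k' ω l := by
  induction l with
  | nil => intro ω; exact ⟨rfl, rfl⟩
  | cons y l ih =>
    rw [List.mem_cons, not_or] at hx
    intro ω
    have h1 := ih hx.2 ω
    simp only [ballCount, mem_sel, mem_unsel, Ne.symm hx.1, and_false, false_or, not_false_iff,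
      true_and, h1, and_self]

/-- The bound does not depend on the length of the list: the first node selected at `k'` ends the
count. The ratio `c` of the two probabilities plays the role of the expected count. -/
theorem expect_choose_ballCount_le (hn : 2 ≤ n) {k k' : Fin h} (hk : k ≠ k') {c : ℝ}
    (hc : W.selProb h (k.val + 1) = W.selProb h (k'.val + 1) * c) (l : List W.VNode)
    (hl : l.Nodup) (j : ℕ) :
    W.expect h (fun ω => ((ballCount k k' ω l).choose j : ℝ)) ≤ c ^ j := by
  have hp := W.selProb_pos (h := h) hn (k.val + 1)
  have hp' := W.selProb_pos (h := h) hn (k'.val + 1)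
  have hp1 := W.selProb_le_one (h := h) hn (k'.val + 1)
  have hc0 : 0 < c := by
    rw [hc] at hp; exact (pos_iff_pos_of_mul_pos hp).1 hp'
  induction l generalizing j with
  | nil =>
    cases j with
    | zero => simp [expect_const]
    | succ j => simp only [ballCount, Nat.choose_zero_succ, Nat.cast_zero, expect_const]; positivity
  | cons x l ih =>
    rw [List.nodup_cons] at hl
    cases j with
    | zero => simp [expect_const]
    | succ j =>
      have h1 : (fun ω : W.Outcome h => ((ballCount k k' ω (x :: l)).choose (j + 1) : ℝ)) =
          fun ω => if x ∈ ω k' then 0 else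
            if x ∈ ω k then ((ballCount k k' ω l).choose j : ℝ) +
            (ballCount k k' ω l).choose (j + 1) else ((ballCount k k' ω l).choose (j + 1) : ℝ) := by
        funext ω
        by_cases hx' : x ∈ ω k'
        · simp [ballCount, hx']
        · by_cases hx : x ∈ ω k
          · simp only [ballCount, hx, hx', if_true, if_false]
            rw [add_comm, Nat.choose_succ_succ, Nat.cast_add]
          · simp [ballCount, hx, hx']
      have hind := fun k₀ => indep_ballCount k k' k₀ hl.1
      have hind' : Indep k' x (fun ω : W.Outcome h =>
          if x ∈ ω k then ((ballCount k k' ω l).choose j : ℝ) +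
            (ballCount k k' ω l).choose (j + 1)
          else ((ballCount k k' ω l).choose (j + 1) : ℝ)) := by
        intro ω
        simp only [hind k' ω, mem_sel, mem_unsel, hk, false_and, false_or, not_false_iff,
          true_and, and_self]
      rw [h1, expect_ite k' x (A := fun _ => 0) (fun ω => ⟨rfl, rfl⟩) hind', expect_const,
        expect_ite k x ((hind k).comp fun m => ((m.choose j : ℝ) + m.choose (j + 1)))
        ((hind k).comp fun m => (m.choose (j + 1) : ℝ)), expect_add]
      have h2 := ih hl.2 j
      have h3 := ih hl.2 (j + 1)
      generalize W.selProb h (k.val + 1) = p at *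
      generalize W.selProb h (k'.val + 1) = p' at *
      have h4 := mul_le_mul_of_nonneg_left h2 hp.le
      have h5 : p * c ^ j = p' * c ^ (j + 1) := by rw [hc]; ring
      -- Since p = p'c, the left side is (1 - p')(1 + p')·c^(j+1).
      have h6 : (1 - p') * (p * c ^ j + c ^ (j + 1)) ≤ c ^ (j + 1) := by
        rw [h5]
        have : (0 : ℝ) < c ^ (j + 1) := by positivity
        nlinarith [mul_nonneg (sq_nonneg p') this.le]
      refine le_trans ?_ h6
      rw [mul_zero, zero_add]
      refine mul_le_mul_of_nonneg_left ?_ (by linarith)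
      linarith

end WGraph

theorem entries_le_card {K A : Type} [Fintype K] (T : K → Option A) : entries T ≤ Fintype.card K :=
  Finset.card_le_univ _

namespace WGraph

variable {n : ℕ} {W : WGraph n} {h : ℕ}

/-! ## The size of one level -/

/-- The number of machine words used for the level `i`. -/
def levelSize (W : WGraph n) (h : ℕ) (L : ℕ → Finset (Fin n)) (i : ℕ) : ℕ :=
  2 * entries ((W.oracle h L).forest i) + 2 * entries ((W.oracle h L).hash i) +
    ((W.oracle h L).dp i).size

/-- The pairs of intersecting stored paths. -/
def crossing (W : WGraph n) (P : Finset (Fin n × Fin n)) :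
    Finset ((Fin n × Fin n) × (Fin n × Fin n)) :=
  (P ×ˢ P).filter fun e => ∃ x, x ∈ W.sp e.1.1 e.1.2 ∧ x ∈ W.sp e.2.1 e.2.2

/-- Each branching event belongs to an ordered pair of intersecting stored paths, and each such pair
has at most two of them. -/
theorem entries_branch_le (hc : W.graph.Connected) (P : Finset (Fin n × Fin n)) :
    entries (W.dppro P).branch ≤ (W.crossing P).card * 2 := by
  have hsub : (Finset.univ.filter fun b => ((W.dppro P).branch b).isSome) ⊆
      (W.crossing P).biUnion fun e => (Finset.univ.filter fun x => W.IsBranching e.1 e.2 x).image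
        fun x => (e.1, e.2, x) := by
    rintro ⟨e, e', x⟩ hb
    simp only [Finset.mem_filter, Finset.mem_univ, true_and] at hb
    have hb' : e ∈ P ∧ e' ∈ P ∧ W.IsBranching e e' x := by
      by_contra hcon
      rw [show (W.dppro P).branch (e, e', x) = none from if_neg hcon] at hb
      cases hb
    obtain ⟨h1, h2, h3⟩ := hb'
    simp only [Finset.mem_biUnion, Finset.mem_image, Finset.mem_filter, Finset.mem_univ, true_and]
    exact ⟨(e, e'), Finset.mem_filter.2 ⟨Finset.mk_mem_product h1 h2, x, h3.2.1, h3.2.2.1⟩,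
      x, h3, rfl⟩
  refine (Finset.card_le_card hsub).trans (Finset.card_biUnion_le_card_mul _ _ _ fun e _ => ?_)
  exact Finset.card_image_le.trans (card_isBranching_le hc e.1 e.2)

/-- Forest and home records give 2 + 5 words per vertex, hash table and end edges 2 + 4 per pair,
and at most two branching records of 9 words go to each crossing. -/
theorem levelSize_le (hc : W.graph.Connected) (L : ℕ → Finset (Fin n)) (i : ℕ) :
    W.levelSize h L i ≤ 7 * n + 6 * (W.pairs h L i).card +
      18 * (W.crossing (W.pairs h L i)).card := by
  have h1 := entries_le_card ((W.oracle h L).forest i)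
  have h2 : entries ((W.oracle h L).hash i) ≤ (W.pairs h L i).card := by
    refine Finset.card_le_card fun e he => ?_
    by_contra hcon
    rw [Finset.mem_filter, show (W.oracle h L).hash i e = none from if_neg hcon] at he
    cases he.2
  have h3 : entries ((W.oracle h L).dp i).ends ≤ (W.pairs h L i).card := by
    refine Finset.card_le_card fun e he => ?_
    by_contra hcon
    rw [Finset.mem_filter, show ((W.oracle h L).dp i).ends e = none from if_neg hcon] at he
    cases he.2
  have h4 := entries_le_card ((W.oracle h L).dp i).home
  have h5 : entries ((W.oracle h L).dp i).branch ≤ _ := entries_branch_le hc (W.pairs h L i)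
  rw [Fintype.card_fin] at h1 h4
  rw [levelSize, Dppro.size]
  omega

theorem card_crossing_le (P : Finset (Fin n × Fin n)) :
    (W.crossing P).card ≤ P.card * P.card := by
  rw [← Finset.card_product]
  exact Finset.card_filter_le _ _

theorem levelSize_top_le (hc : W.graph.Connected) (L : ℕ → Finset (Fin n)) :
    W.levelSize h L h ≤ 7 * n + 24 * (L h).card ^ 4 := by
  have h1 := levelSize_le (h := h) hc L h
  have h2 := card_crossing_le (W := W) (W.pairs h L h)
  have h3 : (W.pairs h L h).card ≤ (L h).card ^ 2 := by
    rw [sq, ← Finset.card_product]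
    exact Finset.card_filter_le _ _
  have h4 : (L h).card ^ 2 ≤ (L h).card ^ 4 := by
    rcases Nat.eq_zero_or_pos (L h).card with h0 | h0
    · rw [h0]; norm_num
    · exact Nat.pow_le_pow_right h0 (by norm_num)
  have h5 : (W.pairs h L h).card * (W.pairs h L h).card ≤ (L h).card ^ 4 :=
    (Nat.mul_le_mul h3 h3).trans (le_of_eq (by ring))
  omega

/-- The landmarks of level `i` in the ball of `u`. -/
def ballLandmarks (W : WGraph n) (L : ℕ → Finset (Fin n)) (i : ℕ) (u : Fin n) : Finset (Fin n) :=
  (L i).filter fun v => W.InBall 1 (L (i + 1)) u v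

/-- Through the common vertex, both ends of the shorter path are within 2·d(a,b) of `a`, which is
less than 2/3 of the distance to the next landmarks. This is the reason for the fraction 1/3 in the
definition of the stored pairs. -/
theorem inBall_of_crossing (hc : W.graph.Connected) {L : Finset (Fin n)} {a b a' b' x : Fin n}
    (hx : x ∈ W.sp a b) (hx' : x ∈ W.sp a' b') (hle : W.dist a' b' ≤ W.dist a b)
    (hab : W.InBall (1 / 3) L a b) : W.InBall 1 L a b ∧ W.InBall 1 L a a' ∧ W.InBall 1 L a b' := by
  have key : ∀ y, W.dist a y ≤ 2 * W.dist a b → W.InBall 1 L a y := fun y hy z hz => by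
    have := hab z hz
    have := W.dist_nonneg a b
    linarith
  have h1 := dist_add_of_mem_sp hc hx
  have h2 := dist_add_of_mem_sp hc hx'
  have h3 := dist_triangle hc a x a'
  have h4 := dist_triangle hc a x b'
  rw [dist_comm hc x a'] at h3
  have h5 := W.dist_nonneg x b
  have h6 := W.dist_nonneg x b'
  have h7 := W.dist_nonneg a' x
  have h8 := W.dist_nonneg a b
  exact ⟨key _ (by linarith), key _ (by linarith), key _ (by linarith)⟩

/-- A ball size is at most its cube, which puts the pairs under the same sum as the crossings. -/
theorem card_pairs_le {L : ℕ → Finset (Fin n)} {i : ℕ} (hi : i ≠ h) :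
    (W.pairs h L i).card ≤ 2 * ∑ u ∈ L i, (W.ballLandmarks L i u).card ^ 3 := by
  have hsub : W.pairs h L i ⊆ (L i).biUnion fun u =>
      (W.ballLandmarks L i u).image (fun v => (u, v)) ∪
      (W.ballLandmarks L i u).image (fun v => (v, u)) := by
    rintro ⟨a, b⟩ he
    simp only [pairs, Finset.mem_filter, Finset.mem_product, hi, false_or] at he
    have hball : ∀ {u v}, W.InBall (1 / 3) (L (i + 1)) u v → W.InBall 1 (L (i + 1)) u v :=
      fun {u v} huv z hz => by
        have := huv z hz
        have := W.dist_nonneg u z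
        linarith
    simp only [Finset.mem_biUnion, Finset.mem_union, Finset.mem_image, ballLandmarks,
      Finset.mem_filter, Prod.mk.injEq]
    rcases he with ⟨⟨ha, hb⟩, h1 | h1⟩
    · exact ⟨a, ha, .inl ⟨b, ⟨hb, hball h1⟩, rfl, rfl⟩⟩
    · exact ⟨b, hb, .inr ⟨a, ⟨ha, hball h1⟩, rfl, rfl⟩⟩
  refine (Finset.card_le_card hsub).trans (Finset.card_biUnion_le.trans ?_)
  rw [Finset.mul_sum]
  refine Finset.sum_le_sum fun u _ => (Finset.card_union_le _ _).trans ?_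
  have h1 := Finset.card_image_le (s := W.ballLandmarks L i u) (f := fun v => (u, v))
  have h2 := Finset.card_image_le (s := W.ballLandmarks L i u) (f := fun v => (v, u))
  have h3 : (W.ballLandmarks L i u).card ≤ (W.ballLandmarks L i u).card ^ 3 :=
    Nat.le_self_pow (by norm_num) _
  omega

/-- The four images correspond to the four end points that may be the centre whose ball contains the
other three: an end of the longer path, on the side for which the pair is stored. -/
theorem card_crossing_pairs_le (hc : W.graph.Connected) {L : ℕ → Finset (Fin n)} {i : ℕ}
    (hi : i ≠ h) : (W.crossing (W.pairs h L i)).card ≤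
      4 * ∑ u ∈ L i, (W.ballLandmarks L i u).card ^ 3 := by
  let T : Fin n → Finset (Fin n × Fin n × Fin n) := fun u =>
    W.ballLandmarks L i u ×ˢ W.ballLandmarks L i u ×ˢ W.ballLandmarks L i u
  have hsub : W.crossing (W.pairs h L i) ⊆ (L i).biUnion fun u =>
      (T u).image (fun v => ((u, v.1), (v.2.1, v.2.2))) ∪
      (T u).image (fun v => ((v.1, u), (v.2.1, v.2.2))) ∪
      (T u).image (fun v => ((v.2.1, v.2.2), (u, v.1))) ∪
      (T u).image (fun v => ((v.2.1, v.2.2), (v.1, u))) := by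
    rintro ⟨⟨a, b⟩, ⟨a', b'⟩⟩ he
    simp only [crossing, pairs, Finset.mem_filter, Finset.mem_product, hi, false_or] at he
    obtain ⟨⟨⟨⟨ha, hb⟩, h1⟩, ⟨ha', hb'⟩, h2⟩, x, hx, hx'⟩ := he
    simp only [Finset.mem_biUnion, Finset.mem_union, Finset.mem_image, ballLandmarks, T,
      Finset.mem_filter, Finset.mem_product, Prod.mk.injEq, Prod.exists]
    rcases le_total (W.dist a' b') (W.dist a b) with hle | hle
    · rcases h1 with h1 | h1
      · obtain ⟨h3, h4, h5⟩ := inBall_of_crossing hc hx hx' hle h1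
        exact ⟨a, ha, .inl (.inl (.inl ⟨b, a', b', ⟨⟨hb, h3⟩, ⟨ha', h4⟩, hb', h5⟩, by simp⟩))⟩
      · obtain ⟨h3, h4, h5⟩ := inBall_of_crossing hc ((mem_sp_comm hc).1 hx) hx'
          (by rwa [dist_comm hc b a]) h1
        exact ⟨b, hb, .inl (.inl (.inr ⟨a, a', b', ⟨⟨ha, h3⟩, ⟨ha', h4⟩, hb', h5⟩, by simp⟩))⟩
    · rcases h2 with h2 | h2
      · obtain ⟨h3, h4, h5⟩ := inBall_of_crossing hc hx' hx hle h2
        exact ⟨a', ha', .inl (.inr ⟨b', a, b, ⟨⟨hb', h3⟩, ⟨ha, h4⟩, hb, h5⟩, by simp⟩)⟩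
      · obtain ⟨h3, h4, h5⟩ := inBall_of_crossing hc ((mem_sp_comm hc).1 hx') hx
          (by rwa [dist_comm hc b' a']) h2
        exact ⟨b', hb', .inr ⟨a', a, b, ⟨⟨ha', h3⟩, ⟨ha, h4⟩, hb, h5⟩, by simp⟩⟩
  refine (Finset.card_le_card hsub).trans (Finset.card_biUnion_le.trans ?_)
  rw [Finset.mul_sum]
  refine Finset.sum_le_sum fun u _ => ?_
  have hT : (T u).card = (W.ballLandmarks L i u).card ^ 3 := by
    simp only [T, Finset.card_product]; ring
  rw [← hT]
  have himg : ∀ f : Fin n × Fin n × Fin n → (Fin n × Fin n) × (Fin n × Fin n),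
      ((T u).image f).card ≤ (T u).card := fun f => Finset.card_image_le
  refine (Finset.card_union_le _ _).trans ?_
  refine (add_le_add_left (Finset.card_union_le _ _) _).trans ?_
  refine (add_le_add_left (add_le_add_left (Finset.card_union_le _ _) _) _).trans ?_
  have h1 := himg (fun v => ((u, v.1), (v.2.1, v.2.2)))
  have h2 := himg (fun v => ((v.1, u), (v.2.1, v.2.2)))
  have h3 := himg (fun v => ((v.2.1, v.2.2), (u, v.1)))
  have h4 := himg (fun v => ((v.2.1, v.2.2), (v.1, u)))
  omega

theorem levelSize_inner_le (hc : W.graph.Connected) (L : ℕ → Finset (Fin n)) {i : ℕ}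
    (hi : i ≠ h) :
    W.levelSize h L i ≤ 7 * n + 84 * ∑ u ∈ L i, (W.ballLandmarks L i u).card ^ 3 := by
  have h1 := levelSize_le (h := h) hc L i
  have h2 := card_crossing_pairs_le (W := W) hc (L := L) hi
  have h3 := card_pairs_le (W := W) (L := L) hi
  omega

/-! ## The expected size -/

theorem sum_deg : ∑ u, W.deg u = 2 * W.numEdges := by
  have h1 := W.graph.sum_degrees_eq_twice_card_edges
  have h2 : W.graph.edgeFinset.card = W.numEdges := by
    rw [numEdges, ← Set.ncard_coe_finset, SimpleGraph.coe_edgeFinset]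
  rw [h2] at h1
  rw [← h1]
  refine Finset.sum_congr rfl fun u _ => ?_
  rw [deg, ← SimpleGraph.card_neighborFinset_eq_degree]
  congr 1
  ext x
  simp [nbrs]

/-- The degrees sum to 2m, which yields 2n, and rounding up adds at most one per vertex. -/
theorem sum_copies_le (hc : W.graph.Connected) (hn : 2 ≤ n) :
    ∑ u, (W.copies u : ℝ) ≤ 3 * n := by
  have hM := half_le_ratio hc hn
  have hn' : (0 : ℝ) < n := by positivity
  have hm : (W.numEdges : ℝ) ≠ 0 := by
    intro h0; rw [h0] at hM; norm_num at hM
  have h1 : ∀ u, (W.copies u : ℝ) ≤ (W.deg u : ℝ) / ((W.numEdges : ℝ) / n) + 1 := fun u =>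
    (Nat.ceil_lt_add_one (by positivity)).le
  refine (Finset.sum_le_sum fun u _ => h1 u).trans (le_of_eq ?_)
  rw [Finset.sum_add_distrib, ← Finset.sum_div, ← Nat.cast_sum, sum_deg]
  simp only [Finset.sum_const, Finset.card_univ, Fintype.card_fin, nsmul_eq_mul, mul_one]
  push_cast
  field_simp
  ring

theorem card_le_selCount (k : Fin h) (ω : W.Outcome h) (l : List W.VNode) :
    ∀ S : Finset W.VNode, (∀ y ∈ S, y ∈ l ∧ y ∈ ω k) → S.card ≤ selCount k ω l := by
  induction l with
  | nil =>
    intro S hS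
    obtain rfl : S = ∅ := Finset.eq_empty_of_forall_notMem fun y hy => by simpa using (hS y hy).1
    simp
  | cons x l ih =>
    intro S hS
    have h1 := ih (S.erase x) fun y hy => by
      obtain ⟨h2, h3⟩ := Finset.mem_erase.1 hy
      obtain ⟨h4, h5⟩ := hS y h3
      exact ⟨(List.mem_cons.1 h4).resolve_left h2, h5⟩
    rw [selCount]
    by_cases hx : x ∈ S
    · rw [if_pos (hS x hx).2, ← Finset.card_erase_add_one hx]
      omega
    · rw [Finset.erase_eq_of_notMem hx] at h1
      omega

theorem card_le_ballCount {k k' : Fin h} (ω : W.Outcome h) (u : Fin n) (l : List W.VNode)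
    (hl : l.Pairwise fun x y => W.dist u x.1 ≤ W.dist u y.1) :
    ∀ S : Finset W.VNode, (∀ y ∈ S, y ∈ l ∧ y ∈ ω k ∧
      W.InBall 1 (W.landmarks h ω (k'.val + 1)) u y.1) → S.card ≤ ballCount k k' ω l := by
  induction l with
  | nil =>
    intro S hS
    obtain rfl : S = ∅ := Finset.eq_empty_of_forall_notMem fun y hy => by simpa using (hS y hy).1
    simp
  | cons x l ih =>
    intro S hS
    rw [List.pairwise_cons] at hl
    rw [ballCount]
    by_cases hx' : x ∈ ω k'
    -- A copy of a landmark of the next level heads the list, and all remaining nodes are at least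
    -- as far away, hence outside the ball.
    · suffices h0 : S = ∅ by simp [h0]
      refine Finset.eq_empty_of_forall_notMem fun y hy => ?_
      obtain ⟨h1, -, h2⟩ := hS y hy
      have h3 := h2 x.1 (mem_landmarks.2 ⟨x.2, hx'⟩)
      rw [one_mul] at h3
      rcases List.mem_cons.1 h1 with rfl | h1
      · exact lt_irrefl _ h3
      · exact not_lt.2 (hl.1 y h1) h3
    have h1 := ih hl.2 (S.erase x) fun y hy => by
      obtain ⟨h2, h3⟩ := Finset.mem_erase.1 hy
      obtain ⟨h4, h5⟩ := hS y h3
      exact ⟨(List.mem_cons.1 h4).resolve_left h2, h5⟩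
    rw [if_neg hx']
    by_cases hx : x ∈ S
    · rw [if_pos (hS x hx).2.1, ← Finset.card_erase_add_one hx]
      omega
    · rw [Finset.erase_eq_of_notMem hx] at h1
      omega

/-- One selected copy per landmark transfers counts of vertices to counts of independent virtual
nodes. -/
theorem exists_selected_nodes {k : Fin h} {ω : W.Outcome h} (T : Finset (Fin n))
    (hT : T ⊆ W.landmarks h ω (k.val + 1)) :
    ∃ S : Finset W.VNode, S.card = T.card ∧ ∀ y ∈ S, y ∈ ω k ∧ y.1 ∈ T := by
  have h1 : ∀ v : T, ∃ c : Fin (W.copies v.1), (⟨v.1, c⟩ : W.VNode) ∈ ω k := fun v =>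
    mem_landmarks.1 (hT v.2)
  choose c hc using h1
  refine ⟨Finset.univ.image fun v : T => (⟨v.1, c v⟩ : W.VNode), ?_, ?_⟩
  · rw [Finset.card_image_of_injective]
    · simp
    · intro a b hab
      exact Subtype.ext (congrArg Sigma.fst hab)
  · intro y hy
    obtain ⟨v, -, rfl⟩ := Finset.mem_image.1 hy
    exact ⟨hc v, v.2⟩

/-! ### Powers in the binomial basis, and the moment bounds -/

theorem sq_eq_choose (m : ℕ) : m ^ 2 = m + 2 * m.choose 2 := by
  induction m with
  | zero => simp
  | succ m ih =>
    rw [Nat.choose_succ_succ' m 1, Nat.choose_one_right, add_sq, ih]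
    ring

theorem pow_three_eq_choose (m : ℕ) : m ^ 3 = m + 6 * m.choose 2 + 6 * m.choose 3 := by
  induction m with
  | zero => simp
  | succ m ih =>
    have h2 := sq_eq_choose m
    rw [Nat.choose_succ_succ' m 1, Nat.choose_succ_succ' m 2, Nat.choose_one_right]
    have : (m + 1) ^ 3 = m ^ 3 + 3 * m ^ 2 + 3 * m + 1 := by ring
    rw [this, ih, h2]
    ring

theorem pow_four_eq_choose (m : ℕ) :
    m ^ 4 = m + 14 * m.choose 2 + 36 * m.choose 3 + 24 * m.choose 4 := by
  induction m with
  | zero => simp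
  | succ m ih =>
    have h2 := sq_eq_choose m
    have h3 := pow_three_eq_choose m
    rw [Nat.choose_succ_succ' m 1, Nat.choose_succ_succ' m 2, Nat.choose_succ_succ' m 3,
      Nat.choose_one_right]
    have : (m + 1) ^ 4 = m ^ 4 + 4 * m ^ 3 + 6 * m ^ 2 + 4 * m + 1 := by ring
    rw [this, ih, h3, h2]
    ring

theorem succ_pow_three_eq_choose (m : ℕ) :
    (m + 1) ^ 3 = 1 + 7 * m.choose 1 + 12 * m.choose 2 + 6 * m.choose 3 := by
  have h2 := sq_eq_choose m
  have h3 := pow_three_eq_choose m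
  have : (m + 1) ^ 3 = m ^ 3 + 3 * m ^ 2 + 3 * m + 1 := by ring
  rw [this, h3, h2, Nat.choose_one_right]
  ring

/-- 75 = 1 + 14 + 36 + 24, each binomial moment being at most μ^4 because μ ≥ 1. -/
theorem expect_selCount_pow_four_le (hn : 2 ≤ n) (k : Fin h) (l : List W.VNode) (hl : l.Nodup)
    {μ : ℝ} (hμ : 1 ≤ μ) (hle : l.length * W.selProb h (k.val + 1) ≤ μ) :
    W.expect h (fun ω => (selCount k ω l : ℝ) ^ 4) ≤ 75 * μ ^ 4 := by
  have h0 : (0 : ℝ) ≤ l.length * W.selProb h (k.val + 1) :=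
    mul_nonneg (Nat.cast_nonneg _) (selProb_pos hn _).le
  have hj : ∀ j ≤ 4, W.expect h (fun ω => ((selCount k ω l).choose j : ℝ)) ≤ μ ^ 4 := fun j hj =>
    (expect_choose_selCount_le hn k l hl j).trans
      ((pow_le_pow_left₀ h0 hle j).trans (pow_le_pow_right₀ hμ hj))
  have heq : (fun ω : W.Outcome h => (selCount k ω l : ℝ) ^ 4) = fun ω =>
      ((selCount k ω l).choose 1 : ℝ) + 14 * ((selCount k ω l).choose 2 : ℝ) +
        36 * ((selCount k ω l).choose 3 : ℝ) + 24 * ((selCount k ω l).choose 4 : ℝ) := by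
    funext ω
    rw [Nat.choose_one_right]
    exact_mod_cast pow_four_eq_choose (selCount k ω l)
  rw [heq, expect_add, expect_add, expect_add, expect_mul_left, expect_mul_left, expect_mul_left]
  have h1 := hj 1 (by norm_num)
  have h2 := hj 2 (by norm_num)
  have h3 := hj 3 (by norm_num)
  have h4 := hj 4 (by norm_num)
  linarith

/-- 26 = 1 + 7 + 12 + 6, by the same argument with c ≥ 1. -/
theorem expect_succ_ballCount_pow_three_le (hn : 2 ≤ n) {k k' : Fin h} (hk : k ≠ k') {c : ℝ}
    (hc : W.selProb h (k.val + 1) = W.selProb h (k'.val + 1) * c) (hc1 : 1 ≤ c)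
    (l : List W.VNode) (hl : l.Nodup) :
    W.expect h (fun ω => ((ballCount k k' ω l : ℝ) + 1) ^ 3) ≤ 26 * c ^ 3 := by
  have hj : ∀ j ≤ 3, W.expect h (fun ω => ((ballCount k k' ω l).choose j : ℝ)) ≤ c ^ 3 :=
    fun j hj => (expect_choose_ballCount_le hn hk hc l hl j).trans (pow_le_pow_right₀ hc1 hj)
  have heq : (fun ω : W.Outcome h => ((ballCount k k' ω l : ℝ) + 1) ^ 3) = fun ω =>
      1 + 7 * ((ballCount k k' ω l).choose 1 : ℝ) + 12 * ((ballCount k k' ω l).choose 2 : ℝ) +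
        6 * ((ballCount k k' ω l).choose 3 : ℝ) := by
    funext ω
    exact_mod_cast succ_pow_three_eq_choose (ballCount k k' ω l)
  rw [heq, expect_add, expect_add, expect_add, expect_mul_left, expect_mul_left, expect_mul_left,
    expect_const]
  have h1 := hj 1 (by norm_num)
  have h2 := hj 2 (by norm_num)
  have h3 := hj 3 (by norm_num)
  have h4 : (1 : ℝ) ≤ c ^ 3 := one_le_pow₀ hc1
  linarith

theorem card_vNode : (Fintype.card W.VNode : ℝ) = ∑ u, (W.copies u : ℝ) := by
  rw [Fintype.card_sigma]
  simp

/-- At the top level p = n^(-3/4), so at most 3n nodes give mean at most 3n^(1/4); the constant is 7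
+ 24·75·81. -/
theorem expect_levelSize_top_le (hc : W.graph.Connected) (hn : 2 ≤ n) (hh : 1 ≤ h) :
    W.expect h (fun ω => (W.levelSize h (W.landmarks h ω) h : ℝ)) ≤ 145807 * n := by
  obtain ⟨k, hk⟩ : ∃ k : Fin h, k.val + 1 = h := ⟨⟨h - 1, by omega⟩, by simp; omega⟩
  have hn' : (1 : ℝ) ≤ n := by exact_mod_cast (by omega : 1 ≤ n)
  set l : List W.VNode := Finset.univ.toList with hl
  have hsel : (n : ℝ) * W.selProb h (k.val + 1) = (n : ℝ) ^ (1 / 4 : ℝ) := by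
    rw [selProb_eq hn, hk]
    nth_rewrite 1 [← Real.rpow_one (n : ℝ)]
    rw [← Real.rpow_add (by linarith)]
    norm_num
  have hlen : (l.length : ℝ) * W.selProb h (k.val + 1) ≤ 3 * (n : ℝ) ^ (1 / 4 : ℝ) := by
    rw [hl, Finset.length_toList, Finset.card_univ, card_vNode, ← hsel, ← mul_assoc]
    exact mul_le_mul_of_nonneg_right (sum_copies_le hc hn) (selProb_pos hn _).le
  have hone : (1 : ℝ) ≤ (n : ℝ) ^ (1 / 4 : ℝ) := Real.one_le_rpow hn' (by norm_num)
  have h1 := expect_selCount_pow_four_le hn k l (Finset.nodup_toList _) (by linarith) hlen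
  have h2 : (3 * (n : ℝ) ^ (1 / 4 : ℝ)) ^ 4 = 81 * n := by
    rw [mul_pow, ← Real.rpow_natCast ((n : ℝ) ^ (1 / 4 : ℝ)), ← Real.rpow_mul (by linarith)]
    norm_num
  rw [h2] at h1
  have h3 : ∀ ω : W.Outcome h, (W.levelSize h (W.landmarks h ω) h : ℝ) ≤
      7 * n + 24 * (selCount k ω l : ℝ) ^ 4 := by
    intro ω
    have h4 := levelSize_top_le (h := h) hc (W.landmarks h ω)
    obtain ⟨S, hS1, hS2⟩ := exists_selected_nodes (k := k) (ω := ω) (W.landmarks h ω h)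
      (by rw [hk])
    have h5 := card_le_selCount k ω l S fun y hy => ⟨by simp [hl], (hS2 y hy).1⟩
    rw [hS1] at h5
    have h6 := Nat.pow_le_pow_left h5 4
    exact_mod_cast h4.trans (by omega)
  refine (expect_mono hn h3).trans ?_
  rw [expect_add, expect_const, expect_mul_left]
  linarith

/-- The virtual nodes of the vertices other than `u`, ordered by their distance to `u`. -/
def sortedNodes (W : WGraph n) (u : Fin n) : List W.VNode :=
  (Finset.univ.filter fun y : W.VNode => y.1 ≠ u).toList.insertionSort
    fun x y => W.dist u x.1 ≤ W.dist u y.1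

theorem mem_sortedNodes {u : Fin n} {y : W.VNode} : y ∈ W.sortedNodes u ↔ y.1 ≠ u := by
  rw [sortedNodes, (List.perm_insertionSort _ _).mem_iff]; simp

theorem nodup_sortedNodes (u : Fin n) : (W.sortedNodes u).Nodup :=
  (List.perm_insertionSort _ _).nodup_iff.2 (Finset.nodup_toList _)

theorem sortedNodes_pairwise (u : Fin n) :
    (W.sortedNodes u).Pairwise fun x y => W.dist u x.1 ≤ W.dist u y.1 := by
  have : Std.Total fun x y : W.VNode => W.dist u x.1 ≤ W.dist u y.1 :=
    ⟨fun x y => le_total _ _⟩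
  have : IsTrans W.VNode fun x y => W.dist u x.1 ≤ W.dist u y.1 :=
    ⟨fun x y z => le_trans⟩
  exact List.pairwise_insertionSort _ _

/-- The copies of the centre `u` are left out of the sorted list, so that the count is independent
of the selection of `u` itself; the summand 1 makes up for `u` as a member of its ball. -/
theorem sum_ballLandmarks_le {k k' : Fin h} (hk : k'.val = k.val + 1) (ω : W.Outcome h) :
    (∑ u ∈ W.landmarks h ω (k.val + 1),
      ((W.ballLandmarks (W.landmarks h ω) (k.val + 1) u).card : ℝ) ^ 3) ≤
    ∑ x : W.VNode, if x ∈ ω k then ((ballCount k k' ω (W.sortedNodes x.1) : ℝ) + 1) ^ 3 else 0 := by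
  obtain ⟨S, hS1, hS2⟩ := exists_selected_nodes (k := k) (ω := ω) _ subset_rfl
  have hball : ∀ u, ((W.ballLandmarks (W.landmarks h ω) (k.val + 1) u).card : ℝ) ≤
      (ballCount k k' ω (W.sortedNodes u) : ℝ) + 1 := by
    intro u
    obtain ⟨S, hS1, hS2⟩ := exists_selected_nodes (k := k) (ω := ω)
      ((W.ballLandmarks (W.landmarks h ω) (k.val + 1) u).erase u)
      ((Finset.erase_subset _ _).trans (Finset.filter_subset _ _))
    have h1 := card_le_ballCount (k := k) (k' := k') ω u _ (sortedNodes_pairwise u) S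
      fun y hy => by
        obtain ⟨h2, h3⟩ := hS2 y hy
        rw [Finset.mem_erase, ballLandmarks, Finset.mem_filter] at h3
        refine ⟨mem_sortedNodes.2 h3.1, h2, ?_⟩
        rw [hk]; exact h3.2.2
    rw [hS1] at h1
    have h4 : (W.ballLandmarks (W.landmarks h ω) (k.val + 1) u).card ≤
        ((W.ballLandmarks (W.landmarks h ω) (k.val + 1) u).erase u).card + 1 :=
      by have := Finset.pred_card_le_card_erase (s := W.ballLandmarks (W.landmarks h ω) (k.val + 1) u)
          (a := u); omega
    exact_mod_cast h4.trans (by omega)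
  rw [Fintype.sum_sigma]
  have hnn : ∀ u (c : Fin (W.copies u)), (0 : ℝ) ≤ if (⟨u, c⟩ : W.VNode) ∈ ω k then
      ((ballCount k k' ω (W.sortedNodes u) : ℝ) + 1) ^ 3 else 0 := fun u c => by
    split_ifs <;> positivity
  refine (Finset.sum_le_sum fun u hu => ?_).trans (Finset.sum_le_sum_of_subset_of_nonneg
    (Finset.subset_univ (W.landmarks h ω (k.val + 1)))
    fun u _ _ => Finset.sum_nonneg fun c _ => hnn u c)
  obtain ⟨c, hc⟩ := mem_landmarks.1 hu
  refine le_trans ?_ (Finset.single_le_sum (fun c _ => hnn u c) (Finset.mem_univ c))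
  rw [if_pos hc]
  exact pow_le_pow_left₀ (Nat.cast_nonneg _) (hball u) 3

theorem expect_levelSize_inner_le (hc : W.graph.Connected) (hn : 2 ≤ n) {k k' : Fin h}
    (hk : k'.val = k.val + 1) :
    W.expect h (fun ω => (W.levelSize h (W.landmarks h ω) (k.val + 1) : ℝ)) ≤ 145807 * n := by
  have hn' : (1 : ℝ) ≤ n := by exact_mod_cast (by omega : 1 ≤ n)
  have hne : k ≠ k' := by rintro rfl; omega
  have hi : k.val + 1 ≠ h := by have := k'.is_lt; omega
  have hp := W.selProb_pos (h := h) hn (k.val + 1)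
  set a : ℝ := (3 / 4 : ℝ) ^ (h - (k'.val + 1) + 1) with ha
  have ha0 : 0 < a := by positivity
  have hexp : (3 / 4 : ℝ) ^ (h - (k.val + 1) + 1) = 3 / 4 * a := by
    have : h - (k.val + 1) + 1 = h - (k'.val + 1) + 1 + 1 := by have := k'.is_lt; omega
    rw [this, pow_succ, mul_comm]
  -- The probabilities are n^(-3a/4) at this level and n^(-a) at the next, so their ratio is n^(a/4)
  -- and its cube cancels the first one.
  set c : ℝ := (n : ℝ) ^ (a / 4) with hcdef
  have hc1 : 1 ≤ c := Real.one_le_rpow hn' (by positivity)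
  have hpc : W.selProb h (k.val + 1) = W.selProb h (k'.val + 1) * c := by
    rw [selProb_eq hn, selProb_eq hn, hexp, hcdef, ← Real.rpow_add (by linarith)]
    congr 1; ring
  have hpc3 : W.selProb h (k.val + 1) * c ^ 3 = 1 := by
    rw [selProb_eq hn, hexp, hcdef, ← Real.rpow_natCast, ← Real.rpow_mul (by linarith),
      ← Real.rpow_add (by linarith)]
    rw [show -(3 / 4 * a) + a / 4 * (3 : ℕ) = 0 by push_cast; ring, Real.rpow_zero]
  have h1 : ∀ ω : W.Outcome h, (W.levelSize h (W.landmarks h ω) (k.val + 1) : ℝ) ≤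
      7 * n + 84 * ∑ x : W.VNode,
        if x ∈ ω k then ((ballCount k k' ω (W.sortedNodes x.1) : ℝ) + 1) ^ 3 else 0 := by
    intro ω
    have h2 := levelSize_inner_le (h := h) hc (W.landmarks h ω) hi
    have h3 := sum_ballLandmarks_le hk ω
    have h4 : (W.levelSize h (W.landmarks h ω) (k.val + 1) : ℝ) ≤ 7 * n +
        84 * ∑ u ∈ W.landmarks h ω (k.val + 1),
          ((W.ballLandmarks (W.landmarks h ω) (k.val + 1) u).card : ℝ) ^ 3 := by
      exact_mod_cast h2
    linarith
  refine (expect_mono hn h1).trans ?_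
  rw [expect_add, expect_const, expect_mul_left, expect_sum]
  have h5 : ∀ x : W.VNode, W.expect h (fun ω => if x ∈ ω k then
      ((ballCount k k' ω (W.sortedNodes x.1) : ℝ) + 1) ^ 3 else 0) ≤ 26 := by
    intro x
    have hx : x ∉ W.sortedNodes x.1 := fun hx => mem_sortedNodes.1 hx rfl
    rw [expect_ite k x (B := fun _ => 0)
      ((indep_ballCount k k' k hx).comp fun m => ((m : ℝ) + 1) ^ 3) (fun ω => ⟨rfl, rfl⟩),
      expect_const, mul_zero, add_zero]
    have h6 := expect_succ_ballCount_pow_three_le hn hne hpc hc1 _ (W.nodup_sortedNodes x.1)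
    have h7 := mul_le_mul_of_nonneg_left h6 hp.le
    have h8 : W.selProb h (k.val + 1) * (26 * c ^ 3) = 26 := by
      rw [mul_left_comm, hpc3, mul_one]
    linarith
  have h6 := Finset.sum_le_sum fun x (_ : x ∈ (Finset.univ : Finset W.VNode)) => h5 x
  have h7 : ∑ _x : W.VNode, (26 : ℝ) ≤ 78 * n := by
    rw [Finset.sum_const, Finset.card_univ, nsmul_eq_mul, card_vNode]
    have := sum_copies_le hc hn
    linarith
  linarith

theorem expect_size_le (hc : W.graph.Connected) (hn : 2 ≤ n) :
    W.expect h (fun ω => ((W.lambdaOracle h ω).size : ℝ)) ≤ 145807 * (n * h) := by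
  have h1 : (fun ω : W.Outcome h => ((W.lambdaOracle h ω).size : ℝ)) =
      fun ω => ∑ i ∈ Finset.Icc 1 h, (W.levelSize h (W.landmarks h ω) i : ℝ) := by
    funext ω
    rw [← Nat.cast_sum]
    rfl
  rw [h1, expect_sum]
  have h2 : ∀ i ∈ Finset.Icc 1 h,
      W.expect h (fun ω => (W.levelSize h (W.landmarks h ω) i : ℝ)) ≤ 145807 * n := by
    intro i hi
    rw [Finset.mem_Icc] at hi
    rcases Nat.lt_or_ge i h with hlt | hge
    · have := expect_levelSize_inner_le (h := h) hc hn (k := ⟨i - 1, by omega⟩) (k' := ⟨i, hlt⟩)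
        (by simp; omega)
      simpa only [Nat.sub_add_cancel hi.1] using this
    · obtain rfl : i = h := by omega
      exact expect_levelSize_top_le hc hn hi.1
  refine (Finset.sum_le_sum h2).trans (le_of_eq ?_)
  rw [Finset.sum_const, Nat.card_Icc, nsmul_eq_mul, Nat.add_sub_cancel]
  ring

end WGraph

namespace WGraph

variable {n : ℕ} {W : WGraph n} {h : ℕ}

/-! ## The expected query time and the stretch -/

theorem four_thirds_rpow_logb (h : ℕ) :
    ((4 / 3 : ℝ) ^ h) ^ Real.logb (4 / 3) 7 = 7 ^ h := by
  rw [← Real.rpow_natCast, ← Real.rpow_mul (by norm_num), mul_comm, Real.rpow_mul (by norm_num),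
    Real.rpow_logb (by norm_num) (by norm_num) (by norm_num), Real.rpow_natCast]

theorem hasStretch (hc : W.graph.Connected) (hh : 1 ≤ h) {S : Search n}
    (hS : W.SearchCorrect S) : W.HasStretch S h (((4 / 3 : ℝ) ^ h) ^ Real.logb (4 / 3) 7) := by
  intro ω u v
  obtain ⟨r, h1, h2, -⟩ := query_spec hc hS hh (W.landmarks h ω) u v
  rw [four_thirds_rpow_logb]
  exact ⟨r, h1, W.dist_le_len r, h2⟩

/-- `order` is the landmark-free processing order, to which `expect_scanned_le` applies. The
additive rest 4h + 15 of a query is at most 19h. -/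
theorem expectedTime_le (hc : W.graph.Connected) (hn : 2 ≤ n) (hh : 1 ≤ h) {S : Search n}
    (hS : W.SearchCorrect S) (order : Fin n → List (Fin n)) (hord : ∀ x, (order x).Nodup)
    {a b : ℝ} (hb : 0 ≤ b) (hcost : ∀ halt src target, ((S W.adj halt src target).cost : ℝ) ≤
      a + b * W.scanned halt (order src)) (u v : Fin n) :
    W.expectedTime S h u v ≤ 2 * a +
      2 * b * ((n : ℝ) ^ (1 / (4 / 3 : ℝ) ^ h) * ((W.numEdges : ℝ) / n)) + 19 * h +
      5 * W.expectedHops S h u v := by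
  obtain ⟨k, hk⟩ : ∃ k : Fin h, k.val + 1 = 1 := ⟨⟨0, by omega⟩, rfl⟩
  have hh' : (1 : ℝ) ≤ h := by exact_mod_cast hh
  -- The first level has selection probability n^(-(3/4)^h), and (3/4)^h = 1/t.
  have hinv : (W.numEdges : ℝ) / n / W.selProb h (k.val + 1) =
      (n : ℝ) ^ (1 / (4 / 3 : ℝ) ^ h) * ((W.numEdges : ℝ) / n) := by
    rw [selProb_eq hn, hk, Nat.sub_add_cancel hh, Real.rpow_neg (Nat.cast_nonneg _), div_inv_eq_mul,
      mul_comm]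
    congr 2
    rw [one_div, ← inv_pow]; norm_num
  have hsc : ∀ x, W.expect h (fun ω => (W.scanned (haltAt (W.landmarks h ω 1)) (order x) : ℝ)) ≤
      (n : ℝ) ^ (1 / (4 / 3 : ℝ) ^ h) * ((W.numEdges : ℝ) / n) := by
    intro x
    have := expect_scanned_le hc hn k (order x) (hord x)
    rw [hinv] at this
    simpa only [hk] using this
  have hpt : ∀ ω : W.Outcome h, ((W.answer S h ω u v).cost : ℝ) ≤
      (2 * a + 4 * h + 15) + b * W.scanned (haltAt (W.landmarks h ω 1)) (order v) +
      b * W.scanned (haltAt (W.landmarks h ω 1)) (order u) +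
      5 * (((W.answer S h ω u v).val.length - 1 : ℕ) : ℝ) := by
    intro ω
    obtain ⟨r, h1, -, h3⟩ := query_spec hc hS hh (W.landmarks h ω) u v
    change (W.answer S h ω u v).val = _ at h1
    change (W.answer S h ω u v).cost ≤ _ at h3
    rw [h1, SimpleGraph.Walk.length_support, Nat.add_sub_cancel]
    rw [SimpleGraph.Walk.length_support] at h3
    have h4 : ((W.answer S h ω u v).cost : ℝ) ≤ (S W.adj (haltAt (W.landmarks h ω 1)) v u).cost +
        (S W.adj (haltAt (W.landmarks h ω 1)) u v).cost + 4 * h + 5 * (r.length + 1) + 10 := by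
      exact_mod_cast h3
    have h5 := hcost (haltAt (W.landmarks h ω 1)) v u
    have h6 := hcost (haltAt (W.landmarks h ω 1)) u v
    linarith
  refine (expect_mono hn hpt).trans ?_
  rw [expect_add, expect_add, expect_add, expect_const, expect_mul_left, expect_mul_left,
    expect_mul_left]
  have h1 := mul_le_mul_of_nonneg_left (hsc v) hb
  have h2 := mul_le_mul_of_nonneg_left (hsc u) hb
  change _ + 5 * W.expectedHops S h u v ≤ _
  linarith

theorem expectedHops_nonneg (hn : 2 ≤ n) (S : Search n) (u v : Fin n) :
    0 ≤ W.expectedHops S h u v :=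
  expect_nonneg hn fun _ => Nat.cast_nonneg _

/-- n² + 2 ≤ n³ for n ≥ 2, and log 2 ≥ 1/2, so the factor is 3·2. -/
theorem natLog_le (hn : 2 ≤ n) : (Nat.log 2 (n * n + 2) : ℝ) ≤ 6 * Real.log n := by
  have h1 : 2 ^ Nat.log 2 (n * n + 2) ≤ n ^ 3 := by
    refine (Nat.pow_log_le_self 2 (by omega)).trans ?_
    obtain ⟨m, rfl⟩ := Nat.exists_eq_add_of_le hn
    ring_nf
    nlinarith [Nat.zero_le (m ^ 3), Nat.zero_le (m ^ 2)]
  have h2 : (2 : ℝ) ^ Nat.log 2 (n * n + 2) ≤ (n : ℝ) ^ 3 := by exact_mod_cast h1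
  have h3 := Real.log_le_log (by positivity) h2
  rw [Real.log_pow, Real.log_pow] at h3
  have h4 : (1 / 2 : ℝ) ≤ Real.log 2 := by have := Real.log_two_gt_d9; linarith
  have h5 := mul_le_mul_of_nonneg_left h4 (Nat.cast_nonneg (α := ℝ) (Nat.log 2 (n * n + 2)))
  push_cast at h3
  linarith

theorem le_four_mul_log (h : ℕ) : (h : ℝ) ≤ 4 * Real.log ((4 / 3 : ℝ) ^ h) := by
  have h1 := Real.one_sub_inv_le_log_of_pos (show (0 : ℝ) < 4 / 3 by norm_num)
  rw [Real.log_pow]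
  have h2 : (1 / 4 : ℝ) ≤ Real.log (4 / 3) := by norm_num at h1 ⊢; linarith
  have := mul_le_mul_of_nonneg_left h2 (Nat.cast_nonneg (α := ℝ) h)
  linarith

theorem half_le_searchBound (hc : W.graph.Connected) (hn : 2 ≤ n) :
    (1 / 2 : ℝ) ≤ (n : ℝ) ^ (1 / (4 / 3 : ℝ) ^ h) * ((W.numEdges : ℝ) / n) := by
  have h1 : (1 : ℝ) ≤ (n : ℝ) ^ (1 / (4 / 3 : ℝ) ^ h) :=
    Real.one_le_rpow (by exact_mod_cast (by omega : 1 ≤ n)) (by positivity)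
  have h2 := half_le_ratio hc hn
  nlinarith

theorem half_le_log (hn : 2 ≤ n) : (1 / 2 : ℝ) ≤ Real.log n := by
  have h1 := Real.log_two_gt_d9
  have h2 := Real.log_le_log (by norm_num) (show (2 : ℝ) ≤ n by exact_mod_cast hn)
  linarith

theorem expectedTime_bfs_le (hc : W.graph.Connected) (hu : W.Unweighted) (hn : 2 ≤ n)
    (hh : 1 ≤ h) (u v : Fin n) : W.expectedTime bfs h u v ≤
      6 * ((n : ℝ) ^ (1 / (4 / 3 : ℝ) ^ h) * ((W.numEdges : ℝ) / n)) +
      84 * Real.log ((4 / 3 : ℝ) ^ h) + 5 * W.expectedHops bfs h u v := by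
  have h1 := expectedTime_le hc hn hh (bfs_correct hc hu) _
    (fun x => (bfsOrder_nodup hc hu (n + 1) _ (init_bInv x)).1) (a := 1) (b := 3) (by norm_num)
    (fun halt src target => by exact_mod_cast bfs_cost_le hc hn halt src target) u v
  have h2 := le_four_mul_log h
  have h3 : (1 : ℝ) ≤ h := by exact_mod_cast hh
  linarith

theorem expectedTime_dijkstra_le (hc : W.graph.Connected) (hn : 2 ≤ n)
    (hh : 1 ≤ h) (u v : Fin n) : W.expectedTime dijkstra h u v ≤
      140 * ((n : ℝ) ^ (1 / (4 / 3 : ℝ) ^ h) * ((W.numEdges : ℝ) / n) * Real.log n) +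
      76 * Real.log ((4 / 3 : ℝ) ^ h) + 5 * W.expectedHops dijkstra h u v := by
  have h1 := expectedTime_le hc hn hh (dijkstra_correct hc) _
    (fun x => (dijkstraOrder_nodup (n * n + 2) _ (init_dInv (W := W) x).heap_ok).1)
    (a := 2 * (Nat.log 2 (n * n + 2) : ℝ) + 4) (b := 3 * (Nat.log 2 (n * n + 2) : ℝ) + 6)
    (by positivity)
    (fun halt src target => by exact_mod_cast dijkstra_cost_le halt src target) u v
  have h2 := le_four_mul_log h
  have h3 := natLog_le hn
  have h4 := half_le_log hn
  have h5 := half_le_searchBound (h := h) hc hn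
  generalize (n : ℝ) ^ (1 / (4 / 3 : ℝ) ^ h) * ((W.numEdges : ℝ) / n) = X at *
  generalize (Nat.log 2 (n * n + 2) : ℝ) = K at *
  -- K ≤ 6 log n and 1 ≤ 2 log n give 30 log n here and 40 log n for the additive terms; as X ≥ 1/2
  -- the total is 2·30 + 2·40 = 140.
  have h6 : (3 * K + 6) * X ≤ 30 * Real.log n * X :=
    mul_le_mul_of_nonneg_right (by linarith) (by linarith)
  have h7 : Real.log n * (1 / 2) ≤ Real.log n * X :=
    mul_le_mul_of_nonneg_left h5 (by linarith)
  linarith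

end WGraph

end PathOracle

end

/-! ### The final bounds -/

theorem corollary3 :
    ∃ C : ℝ, 0 < C ∧
      ∀ (h n : ℕ) (t : ℝ) (W : PathOracle.WGraph n),
        1 ≤ h → t = (4 / 3 : ℝ) ^ h → 2 ≤ n → W.graph.Connected →
          W.expect h (fun ω => ((W.lambdaOracle h ω).size : ℝ)) ≤ C * ((n : ℝ) * h) ∧
          W.HasStretch PathOracle.dijkstra h (t ^ Real.logb (4 / 3) 7) ∧
          (∀ u v : Fin n,
            W.expectedTime PathOracle.dijkstra h u v ≤
              C * ((n : ℝ) ^ (1 / t) * ((W.numEdges : ℝ) / n) * Real.log n + Real.log t +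
                W.expectedHops PathOracle.dijkstra h u v)) ∧
          (t ≤ n → ∀ u v : Fin n,
            W.expectedTime PathOracle.dijkstra h u v ≤
              C * ((n : ℝ) ^ (1 / t) * ((W.numEdges : ℝ) / n) * Real.log n +
                W.expectedHops PathOracle.dijkstra h u v)) ∧
          (W.Unweighted →
            W.HasStretch PathOracle.bfs h (t ^ Real.logb (4 / 3) 7) ∧
            ∀ u v : Fin n,
              W.expectedTime PathOracle.bfs h u v ≤
                C * ((n : ℝ) ^ (1 / t) * ((W.numEdges : ℝ) / n) + Real.log t +
                  W.expectedHops PathOracle.bfs h u v)) := by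
  -- The space bound dictates the constant; those of the query times are far smaller.
  refine ⟨145807, by norm_num, fun h n t W hh ht hn hc => ?_⟩
  subst ht
  have hX := PathOracle.WGraph.half_le_searchBound (h := h) hc hn
  have hlog := PathOracle.WGraph.half_le_log hn
  have hlt := PathOracle.WGraph.le_four_mul_log h
  have hh' : (1 : ℝ) ≤ h := by exact_mod_cast hh
  have hXl := mul_le_mul_of_nonneg_right hX (show (0 : ℝ) ≤ Real.log n by linarith)
  refine ⟨PathOracle.WGraph.expect_size_le hc hn,
    PathOracle.WGraph.hasStretch hc hh (PathOracle.WGraph.dijkstra_correct hc),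
    fun u v => ?_, fun htn u v => ?_, fun hu =>
    ⟨PathOracle.WGraph.hasStretch hc hh (PathOracle.WGraph.bfs_correct hc hu), fun u v => ?_⟩⟩
  · have h1 := PathOracle.WGraph.expectedTime_dijkstra_le hc hn hh u v
    have h2 := PathOracle.WGraph.expectedHops_nonneg (W := W) (h := h) hn PathOracle.dijkstra u v
    linarith
  · have h1 := PathOracle.WGraph.expectedTime_dijkstra_le hc hn hh u v
    have h2 := PathOracle.WGraph.expectedHops_nonneg (W := W) (h := h) hn PathOracle.dijkstra u v
    -- For t ≤ n, log t ≤ log n, which is at most twice the main term by `hXl`.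
    have h3 := Real.log_le_log (by positivity) htn
    linarith
  · have h1 := PathOracle.WGraph.expectedTime_bfs_le hc hu hn hh u v
    have h2 := PathOracle.WGraph.expectedHops_nonneg (W := W) (h := h) hn PathOracle.bfs u v
    linarith
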